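/- \textbf{Conventions.} All vector fields are planar and real analytic in a neighbourhood of the origin. The origin is a \emph{non-degenerate monodromic singularity} of $V$ if $V(0,0)=0$ and the eigenvalues of the linear part $DV(0,0)$ have non-zero imaginary part. Its \emph{semi-monodromy map} $h$ is defined for small $x\neq 0$ by letting $(h(x),0)$ be the first point at which the forward trajectory of $V$ starting at $(x,0)$ meets the $x$-axis again. For $k\in\mathbb N_0$, the singularity is a \emph{focus of order $k$} if $h(h(x))-x=\alpha x^{2k+1}+o(x^{2k+1})$ as $x\to0$, for some $\alpha\neq 0$. Let $V_1$ and $V_2$ have foci (of some orders) at the origin and assume that the flow turns counter-clockwise, i.e. the second components $N_i$ of $V_i$ satisfy $\operatorname{sgn}N_1(x,0)=\operatorname{sgn}N_2(x,0)=\operatorname{sgn}x$ for all small $x$. Then the origin is a \emph{pseudo focus} (of focus-focus type) of the piecewise analytic field $V=\mathbf 1_{\{y>0\}}V_1+\mathbf 1_{\{y<0\}}V_2$, whose trajectories follow $V_1$ in $\{y>0\}$, follow $V_2$ in $\{y<0\}$, and switch when they cross the $x$-axis. Let $P$ be its first return map to the positive $x$-semiaxis. For $k\in\mathbb N=\{1,2,\dots\}$,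 the pseudo focus is \emph{of order $k$} if $P(x)=x+\alpha x^k+o(x^k)$ as $x\to0^+$, for some $\alpha\neq0$. \textbf{Theorem (Realization of FF type pseudo foci).} Let $k_1\ge k_2\ge 0$ be integers. \begin{enumerate} \item If $k_1=k_2$, then for every $k\in\mathbb N$, $k\ge1$, the following holds: there exist analytic vector fields $V_1$ and $V_2$, with foci of order $k_1$ and $k_2$ at the origin respectively, such that the piecewise analytic vector field $V=\mathbf 1_{\{y>0\}}V_1+\mathbf 1_{\{y<0\}}V_2$ has a pseudo focus of order $k$ at the origin, if and only if $k\ge 2k_1+1=2k_2+1$ or $k$ is even. \item If $k_1>k_2$, then for every $k\in\mathbb N$, $k\ge1$, the following holds: there exist analytic vector fields $V_1$ and $V_2$, with foci of order $k_1$ and $k_2$ at the origin respectively, such that the piecewise analytic vector field $V=\mathbf 1_{\{y>0\}}V_1+\mathbf 1_{\{y<0\}}V_2$ has a pseudo focus of order $k$ at the origin, if and only if $k=2k_2+1$, or $k$ is even and $k<2k_2+1$. \end{enumerate} -/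

import Mathlib

open Filter Topology Asymptotics Set

/-- The origin is a non-degenerate monodromic singularity of the planar vector field `V`, analytic
in a neighbourhood of the origin: `V` vanishes at the origin and the (complex) eigenvalues of its
linear part there have non-zero imaginary part. The field is a total function, but only its
restriction to small neighbourhoods of the origin matters. -/
structure IsNondegenerateMonodromic (V : ℝ × ℝ → ℝ × ℝ) : Prop where
  analytic : AnalyticAt ℝ V 0
  singular : V 0 = 0
  eigenvalues : ∀ z : ℂ,
    Polynomial.aeval z (LinearMap.charpoly (fderiv ℝ V 0 : ℝ × ℝ →ₗ[ℝ] ℝ × ℝ)) = 0 → z.im ≠ 0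

/-- The forward trajectory of `V` starting at `(x, 0)` meets the `x`-axis again for the first time
at the point `(x', 0)`. -/
def FirstHit (V : ℝ × ℝ → ℝ × ℝ) (x x' : ℝ) : Prop :=
  ∃ (T : ℝ) (γ : ℝ → ℝ × ℝ), 0 < T ∧ γ 0 = (x, 0) ∧ γ T = (x', 0) ∧
    IsIntegralCurveOn γ (fun _ => V) (Icc 0 T) ∧ ∀ t ∈ Ioo 0 T, (γ t).2 ≠ 0

/-- `h` is (a representative of the germ at `0` of) the semi-monodromy map of `V`, with the
`x`-axis, parametrized by `x ↦ (x, 0)`, as transversal. -/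
def IsSemiMonodromy (V : ℝ × ℝ → ℝ × ℝ) (h : ℝ → ℝ) : Prop :=
  ∀ᶠ x in 𝓝[≠] (0 : ℝ), FirstHit V x (h x)

/-- The origin is a (non-degenerate) focus of order `k` of the analytic vector field `V`: the
monodromy map `h ∘ h`, where `h` is the semi-monodromy map, satisfies
`h (h x) - x = α x ^ (2 k + 1) + o(x ^ (2 k + 1))` as `x → 0`, with `α ≠ 0`. -/
def HasFocusOfOrder (V : ℝ × ℝ → ℝ × ℝ) (k : ℕ) : Prop :=
  IsNondegenerateMonodromic V ∧
    ∃ h : ℝ → ℝ, IsSemiMonodromy V h ∧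
      ∃ α : ℝ, α ≠ 0 ∧
        (fun x : ℝ => h (h x) - x - α * x ^ (2 * k + 1)) =o[𝓝[≠] 0]
          fun x : ℝ => x ^ (2 * k + 1)

/-- The piecewise analytic field `𝟙_{y > 0} V₁ + 𝟙_{y < 0} V₂`. -/
noncomputable def gluing (V₁ V₂ : ℝ × ℝ → ℝ × ℝ) (p : ℝ × ℝ) : ℝ × ℝ :=
  {q : ℝ × ℝ | 0 < q.2}.indicator V₁ p + {q : ℝ × ℝ | q.2 < 0}.indicator V₂ p

/-- The flow direction of the two fields along the `x`-axis near the origin is counter-clockwise: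
`sgn N₁(x, 0) = sgn N₂(x, 0) = sgn x`, where `Nᵢ` is the second component of `Vᵢ`. -/
def IsCounterclockwise (V₁ V₂ : ℝ × ℝ → ℝ × ℝ) : Prop :=
  ∀ᶠ x in 𝓝[≠] (0 : ℝ),
    SignType.sign (V₁ (x, 0)).2 = SignType.sign x ∧ SignType.sign (V₂ (x, 0)).2 = SignType.sign x

/-- The origin is a pseudo focus of FF (focus-focus) type of the gluing of `V₁` (in the upper
half plane) and `V₂` (in the lower half plane). -/
def IsFFPseudoFocus (V₁ V₂ : ℝ × ℝ → ℝ × ℝ) : Prop :=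
  (∃ k₁, HasFocusOfOrder V₁ k₁) ∧ (∃ k₂, HasFocusOfOrder V₂ k₂) ∧ IsCounterclockwise V₁ V₂

/-- The trajectory of the gluing of `V₁` and `V₂` that starts at `(x, 0)`, `x > 0`, returns to the
positive `x`-semiaxis for the first time at `(x', 0)`. It is a continuous curve that moves in the
upper half plane until a time `S`, when it crosses the negative `x`-semiaxis, then in the lower
half plane until it returns at a time `T`, and follows the piecewise field
off the `x`-axis. -/
def IsFirstReturn (V₁ V₂ : ℝ × ℝ → ℝ × ℝ) (x x' : ℝ) : Prop :=
  0 < x ∧ 0 < x' ∧ ∃ (S T : ℝ) (γ : ℝ → ℝ × ℝ), 0 < S ∧ S < T ∧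
    ContinuousOn γ (Icc 0 T) ∧
    γ 0 = (x, 0) ∧ (γ S).1 < 0 ∧ (γ S).2 = 0 ∧ γ T = (x', 0) ∧
    (∀ t ∈ Ioo 0 S, 0 < (γ t).2) ∧ (∀ t ∈ Ioo S T, (γ t).2 < 0) ∧
    ∀ t ∈ Ioo 0 T, t ≠ S → HasDerivAt γ (gluing V₁ V₂ (γ t)) t

/-- The origin is an FF type pseudo focus of order `k` of the gluing of `V₁` and `V₂`: the first
return map `P` on the positive `x`-semiaxis satisfies `P x = x + α x ^ k + o(x ^ k)` as `x → 0+`,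
with `α ≠ 0`. -/
def HasFFPseudoFocusOfOrder (V₁ V₂ : ℝ × ℝ → ℝ × ℝ) (k : ℕ) : Prop :=
  IsFFPseudoFocus V₁ V₂ ∧
    ∃ P : ℝ → ℝ, (∀ᶠ x in 𝓝[>] (0 : ℝ), IsFirstReturn V₁ V₂ x (P x)) ∧
      ∃ α : ℝ, α ≠ 0 ∧
        (fun x : ℝ => P x - x - α * x ^ k) =o[𝓝[>] 0] fun x : ℝ => x ^ k

/-! Necessity is a computation with jets. In polar coordinates the end point of a half turn has an
expansion to every order in its starting point (`IsNondegenerateMonodromic.exists_jet`), so the two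
semi-monodromy maps have polynomial jets p₁, p₂ with negative slope, and the return map has jet p₂ ∘
p₁. A focus of order k makes its jet an involution modulo x^(2k+1), and not modulo x^(2k+2).

If k < 2k₂ + 1, both jets are involutions of slope -1 modulo x^(k+1). For odd k, p₂ ∘ p₁ = x + αx^k
forces p₂ = p₁ - αx^k, and then p₂ ∘ p₂ = x + 2αx^k, so α = 0 (`eq_zero_of_involutions`). If k₂ < k₁
and k > 2k₂ + 1, then modulo x^(2k₂+2) the jet p₂ inverts the involution p₁, so p₂ is an involution
too, against the order of the second focus (`involution_of_comp`). Both arguments meet in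
`HasFFPseudoFocusOfOrder.order`.

Sufficiency uses explicit fields: θ' = 1, r' = r F(r²), pulled back by (x, y) ↦ (x + bx^k, y). With
ψ(x) = x + bx^k, a half turn is x ↦ ψ⁻¹(-ψ(x) e^λ(ψ(x))), λ being the even logarithmic growth
determined by F. The order of the focus depends on F alone, while b enters the return map when only
the lower field is pulled back. For even k the change of coordinate contributes -2bx^k at leading
order; odd orders come from the growths: 2k₂ + 1 if they have the same sign, and a larger odd order
if their leading terms cancel and a higher term of F survives. For k₁ = k₂ = 0, constant growths e^π
and e^(-π) act on the term bx^k and give every k ≥ 2. -/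

/-! ### The linear part and its angular velocity. -/

theorem aeval_charpoly_prod (L : ℝ × ℝ →L[ℝ] ℝ × ℝ) (z : ℂ) :
    Polynomial.aeval z (LinearMap.charpoly (L : ℝ × ℝ →ₗ[ℝ] ℝ × ℝ)) =
      z ^ 2 - ((L (1, 0)).1 + (L (0, 1)).2 : ℝ) * z +
        ((L (1, 0)).1 * (L (0, 1)).2 - (L (0, 1)).1 * (L (1, 0)).2 : ℝ) := by
  rw [← LinearMap.charpoly_toMatrix _ (Module.Basis.finTwoProd ℝ), Matrix.charpoly_fin_two]
  simp only [Matrix.trace_fin_two, Matrix.det_fin_two, LinearMap.toMatrix_apply,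
    Module.Basis.finTwoProd_zero, Module.Basis.finTwoProd_one, Module.Basis.coe_finTwoProd_repr]
  simp

theorem disc_neg_of_charpoly (L : ℝ × ℝ →L[ℝ] ℝ × ℝ)
    (h : ∀ z : ℂ, Polynomial.aeval z (LinearMap.charpoly (L : ℝ × ℝ →ₗ[ℝ] ℝ × ℝ)) = 0 → z.im ≠ 0) :
    ((L (0, 1)).2 - (L (1, 0)).1) ^ 2 + 4 * (L (0, 1)).1 * (L (1, 0)).2 < 0 := by
  by_contra hd
  push Not at hd
  set a := (L (1, 0)).1
  set b := (L (0, 1)).1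
  set c := (L (1, 0)).2
  set d := (L (0, 1)).2
  -- With a non-negative discriminant, the larger root of the characteristic polynomial is a real
  -- eigenvalue.
  refine h (((a + d + √((d - a) ^ 2 + 4 * b * c)) / 2 : ℝ) : ℂ) ?_ (Complex.ofReal_im _)
  rw [aeval_charpoly_prod]
  have hs := Real.sq_sqrt hd
  norm_cast
  change _ - (a + d) * _ + (a * d - b * c) = 0
  nlinarith

/-- A definite binary quadratic form with positive leading coefficient is coercive. -/
theorem exists_pos_le_quadratic {a b c : ℝ} (ha : 0 < a) (h : b ^ 2 - 4 * a * c < 0) :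
    ∃ m > 0, ∀ θ : ℝ, m ≤ a * Real.cos θ ^ 2 + b * (Real.cos θ * Real.sin θ) +
      c * Real.sin θ ^ 2 := by
  have hcont : Continuous fun θ : ℝ => a * Real.cos θ ^ 2 + b * (Real.cos θ * Real.sin θ) +
      c * Real.sin θ ^ 2 := by fun_prop
  have hpos : ∀ θ : ℝ, 0 < a * Real.cos θ ^ 2 + b * (Real.cos θ * Real.sin θ) +
      c * Real.sin θ ^ 2 := by
    intro θ
    have h1 := Real.sin_sq_add_cos_sq θ
    have : 0 < 4 * a * (a * Real.cos θ ^ 2 + b * (Real.cos θ * Real.sin θ) +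
      c * Real.sin θ ^ 2) := by
      have : 4 * a * (a * Real.cos θ ^ 2 + b * (Real.cos θ * Real.sin θ) +
        c * Real.sin θ ^ 2) = (2 * a * Real.cos θ + b * Real.sin θ) ^ 2 +
          (4 * a * c - b ^ 2) * Real.sin θ ^ 2 := by ring
      rw [this]
      by_cases hs : Real.sin θ = 0
      · have hc : Real.cos θ ^ 2 = 1 := by rw [hs] at h1; linarith
        rw [hs]
        nlinarith [sq_pos_of_pos ha]
      · have := mul_pos (show 0 < 4 * a * c - b ^ 2 by linarith) (pow_pos (abs_pos.2 hs) 2)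
        rw [sq_abs] at this
        positivity
    exact pos_of_mul_pos_right this (by positivity)
  obtain ⟨θ₀, -, hθ₀⟩ := isCompact_Icc.exists_isMinOn (s := Icc (0 : ℝ) (2 * Real.pi))
    (nonempty_Icc.2 (by positivity)) hcont.continuousOn
  refine ⟨_, hpos θ₀, fun θ => ?_⟩
  obtain ⟨y, hy, hyθ⟩ := (show Function.Periodic (fun θ : ℝ => a * Real.cos θ ^ 2 +
    b * (Real.cos θ * Real.sin θ) + c * Real.sin θ ^ 2) (2 * Real.pi) from fun θ => by
      simp).exists_mem_Ico₀ (by positivity) θ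
  rw [show _ = _ from hyθ]
  exact hθ₀ ⟨hy.1, hy.2.le⟩

theorem fderiv_apply_prod (L : ℝ × ℝ →L[ℝ] ℝ × ℝ) (x y : ℝ) :
    L (x, y) = x • L (1, 0) + y • L (0, 1) := by
  rw [← map_smul, ← map_smul, ← map_add]; simp

/-- The linear part of a counter-clockwise monodromic singularity turns counter-clockwise. -/
theorem IsNondegenerateMonodromic.exists_pos_le_angular {V : ℝ × ℝ → ℝ × ℝ}
    (hV : IsNondegenerateMonodromic V)
    (hcc : ∀ᶠ x in 𝓝[≠] (0 : ℝ), SignType.sign (V (x, 0)).2 = SignType.sign x) :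
    ∃ m > 0, ∀ θ : ℝ, m ≤
      Real.cos θ * (fderiv ℝ V 0 (Real.cos θ, Real.sin θ)).2 -
      Real.sin θ * (fderiv ℝ V 0 (Real.cos θ, Real.sin θ)).1 := by
  set L := fderiv ℝ V 0 with hL
  have hdisc := disc_neg_of_charpoly L hV.eigenvalues
  -- The entry is a limit of quotients N(x, 0) / x, which the sign condition makes positive.
  have hc : 0 ≤ (L (1, 0)).2 := by
    have hd : HasFDerivAt V L 0 := hV.analytic.differentiableAt.hasFDerivAt
    have h1 : HasDerivAt (fun x : ℝ => (V (x, 0)).2) (L (1, 0)).2 0 := by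
      have h2 : HasDerivAt (fun x : ℝ => ((x, 0) : ℝ × ℝ)) (1, 0) 0 :=
        (hasDerivAt_id 0).prodMk (hasDerivAt_const 0 0)
      have h3 : HasDerivAt (fun x : ℝ => V (x, 0)) (L (1, 0)) 0 :=
        HasFDerivAt.comp_hasDerivAt (x := (0:ℝ)) (f := fun x : ℝ => ((x, 0) : ℝ × ℝ)) hd h2
      exact (ContinuousLinearMap.snd ℝ ℝ ℝ).hasFDerivAt.comp_hasDerivAt 0 h3
    have h4 := hasDerivAt_iff_tendsto_slope.1 h1
    refine ge_of_tendsto h4 ?_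
    filter_upwards [hcc, self_mem_nhdsWithin] with x hx hx0
    have hV0 : V (0, 0) = 0 := hV.singular
    simp only [slope, vsub_eq_sub, smul_eq_mul, hV0, sub_zero, Prod.snd_zero]
    rcases lt_or_gt_of_ne (show x ≠ 0 from hx0) with h | h
    · rw [sign_neg h, sign_eq_neg_one_iff] at hx
      exact mul_nonneg_of_nonpos_of_nonpos (inv_nonpos.2 h.le) hx.le
    · rw [sign_pos h, sign_eq_one_iff] at hx
      positivity
  -- If it vanished, the discriminant would be a square.
  have hc' : 0 < (L (1, 0)).2 := by
    refine lt_of_le_of_ne hc fun h => ?_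
    rw [← h] at hdisc
    nlinarith [sq_nonneg ((L (0, 1)).2 - (L (1, 0)).1)]
  obtain ⟨m, hm, h⟩ := exists_pos_le_quadratic (b := (L (0, 1)).2 - (L (1, 0)).1)
    (c := -(L (0, 1)).1) hc' (by linarith)
  refine ⟨m, hm, fun θ => (h θ).trans_eq ?_⟩
  rw [fderiv_apply_prod L (Real.cos θ) (Real.sin θ)]
  simp only [Prod.snd_add, Prod.fst_add, Prod.smul_fst, Prod.smul_snd, smul_eq_mul]
  ring

/-! ### Calculus of uniform expansions along families of curves. -/

/-- Uniform asymptotic expansion to order `n` of a family `f` of functions of time, in powers of the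
small quantity `ε`, with coefficients that are continuous functions of the angle `θ`. -/
def HasUExp {κ : Type*} (T : κ → ℝ) (θ ε : κ → ℝ → ℝ) : ℕ → (κ → ℝ → ℝ) → Prop
  | 0, f => ∃ C, ∀ j, ∀ t ∈ Icc 0 (T j), |f j t| ≤ C
  | n + 1, f => ∃ a : ℝ → ℝ, Continuous a ∧ ∃ g : κ → ℝ → ℝ, HasUExp T θ ε n g ∧
      ∀ j, ∀ t ∈ Icc 0 (T j), f j t = a (θ j t) + ε j t * g j t

namespace HasUExp

variable {κ : Type*} {T : κ → ℝ} {θ ε : κ → ℝ → ℝ} {n : ℕ} {f g : κ → ℝ → ℝ}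

theorem congr (hf : HasUExp T θ ε n f) (h : ∀ j, ∀ t ∈ Icc 0 (T j), g j t = f j t) :
    HasUExp T θ ε n g := by
  cases n with
  | zero => obtain ⟨C, hC⟩ := hf; exact ⟨C, fun j t ht => by rw [h j t ht]; exact hC j t ht⟩
  | succ n =>
    obtain ⟨a, ha, f', hf', e⟩ := hf
    exact ⟨a, ha, f', hf', fun j t ht => by rw [h j t ht, e j t ht]⟩

theorem add (hf : HasUExp T θ ε n f) (hg : HasUExp T θ ε n g) :
    HasUExp T θ ε n (fun j t => f j t + g j t) := by
  induction n generalizing f g with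
  | zero =>
    obtain ⟨C, hC⟩ := hf
    obtain ⟨C', hC'⟩ := hg
    exact ⟨C + C', fun j t ht => (abs_add_le _ _).trans (add_le_add (hC j t ht) (hC' j t ht))⟩
  | succ n ih =>
    obtain ⟨a, ha, f', hf', e⟩ := hf
    obtain ⟨b, hb, g', hg', e'⟩ := hg
    exact ⟨_, ha.add hb, _, ih hf' hg', fun j t ht => by
      simp only [Pi.add_apply, e j t ht, e' j t ht]; ring⟩

theorem neg (hf : HasUExp T θ ε n f) : HasUExp T θ ε n (fun j t => -f j t) := by
  induction n generalizing f with
  | zero =>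
    obtain ⟨C, hC⟩ := hf
    exact ⟨C, fun j t ht => (abs_neg _).trans_le (hC j t ht)⟩
  | succ n ih =>
    obtain ⟨a, ha, f', hf', e⟩ := hf
    exact ⟨_, ha.neg, _, ih hf', fun j t ht => by simp only [Pi.neg_apply, e j t ht]; ring⟩

theorem sub (hf : HasUExp T θ ε n f) (hg : HasUExp T θ ε n g) :
    HasUExp T θ ε n (fun j t => f j t - g j t) :=
  (hf.add hg.neg).congr fun _ _ _ => sub_eq_add_neg _ _

theorem zero : HasUExp T θ ε n (fun _ _ => 0) := by
  induction n with
  | zero => exact ⟨0, fun _ _ _ => by simp⟩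
  | succ n ih => exact ⟨_, continuous_const (y := 0), _, ih, fun _ _ _ => by simp⟩

theorem of_continuous {A B : ℝ} (hθ : ∀ j, ∀ t ∈ Icc 0 (T j), θ j t ∈ Icc A B) {a : ℝ → ℝ}
    (ha : Continuous a) : HasUExp T θ ε n (fun j t => a (θ j t)) := by
  cases n with
  | zero =>
    obtain ⟨C, hC⟩ := (isCompact_Icc (a := A) (b := B)).exists_bound_of_continuousOn
      ha.continuousOn
    exact ⟨C, fun j t ht => hC _ (hθ j t ht)⟩
  | succ n => exact ⟨a, ha, _, zero, fun _ _ _ => by simp⟩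

theorem eps_mul (hf : HasUExp T θ ε n f) : HasUExp T θ ε (n + 1) (fun j t => ε j t * f j t) :=
  ⟨_, continuous_const (y := 0), f, hf, fun _ _ _ => by simp⟩

section

variable {A B : ℝ} (hθ : ∀ j, ∀ t ∈ Icc 0 (T j), θ j t ∈ Icc A B)
  (hε : ∀ j, ∀ t ∈ Icc 0 (T j), |ε j t| ≤ 1)

theorem of_succ {A B : ℝ} (hθ : ∀ j, ∀ t ∈ Icc 0 (T j), θ j t ∈ Icc A B)
    (hε : ∀ j, ∀ t ∈ Icc 0 (T j), |ε j t| ≤ 1) (hf : HasUExp T θ ε (n + 1) f) :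
    HasUExp T θ ε n f := by
  induction n generalizing f with
  | zero =>
    obtain ⟨a, ha, f', ⟨C, hC⟩, e⟩ := hf
    obtain ⟨C', hC'⟩ := of_continuous (n := 0) (ε := ε) hθ ha
    refine ⟨C' + C, fun j t ht => ?_⟩
    rw [e j t ht]
    refine (abs_add_le _ _).trans (add_le_add (hC' j t ht) ?_)
    rw [abs_mul]
    exact (mul_le_of_le_one_left (abs_nonneg _) (hε j t ht)).trans (hC j t ht)
  | succ n ih =>
    obtain ⟨a, ha, f', hf', e⟩ := hf
    exact ⟨a, ha, f', ih hf', e⟩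

theorem mul {A B : ℝ} (hθ : ∀ j, ∀ t ∈ Icc 0 (T j), θ j t ∈ Icc A B)
    (hε : ∀ j, ∀ t ∈ Icc 0 (T j), |ε j t| ≤ 1) (hf : HasUExp T θ ε n f)
    (hg : HasUExp T θ ε n g) : HasUExp T θ ε n (fun j t => f j t * g j t) := by
  induction n generalizing f g with
  | zero =>
    obtain ⟨C, hC⟩ := hf
    obtain ⟨C', hC'⟩ := hg
    refine ⟨C * C', fun j t ht => ?_⟩
    rw [abs_mul]
    exact mul_le_mul (hC j t ht) (hC' j t ht) (abs_nonneg _) ((abs_nonneg _).trans (hC j t ht))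
  | succ n ih =>
    obtain ⟨a, ha, f', hf', e⟩ := hf
    obtain ⟨b, hb, g', hg', e'⟩ := hg
    refine ⟨_, ha.mul hb, _, ((ih (of_continuous hθ ha) hg').add
      (ih (of_continuous hθ hb) hf')).add (of_succ hθ hε (eps_mul (ih hf' hg'))),
      fun j t ht => ?_⟩
    simp only [Pi.mul_apply, e j t ht, e' j t ht]
    ring

theorem of_le {A B : ℝ} (hθ : ∀ j, ∀ t ∈ Icc 0 (T j), θ j t ∈ Icc A B)
    (hε : ∀ j, ∀ t ∈ Icc 0 (T j), |ε j t| ≤ 1) {m : ℕ} (hmn : m ≤ n)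
    (hf : HasUExp T θ ε n f) : HasUExp T θ ε m f := by
  induction n, hmn using Nat.le_induction with
  | base => exact hf
  | succ n _ ih => exact ih (of_succ hθ hε hf)

theorem pow_mul {A B : ℝ} (hθ : ∀ j, ∀ t ∈ Icc 0 (T j), θ j t ∈ Icc A B)
    (hε : ∀ j, ∀ t ∈ Icc 0 (T j), |ε j t| ≤ 1) (hf : HasUExp T θ ε n f) (i : ℕ) :
    HasUExp T θ ε n (fun j t => ε j t ^ i * f j t) := by
  induction i with
  | zero => exact hf.congr fun _ _ _ => by simp
  | succ i ih => exact (of_succ hθ hε ih.eps_mul).congr fun _ _ _ => by ring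

end

theorem sum {ι : Type*} (s : Finset ι) {F : ι → κ → ℝ → ℝ} (h : ∀ i, HasUExp T θ ε n (F i)) :
    HasUExp T θ ε n (fun j t => ∑ i ∈ s, F i j t) := by
  classical
  induction s using Finset.induction_on with
  | empty => exact zero.congr fun _ _ _ => by simp
  | insert i s hi ih => exact ((h i).add ih).congr fun _ _ _ => Finset.sum_insert hi

/-- All coefficients are zero: each division by ε lowers the exponent of the bound by one. This
absorbs Taylor remainders. -/
theorem of_abs_le_pow (hε0 : ∀ j, ∀ t ∈ Icc 0 (T j), ε j t ≠ 0) {C : ℝ}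
    (h : ∀ j, ∀ t ∈ Icc 0 (T j), |f j t| ≤ C * |ε j t| ^ n) : HasUExp T θ ε n f := by
  induction n generalizing f with
  | zero => exact ⟨C, fun j t ht => by simpa using h j t ht⟩
  | succ n ih =>
    refine ⟨_, continuous_const (y := 0), fun j t => f j t / ε j t, ih fun j t ht => ?_,
      fun j t ht => ?_⟩
    · rw [abs_div, div_le_iff₀ (abs_pos.2 (hε0 j t ht))]
      exact (h j t ht).trans_eq (by ring)
    · field_simp [hε0 j t ht]
      simp

/-- Substitution `r = ε c` in an expansion in powers of `r`. -/
theorem comp_mul {A B : ℝ} (hθ : ∀ j, ∀ t ∈ Icc 0 (T j), θ j t ∈ Icc A B)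
    (hε : ∀ j, ∀ t ∈ Icc 0 (T j), |ε j t| ≤ 1) {c : κ → ℝ → ℝ} (hc : HasUExp T θ ε n c)
    (hf : HasUExp T θ (fun j t => ε j t * c j t) n f) : HasUExp T θ ε n f := by
  induction n generalizing f with
  | zero => exact hf
  | succ n ih =>
    obtain ⟨a, ha, g, hg, e⟩ := hf
    have hc' := of_succ hθ hε hc
    exact ⟨a, ha, _, mul hθ hε hc' (ih hc' hg), fun j t ht => by rw [e j t ht]; ring⟩

/-- The inverse of an expansion whose leading coefficient is invertible. -/
theorem inv {A B : ℝ} (hθ : ∀ j, ∀ t ∈ Icc 0 (T j), θ j t ∈ Icc A B)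
    (hε : ∀ j, ∀ t ∈ Icc 0 (T j), |ε j t| ≤ 1) {d : ℝ → ℝ} (hd : Continuous d)
    (hd0 : ∀ x, d x ≠ 0) {m : ℝ} (hm : 0 < m) (hfm : ∀ j, ∀ t ∈ Icc 0 (T j), m ≤ f j t)
    (hg : HasUExp T θ ε n g) (hf : ∀ j, ∀ t ∈ Icc 0 (T j), f j t = d (θ j t) + ε j t * g j t) :
    HasUExp T θ ε n (fun j t => (f j t)⁻¹) := by
  induction n with
  | zero =>
    refine ⟨m⁻¹, fun j t ht => ?_⟩
    have := hfm j t ht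
    rw [abs_inv, abs_of_pos (hm.trans_le this)]
    exact inv_anti₀ hm this
  | succ n ih =>
    have h1 := of_succ hθ hε hg
    have hdi : Continuous fun x => (d x)⁻¹ := hd.inv₀ hd0
    -- From 1/f = 1/d - ε g (1/f)(1/d): the remainder involves 1/f to one order less.
    refine ⟨_, hdi, _, (mul hθ hε (mul hθ hε h1 (ih h1)) (of_continuous hθ hdi)).neg,
      fun j t ht => ?_⟩
    have h2 : f j t ≠ 0 := (hm.trans_le (hfm j t ht)).ne'
    have h3 := hd0 (θ j t)
    have h4 := hf j t ht
    field_simp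
    linear_combination -h4

/-- Integration of an expansion with respect to the angle. -/
theorem integral {T : κ → ℝ} {θ D z : κ → ℝ → ℝ} {ε : κ → ℝ} {A B : ℝ}
    (hθ : ∀ j, ∀ t ∈ Icc 0 (T j), θ j t ∈ Icc A B) (hθ0 : ∀ j, θ j 0 = 0)
    (hε : ∀ j, ε j ≠ 0) (hT : ∀ j, 0 ≤ T j)
    (hθc : ∀ j, ContinuousOn (θ j) (Icc 0 (T j)))
    (hθd : ∀ j, ∀ t ∈ Ioo 0 (T j), HasDerivAt (θ j) (D j t) t)
    (hD : ∀ j, ∀ t ∈ Icc 0 (T j), 0 ≤ D j t)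
    (hzc : ∀ j, ContinuousOn (z j) (Icc 0 (T j))) (hz0 : ∀ j, z j 0 = 0)
    (hzd : ∀ j, ∀ t ∈ Ioo 0 (T j), HasDerivAt (z j) (f j t * D j t) t)
    (hf : HasUExp T θ (fun j _ => ε j) n f) : HasUExp T θ (fun j _ => ε j) n z := by
  induction n generalizing f z with
  | zero =>
    obtain ⟨C, hC⟩ := hf
    refine ⟨|C| * |B|, fun j t ht => ?_⟩
    -- As z' = f θ' with |f| ≤ |C| and θ' ≥ 0, both |C| θ - z and |C| θ + z increase; s is the sign.
    have key : ∀ s : ℝ, |s| = 1 → s * z j t ≤ |C| * |B| := by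
      intro s hs
      have hmono : MonotoneOn (fun t => |C| * θ j t - s * z j t) (Icc 0 (T j)) := by
        refine monotoneOn_of_hasDerivWithinAt_nonneg
          (f' := fun t => |C| * D j t - s * (f j t * D j t)) (convex_Icc _ _)
          ((continuousOn_const.mul (hθc j)).sub (continuousOn_const.mul (hzc j))) ?_ ?_ <;>
          rw [interior_Icc]
        · exact fun t ht => (((hθd j t ht).const_mul _).sub
            ((hzd j t ht).const_mul _)).hasDerivWithinAt
        · intro t ht
          have h1 := hC j t (Ioo_subset_Icc_self ht)
          have h2 : s * f j t ≤ |C| := by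
            calc s * f j t ≤ |s * f j t| := le_abs_self _
              _ = |f j t| := by rw [abs_mul, hs, one_mul]
              _ ≤ |C| := h1.trans (le_abs_self _)
          have := mul_le_mul_of_nonneg_right h2 (hD j t (Ioo_subset_Icc_self ht))
          linarith
      have h := hmono (left_mem_Icc.2 (hT j)) ht ht.1
      simp only [hθ0, hz0, mul_zero, sub_zero] at h
      have : θ j t ≤ |B| := (hθ j t ht).2.trans (le_abs_self _)
      nlinarith [abs_nonneg C]
    rw [abs_le']
    exact ⟨by simpa using key 1 (by simp), by simpa using key (-1) (by simp)⟩
  | succ n ih =>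
    obtain ⟨a, ha, g, hg, e⟩ := hf
    have hA : ∀ x, HasDerivAt (fun x => ∫ s in (0 : ℝ)..x, a s) (a x) x := fun x =>
      intervalIntegral.integral_hasDerivAt_right (ha.intervalIntegrable _ _)
        (ha.stronglyMeasurableAtFilter _ _) ha.continuousAt
    have hAc : Continuous fun x => ∫ s in (0 : ℝ)..x, a s :=
      continuous_iff_continuousAt.2 fun x => (hA x).continuousAt
    -- Since ε is constant in time, the quotient has derivative g θ', to which the induction
    -- applies.
    refine ⟨_, hAc, fun j t => (z j t - ∫ s in (0 : ℝ)..θ j t, a s) / ε j,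
      ih (fun j => ?_) (fun j => ?_) (fun j t ht => ?_) hg, fun j t ht => ?_⟩
    · exact ((hzc j).sub (hAc.comp_continuousOn (hθc j))).div_const _
    · simp [hz0, hθ0]
    · refine (((hzd j t ht).sub ((hA _).comp t (hθd j t ht))).div_const (ε j)).congr_deriv ?_
      rw [e j t (Ioo_subset_Icc_self ht)]
      field_simp [hε j]
      ring
    · field_simp [hε j]
      ring

/-- At a fixed angle the coefficient functions become numbers, the same for every member of the
family. -/
theorem exists_polynomial (hf : HasUExp T θ ε n f) (x : ℝ) : ∃ p : Polynomial ℝ, ∃ C, ∀ j,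
    ∀ t ∈ Icc 0 (T j), θ j t = x → |f j t - p.eval (ε j t)| ≤ C * |ε j t| ^ n := by
  induction n generalizing f with
  | zero =>
    obtain ⟨C, hC⟩ := hf
    exact ⟨0, C, fun j t ht _ => by simpa using hC j t ht⟩
  | succ n ih =>
    obtain ⟨a, ha, g, hg, e⟩ := hf
    obtain ⟨p, C, hC⟩ := ih hg
    refine ⟨Polynomial.C (a x) + Polynomial.X * p, C, fun j t ht hx => ?_⟩
    have h1 : f j t - (Polynomial.C (a x) + Polynomial.X * p).eval (ε j t) =
        ε j t * (g j t - p.eval (ε j t)) := by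
      rw [e j t ht, hx]; simp; ring
    rw [h1, abs_mul]
    exact (mul_le_mul_of_nonneg_left (hC j t ht hx) (abs_nonneg _)).trans_eq (by ring)

end HasUExp

/-- Solutions in polar coordinates have uniform expansions in the initial radius `ε`, when the
radial and angular velocities have expansions in the radius `r = ε c`. -/
theorem hasUExp_radius {κ : Type*} {T ε : κ → ℝ} {θ D lam c Dh lh : κ → ℝ → ℝ} {A B : ℝ}
    {d l : ℝ → ℝ} {m : ℝ} {N : ℕ}
    (hθ : ∀ j, ∀ t ∈ Icc 0 (T j), θ j t ∈ Icc A B) (hθ0 : ∀ j, θ j 0 = 0)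
    (hε : ∀ j, ε j ≠ 0) (hε1 : ∀ j, |ε j| ≤ 1) (hT : ∀ j, 0 ≤ T j)
    (hθc : ∀ j, ContinuousOn (θ j) (Icc 0 (T j)))
    (hθd : ∀ j, ∀ t ∈ Ioo 0 (T j), HasDerivAt (θ j) (D j t) t)
    (hcc : ∀ j, ContinuousOn (c j) (Icc 0 (T j))) (hc0 : ∀ j, c j 0 = 1)
    (hcd : ∀ j, ∀ t ∈ Ioo 0 (T j), HasDerivAt (c j) (lam j t * c j t) t)
    (hcb : ∃ C, ∀ j, ∀ t ∈ Icc 0 (T j), |c j t| ≤ C)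
    (hd : Continuous d) (hd0 : ∀ x, d x ≠ 0) (hl : Continuous l)
    (hm : 0 < m) (hDm : ∀ j, ∀ t ∈ Icc 0 (T j), m ≤ D j t)
    (hDh : HasUExp T θ (fun j t => ε j * c j t) N Dh)
    (hlh : HasUExp T θ (fun j t => ε j * c j t) N lh)
    (hr : ∀ j, ∀ t ∈ Icc 0 (T j), |ε j * c j t| ≤ 1)
    (hD : ∀ j, ∀ t ∈ Icc 0 (T j), D j t = d (θ j t) + ε j * c j t * Dh j t)
    (hlam : ∀ j, ∀ t ∈ Icc 0 (T j), lam j t = l (θ j t) + ε j * c j t * lh j t) :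
    HasUExp T θ (fun j _ => ε j) N c := by
  have hε1' : ∀ j, ∀ t ∈ Icc 0 (T j), |(fun j _ => ε j : κ → ℝ → ℝ) j t| ≤ 1 := fun j _ _ => hε1 j
  suffices H : ∀ n ≤ N, HasUExp T θ (fun j _ => ε j) n c from H N le_rfl
  intro n
  induction n with
  | zero => exact fun _ => hcb
  | succ n ih =>
    intro hn
    have hc := ih (by omega)
    have hDh' := HasUExp.comp_mul hθ hε1' hc (hDh.of_le hθ hr (by omega : n ≤ N))
    have hlh' := HasUExp.comp_mul hθ hε1' hc (hlh.of_le hθ hr (by omega : n ≤ N))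
    have hM : Continuous fun x => l x / d x := hl.div hd hd0
    -- The logarithm of the radius for the linear part; exp (-b θ) serves as integrating factor.
    set b : ℝ → ℝ := fun x => ∫ s in (0 : ℝ)..x, l s / d s with hb
    have hbd : ∀ x, HasDerivAt b (l x / d x) x := fun x =>
      intervalIntegral.integral_hasDerivAt_right (hM.intervalIntegrable _ _)
        (hM.stronglyMeasurableAtFilter _ _) hM.continuousAt
    have hbc : Continuous b := continuous_iff_continuousAt.2 fun x => (hbd x).continuousAt
    have hDi : HasUExp T θ (fun j _ => ε j) n (fun j t => (D j t)⁻¹) :=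
      HasUExp.inv hθ hε1' hd hd0 hm hDm (HasUExp.mul hθ hε1' hc hDh') fun j t ht => by
        rw [hD j t ht]; ring
    have hexp : Continuous fun x => Real.exp (-b x) := by fun_prop
    have hz : HasUExp T θ (fun j _ => ε j) n (fun j t => c j t * Real.exp (-b (θ j t))) :=
      HasUExp.mul hθ hε1' hc (HasUExp.of_continuous hθ hexp)
    -- The derivative of c exp (-b θ) with respect to the angle is ε times this product. The product
    -- is known to order n, so integration gives order n + 1.
    have hW := HasUExp.mul hθ hε1' (HasUExp.mul hθ hε1' (HasUExp.mul hθ hε1'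
      (hlh'.sub (HasUExp.mul hθ hε1' (HasUExp.of_continuous hθ hM) hDh')) hc) hDi) hz
    have hI := HasUExp.integral (z := fun j t => (c j t * Real.exp (-b (θ j t)) - 1) / ε j)
      hθ hθ0 hε hT hθc hθd (fun j t ht => hm.le.trans (hDm j t ht)) (fun j => ?_) (fun j => ?_)
      (fun j t ht => ?_) hW
    · have h1 : HasUExp T θ (fun j _ => ε j) (n + 1)
          (fun j t => c j t * Real.exp (-b (θ j t))) := by
        refine ⟨_, continuous_const (y := 1), _, hI, fun j t ht => ?_⟩
        field_simp [hε j]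
        ring
      have hexp' : Continuous fun x => Real.exp (b x) := by fun_prop
      refine (HasUExp.mul hθ hε1' h1 (HasUExp.of_continuous hθ hexp')).congr fun j t ht => ?_
      rw [mul_assoc, ← Real.exp_add]
      simp
    · exact (((hcc j).mul (hexp.comp_continuousOn (hθc j))).sub continuousOn_const).div_const _
    · simp [hc0, hθ0, hb]
    · have ht' := Ioo_subset_Icc_self ht
      have h1 := (((hcd j t ht).mul (((hbd _).comp t (hθd j t ht)).neg.exp)).sub_const
        1).div_const (ε j)
      refine h1.congr_deriv ?_
      have h2 : D j t ≠ 0 := (hm.trans_le (hDm j t ht')).ne'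
      have h3 := hd0 (θ j t)
      have h5 := hD j t ht'
      rw [hlam j t ht']
      simp only [Function.comp_apply, Pi.neg_apply]
      field_simp [hε j]
      rw [h5]
      ring

/-! ### Polar coordinates along trajectories. -/

/-- Angular velocity of `V`. -/
noncomputable def angVel (V : ℝ × ℝ → ℝ × ℝ) (p : ℝ × ℝ) : ℝ :=
  (p.1 * (V p).2 - p.2 * (V p).1) / (p.1 ^ 2 + p.2 ^ 2)

/-- Logarithmic derivative of the radius along `V`. -/
noncomputable def radVel (V : ℝ × ℝ → ℝ × ℝ) (p : ℝ × ℝ) : ℝ :=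
  (p.1 * (V p).1 + p.2 * (V p).2) / (p.1 ^ 2 + p.2 ^ 2)

theorem vel_decomp (V : ℝ × ℝ → ℝ × ℝ) {p : ℝ × ℝ} (hp : 0 < p.1 ^ 2 + p.2 ^ 2) :
    V p = (radVel V p * p.1 - angVel V p * p.2, radVel V p * p.2 + angVel V p * p.1) := by
  have hp' := hp.ne'
  ext <;> simp only [radVel, angVel] <;> field_simp <;> ring

theorem monotoneOn_of_hasDerivAt_nonneg {a b : ℝ} {f f' : ℝ → ℝ} (hf : ContinuousOn f (Icc a b))
    (hd : ∀ t ∈ Ioo a b, HasDerivAt f (f' t) t) (h0 : ∀ t ∈ Ioo a b, 0 ≤ f' t) :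
    MonotoneOn f (Icc a b) := by
  refine monotoneOn_of_hasDerivWithinAt_nonneg (f' := f') (convex_Icc _ _) hf ?_ ?_ <;>
    rw [interior_Icc]
  · exact fun t ht => (hd t ht).hasDerivWithinAt
  · exact h0

theorem eq_of_hasDerivAt_zero {a b : ℝ} {f : ℝ → ℝ} (hf : ContinuousOn f (Icc a b))
    (hd : ∀ t ∈ Ioo a b, HasDerivAt f 0 t) {t : ℝ} (ht : t ∈ Icc a b) : f t = f a := by
  have ha : a ∈ Icc a b := left_mem_Icc.2 (ht.1.trans ht.2)
  have h1 := monotoneOn_of_hasDerivAt_nonneg hf hd (fun _ _ => le_rfl) ha ht ht.1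
  have h2 := monotoneOn_of_hasDerivAt_nonneg hf.neg (fun s hs => (hd s hs).neg)
    (fun _ _ => by simp) ha ht ht.1
  simp only [Pi.neg_apply] at h2
  linarith

theorem continuousOn_vel {V : ℝ × ℝ → ℝ × ℝ} {s : Set (ℝ × ℝ)} (hV : ContinuousOn V s)
    (hs : ∀ p ∈ s, 0 < p.1 ^ 2 + p.2 ^ 2) :
    ContinuousOn (angVel V) s ∧ ContinuousOn (radVel V) s := by
  have h1 : ContinuousOn (fun p => (V p).1) s := continuous_fst.comp_continuousOn hV
  have h2 : ContinuousOn (fun p => (V p).2) s := continuous_snd.comp_continuousOn hV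
  have h3 : ContinuousOn (fun p : ℝ × ℝ => p.1 ^ 2 + p.2 ^ 2) s := by fun_prop
  exact ⟨((continuous_fst.continuousOn.mul h2).sub (continuous_snd.continuousOn.mul h1)).div h3
    fun p hp => (hs p hp).ne', ((continuous_fst.continuousOn.mul h1).add
    (continuous_snd.continuousOn.mul h2)).div h3 fun p hp => (hs p hp).ne'⟩

/-- The data of a trajectory `(ε c cos θ, ε c sin θ)` of `V` on `[0, T]` in polar coordinates. -/
structure IsPolarCurve (V : ℝ × ℝ → ℝ × ℝ) (ε T : ℝ) (θ c : ℝ → ℝ) : Prop where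
  θ_zero : θ 0 = 0
  c_zero : c 0 = 1
  θ_cont : ContinuousOn θ (Icc 0 T)
  c_cont : ContinuousOn c (Icc 0 T)
  c_pos : ∀ t ∈ Icc 0 T, 0 < c t
  θ_deriv : ∀ t ∈ Ioo 0 T,
    HasDerivAt θ (angVel V (ε * c t * Real.cos (θ t), ε * c t * Real.sin (θ t))) t
  c_deriv : ∀ t ∈ Ioo 0 T,
    HasDerivAt c (radVel V (ε * c t * Real.cos (θ t), ε * c t * Real.sin (θ t)) * c t) t

/-- A trajectory that stays in a disc where the angular velocity is bounded below and the radial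
one is bounded can be written in polar coordinates. -/
theorem exists_polar {V : ℝ × ℝ → ℝ × ℝ} {δ m K : ℝ}
    (hV : ContinuousOn V {p | p.1 ^ 2 + p.2 ^ 2 ≤ δ ^ 2})
    (hD : ∀ p : ℝ × ℝ, 0 < p.1 ^ 2 + p.2 ^ 2 → p.1 ^ 2 + p.2 ^ 2 ≤ δ ^ 2 →
      m ≤ angVel V p ∧ |radVel V p| ≤ K)
    {x T : ℝ} (hx : x ≠ 0) (hT : 0 < T) {γ : ℝ → ℝ × ℝ} (h0 : γ 0 = (x, 0))
    (hc : ContinuousOn γ (Icc 0 T)) (hd : ∀ t ∈ Ioo 0 T, HasDerivAt γ (V (γ t)) t)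
    (hball : ∀ t ∈ Icc 0 T, (γ t).1 ^ 2 + (γ t).2 ^ 2 ≤ δ ^ 2) :
    ∃ θ c : ℝ → ℝ, IsPolarCurve V x T θ c ∧
      (∀ t ∈ Icc 0 T, γ t = (x * c t * Real.cos (θ t), x * c t * Real.sin (θ t))) ∧
      (∀ t ∈ Icc 0 T, c t ≤ Real.exp (K * t)) ∧ (∀ t ∈ Icc 0 T, m * t ≤ θ t) := by
  have hX : ContinuousOn (fun t => (γ t).1) (Icc 0 T) := continuous_fst.comp_continuousOn hc
  have hY : ContinuousOn (fun t => (γ t).2) (Icc 0 T) := continuous_snd.comp_continuousOn hc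
  have hXd : ∀ t ∈ Ioo 0 T, HasDerivAt (fun t => (γ t).1) (V (γ t)).1 t := fun t ht =>
    (ContinuousLinearMap.fst ℝ ℝ ℝ).hasFDerivAt.comp_hasDerivAt t (hd t ht)
  have hYd : ∀ t ∈ Ioo 0 T, HasDerivAt (fun t => (γ t).2) (V (γ t)).2 t := fun t ht =>
    (ContinuousLinearMap.snd ℝ ℝ ℝ).hasFDerivAt.comp_hasDerivAt t (hd t ht)
  -- The squared radius decays at rate at most 2K, so its product with exp (2Kt) increases and the
  -- origin is never reached.
  have hpos : ∀ t ∈ Icc 0 T, 0 < (γ t).1 ^ 2 + (γ t).2 ^ 2 := by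
    intro t ht
    have hmono := monotoneOn_of_hasDerivAt_nonneg (a := 0) (b := T)
      (f := fun t => ((γ t).1 ^ 2 + (γ t).2 ^ 2) * Real.exp (2 * K * t))
      (((hX.pow 2).add (hY.pow 2)).mul (by fun_prop)) (fun t ht =>
        (((hXd t ht).pow 2).add ((hYd t ht).pow 2)).mul
          (((hasDerivAt_id t).const_mul (2 * K)).exp)) (fun t ht => ?_)
    · have := hmono (left_mem_Icc.2 hT.le) ht ht.1
      simp only [h0] at this
      have h2 : 0 < x ^ 2 := by positivity
      have h3 : 0 < ((γ t).1 ^ 2 + (γ t).2 ^ 2) * Real.exp (2 * K * t) :=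
        lt_of_lt_of_le (by simpa using h2) this
      exact pos_of_mul_pos_left h3 (Real.exp_pos _).le
    · have ht' := Ioo_subset_Icc_self ht
      have he := Real.exp_pos (2 * K * t)
      have key : 0 ≤ 2 * ((γ t).1 * (V (γ t)).1 + (γ t).2 * (V (γ t)).2) +
          2 * K * ((γ t).1 ^ 2 + (γ t).2 ^ 2) := by
        -- Non-vanishing is not yet known here, and the velocity bounds hold only off the origin.
        rcases (add_nonneg (sq_nonneg (γ t).1) (sq_nonneg (γ t).2)).eq_or_lt with h | h
        · have h1 : (γ t).1 = 0 := by nlinarith [sq_nonneg (γ t).1, sq_nonneg (γ t).2]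
          have h2 : (γ t).2 = 0 := by nlinarith [sq_nonneg (γ t).1, sq_nonneg (γ t).2]
          simp [h1, h2]
        · have h1 := (abs_le.1 (hD _ h (hball t ht')).2).1
          rw [radVel, le_div_iff₀ h] at h1
          linarith
      have := mul_nonneg key he.le
      simp only [id, Pi.add_apply, Pi.pow_apply]
      push_cast
      linarith
  have hcont := continuousOn_vel (s := γ '' Icc 0 T)
    (hV.mono (by rintro _ ⟨t, ht, rfl⟩; exact hball t ht))
    (by rintro _ ⟨t, ht, rfl⟩; exact hpos t ht)
  have hDc : ContinuousOn (fun t => angVel V (γ t)) (Icc 0 T) :=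
    hcont.1.comp hc (mapsTo_image _ _)
  have hlc : ContinuousOn (fun t => radVel V (γ t)) (Icc 0 T) :=
    hcont.2.comp hc (mapsTo_image _ _)
  -- Extending f by its end values makes the primitive two-sidedly differentiable at 0 and T as
  -- well.
  have key : ∀ f : ℝ → ℝ, ContinuousOn f (Icc 0 T) → ∃ F : ℝ → ℝ, F 0 = 0 ∧ Continuous F ∧
      ∀ t ∈ Icc 0 T, HasDerivAt F (f (projIcc 0 T hT.le t)) t := by
    intro f hf
    have hf' : Continuous fun t => f (projIcc 0 T hT.le t) :=
      hf.comp_continuous (continuous_subtype_val.comp continuous_projIcc) fun t => (projIcc 0 T _ t).2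
    have hF : ∀ t, HasDerivAt (fun t => ∫ s in (0 : ℝ)..t, f (projIcc 0 T hT.le s))
        (f (projIcc 0 T hT.le t)) t := fun t =>
      intervalIntegral.integral_hasDerivAt_right (hf'.intervalIntegrable _ _)
        (hf'.stronglyMeasurableAtFilter _ _) hf'.continuousAt
    exact ⟨_, by simp, continuous_iff_continuousAt.2 fun t => (hF t).continuousAt, fun t _ => hF t⟩
  have key' : ∀ f : ℝ → ℝ, ContinuousOn f (Icc 0 T) → ∃ F : ℝ → ℝ, F 0 = 0 ∧ Continuous F ∧
      ∀ t ∈ Icc 0 T, HasDerivAt F (f t) t := by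
    intro f hf
    obtain ⟨F, h1, h2, h3⟩ := key f hf
    exact ⟨F, h1, h2, fun t ht => by simpa [projIcc_of_mem hT.le ht] using h3 t ht⟩
  obtain ⟨θ, hθ0, hθc, hθd⟩ := key' _ hDc
  obtain ⟨Λ, hΛ0, hΛc, hΛd⟩ := key' _ hlc
  -- Rotating γ back by θ and scaling it by exp (-Λ) freezes it at (x, 0). This avoids choosing a
  -- branch of the argument.
  have hu : ∀ t ∈ Icc 0 T, ((γ t).1 * Real.cos (θ t) + (γ t).2 * Real.sin (θ t)) *
      Real.exp (-Λ t) = x := by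
    intro t ht
    have := eq_of_hasDerivAt_zero (f := fun t => ((γ t).1 * Real.cos (θ t) +
      (γ t).2 * Real.sin (θ t)) * Real.exp (-Λ t)) (a := 0) (b := T)
      (((hX.mul (by fun_prop)).add (hY.mul (by fun_prop))).mul (by fun_prop)) (fun t ht => ?_) ht
    · simpa [h0, hθ0, hΛ0] using this
    · have ht' := Ioo_subset_Icc_self ht
      refine ((((hXd t ht).mul (hθd t ht').cos).add ((hYd t ht).mul (hθd t ht').sin)).mul
        (hΛd t ht').neg.exp).congr_deriv ?_
      have hv := vel_decomp V (hpos t ht')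
      simp only [Pi.add_apply, Pi.mul_apply, Pi.neg_apply]
      rw [show (V (γ t)).1 = _ from congrArg Prod.fst hv,
        show (V (γ t)).2 = _ from congrArg Prod.snd hv]
      ring
  have hv : ∀ t ∈ Icc 0 T, ((γ t).2 * Real.cos (θ t) - (γ t).1 * Real.sin (θ t)) *
      Real.exp (-Λ t) = 0 := by
    intro t ht
    have := eq_of_hasDerivAt_zero (f := fun t => ((γ t).2 * Real.cos (θ t) -
      (γ t).1 * Real.sin (θ t)) * Real.exp (-Λ t)) (a := 0) (b := T)
      (((hY.mul (by fun_prop)).sub (hX.mul (by fun_prop))).mul (by fun_prop)) (fun t ht => ?_) ht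
    · simpa [h0, hθ0, hΛ0] using this
    · have ht' := Ioo_subset_Icc_self ht
      refine ((((hYd t ht).mul (hθd t ht').cos).sub ((hXd t ht).mul (hθd t ht').sin)).mul
        (hΛd t ht').neg.exp).congr_deriv ?_
      have hv := vel_decomp V (hpos t ht')
      simp only [Pi.sub_apply, Pi.mul_apply, Pi.neg_apply]
      rw [show (V (γ t)).1 = _ from congrArg Prod.fst hv,
        show (V (γ t)).2 = _ from congrArg Prod.snd hv]
      ring
  have hγ : ∀ t ∈ Icc 0 T, γ t =
      (x * Real.exp (Λ t) * Real.cos (θ t), x * Real.exp (Λ t) * Real.sin (θ t)) := by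
    intro t ht
    have h1 : Real.exp (-Λ t) * Real.exp (Λ t) = 1 := by rw [← Real.exp_add]; simp
    have h2 := hu t ht
    have h3 := hv t ht
    have h4 := Real.sin_sq_add_cos_sq (θ t)
    ext <;> dsimp only
    · linear_combination -(γ t).1 * h4 + Real.exp (Λ t) * Real.cos (θ t) * h2 -
        Real.exp (Λ t) * Real.sin (θ t) * h3 -
        (γ t).1 * (Real.sin (θ t) ^ 2 + Real.cos (θ t) ^ 2) * h1
    · linear_combination -(γ t).2 * h4 + Real.exp (Λ t) * Real.sin (θ t) * h2 +
        Real.exp (Λ t) * Real.cos (θ t) * h3 -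
        (γ t).2 * (Real.sin (θ t) ^ 2 + Real.cos (θ t) ^ 2) * h1
  refine ⟨θ, fun t => Real.exp (Λ t), ⟨hθ0, by simp [hΛ0], hθc.continuousOn, by fun_prop,
    fun _ _ => Real.exp_pos _, fun t ht => ?_, fun t ht => ?_⟩, hγ, fun t ht => ?_, fun t ht => ?_⟩
  · rw [← hγ t (Ioo_subset_Icc_self ht)]
    exact hθd t (Ioo_subset_Icc_self ht)
  · rw [← hγ t (Ioo_subset_Icc_self ht), mul_comm]
    exact (hΛd t (Ioo_subset_Icc_self ht)).exp
  · rw [Real.exp_le_exp]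
    have := monotoneOn_of_hasDerivAt_nonneg (a := 0) (b := T) (f := fun t => K * t - Λ t)
      (by fun_prop) (fun t ht => ((hasDerivAt_id t).const_mul K).sub
        (hΛd t (Ioo_subset_Icc_self ht))) (fun t ht => ?_) (left_mem_Icc.2 hT.le) ht ht.1
    · simp only [hΛ0] at this
      linarith
    · have ht' := Ioo_subset_Icc_self ht
      have := (abs_le.1 (hD _ (hpos t ht') (hball t ht')).2).2
      linarith
  · have := monotoneOn_of_hasDerivAt_nonneg (a := 0) (b := T) (f := fun t => θ t - m * t)
      (by fun_prop) (fun t ht => (hθd t (Ioo_subset_Icc_self ht)).sub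
        ((hasDerivAt_id t).const_mul m)) (fun t ht => ?_) (left_mem_Icc.2 hT.le) ht ht.1
    · simp only [hθ0] at this
      linarith
    · have ht' := Ioo_subset_Icc_self ht
      have := (hD _ (hpos t ht') (hball t ht')).1
      linarith

/-- A trajectory of `V` runs from `(x, 0)` to `(x', 0)` off the `x`-axis in between. -/
def IsArc (V : ℝ × ℝ → ℝ × ℝ) (x x' : ℝ) : Prop :=
  ∃ (T : ℝ) (γ : ℝ → ℝ × ℝ), 0 < T ∧ γ 0 = (x, 0) ∧ γ T = (x', 0) ∧ ContinuousOn γ (Icc 0 T) ∧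
    (∀ t ∈ Ioo 0 T, HasDerivAt γ (V (γ t)) t) ∧ ∀ t ∈ Ioo 0 T, (γ t).2 ≠ 0

theorem FirstHit.isArc {V : ℝ × ℝ → ℝ × ℝ} {x x' : ℝ} (h : FirstHit V x x') : IsArc V x x' := by
  obtain ⟨T, γ, hT, h0, h1, hγ, hne⟩ := h
  exact ⟨T, γ, hT, h0, h1, fun t ht => (hγ t ht).continuousWithinAt, fun t ht =>
    (hγ t (Ioo_subset_Icc_self ht)).hasDerivAt (Icc_mem_nhds ht.1 ht.2), hne⟩

theorem angle_le_pi {T : ℝ} {θ : ℝ → ℝ} (hθ : ContinuousOn θ (Icc 0 T))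
    (hθ0 : θ 0 = 0) (hs : ∀ t ∈ Ioo 0 T, Real.sin (θ t) ≠ 0) : ∀ t ∈ Icc 0 T, θ t ≤ Real.pi := by
  intro t ht
  by_contra! h
  have h1 : 0 < t := ht.1.lt_of_ne fun h' => by
    rw [← h', hθ0] at h
    exact h.not_ge Real.pi_pos.le
  obtain ⟨s, hs1, hs2⟩ := intermediate_value_Ioo h1.le (hθ.mono (Icc_subset_Icc_right ht.2))
    (show Real.pi ∈ Ioo (θ 0) (θ t) from ⟨by rw [hθ0]; exact Real.pi_pos, h⟩)
  exact hs s ⟨hs1.1, hs1.2.trans_le ht.2⟩ (by rw [hs2]; exact Real.sin_pi)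

/-- Arcs that start near the origin stay near the origin and turn by the angle `π`. -/
theorem IsArc.exists_polar {V : ℝ × ℝ → ℝ × ℝ} {δ m K : ℝ} (hm : 0 < m) (hδ : 0 < δ) (hK : 0 ≤ K)
    (hV : ContinuousOn V {p | p.1 ^ 2 + p.2 ^ 2 ≤ δ ^ 2})
    (hD : ∀ p : ℝ × ℝ, 0 < p.1 ^ 2 + p.2 ^ 2 → p.1 ^ 2 + p.2 ^ 2 ≤ δ ^ 2 →
      m ≤ angVel V p ∧ |radVel V p| ≤ K)
    {x x' : ℝ} (hx : x ≠ 0) (hxδ : |x| * Real.exp (K * (Real.pi / m)) < δ) (h : IsArc V x x') :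
    ∃ (T : ℝ) (θ c : ℝ → ℝ), 0 < T ∧ IsPolarCurve V x T θ c ∧ (∀ t ∈ Icc 0 T,
      θ t ∈ Icc 0 Real.pi ∧ c t ≤ Real.exp (K * (Real.pi / m))) ∧ θ T = Real.pi ∧
      x' = -(x * c T) := by
  obtain ⟨T, γ, hT, h0, h1, hc, hd, hne⟩ := h
  have hqc : ContinuousOn (fun t => (γ t).1 ^ 2 + (γ t).2 ^ 2) (Icc 0 T) := by fun_prop
  -- A priori bounds while the curve is in the disc: m t ≤ θ ≤ π bounds the time by π / m, hence the
  -- growth of the radius.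
  have main : ∀ S, 0 < S → S ≤ T → (∀ t ∈ Icc 0 S, (γ t).1 ^ 2 + (γ t).2 ^ 2 ≤ δ ^ 2) →
      ∃ θ c : ℝ → ℝ, IsPolarCurve V x S θ c ∧
      (∀ t ∈ Icc 0 S, γ t = (x * c t * Real.cos (θ t), x * c t * Real.sin (θ t))) ∧
      (∀ t ∈ Icc 0 S, c t ≤ Real.exp (K * (Real.pi / m))) ∧ (∀ t ∈ Icc 0 S, m * t ≤ θ t) ∧
      (∀ t ∈ Icc 0 S, θ t ≤ Real.pi) := by
    intro S hS hST hball
    obtain ⟨θ, c, hp, hγ, hce, hθm⟩ := _root_.exists_polar hV hD hx hS h0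
      (hc.mono (Icc_subset_Icc_right hST)) (fun t ht => hd t ⟨ht.1, ht.2.trans_le hST⟩) hball
    have hπ := angle_le_pi hp.θ_cont hp.θ_zero fun t ht hs => hne t ⟨ht.1, ht.2.trans_le hST⟩ (by
      rw [hγ t (Ioo_subset_Icc_self ht), hs, mul_zero])
    refine ⟨θ, c, hp, hγ, fun t ht => (hce t ht).trans ?_, hθm, hπ⟩
    rw [Real.exp_le_exp]
    refine mul_le_mul_of_nonneg_left ?_ hK
    rw [le_div_iff₀ hm, mul_comm]
    exact (hθm t ht).trans (hπ t ht)
  have hxδ' : x ^ 2 < δ ^ 2 := by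
    rw [sq_lt_sq, abs_of_pos hδ]
    refine lt_of_le_of_lt (le_mul_of_one_le_right (abs_nonneg x) (Real.one_le_exp ?_)) hxδ
    have := Real.pi_pos
    positivity
  have hball : ∀ t ∈ Icc 0 T, (γ t).1 ^ 2 + (γ t).2 ^ 2 ≤ δ ^ 2 := by
    by_contra! hcon
    obtain ⟨t₀, ht₀, hlt⟩ := hcon
    have hq0 : (γ 0).1 ^ 2 + (γ 0).2 ^ 2 = x ^ 2 := by rw [h0]; simp
    have hex : ∀ t ∈ Icc 0 T, δ ^ 2 < (γ t).1 ^ 2 + (γ t).2 ^ 2 →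
        ∃ s ∈ Icc 0 t, (γ s).1 ^ 2 + (γ s).2 ^ 2 = δ ^ 2 := fun t ht hl =>
      intermediate_value_Icc ht.1 (hqc.mono (Icc_subset_Icc_right ht.2))
        ⟨by simpa only [hq0] using hxδ'.le, hl.le⟩
    have hcl : IsCompact {t ∈ Icc 0 T | (γ t).1 ^ 2 + (γ t).2 ^ 2 = δ ^ 2} :=
      isCompact_Icc.of_isClosed_subset (hqc.preimage_isClosed_of_isClosed isClosed_Icc
        isClosed_singleton) fun t ht => ht.1
    obtain ⟨s, hs, hsq⟩ := hex t₀ ht₀ hlt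
    -- At the first time on the boundary circle the a priori bound keeps the radius strictly below
    -- δ, a contradiction.
    obtain ⟨S, hS, hSl⟩ := hcl.exists_isLeast ⟨s, ⟨hs.1, hs.2.trans ht₀.2⟩, hsq⟩
    have hS0 : 0 < S := hS.1.1.lt_of_ne fun h' => by
      have := hS.2
      rw [← h', hq0] at this
      exact hxδ'.ne this
    obtain ⟨θ, c, hp, hγ, hce, -, -⟩ := main S hS0 hS.1.2 fun t ht => by
      by_contra! hl
      obtain ⟨s, hs, hsq⟩ := hex t ⟨ht.1, ht.2.trans hS.1.2⟩ hl
      have h2 := hSl ⟨⟨hs.1, hs.2.trans (ht.2.trans hS.1.2)⟩, hsq⟩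
      have h3 : s = t := le_antisymm hs.2 (ht.2.trans h2)
      rw [h3] at hsq
      exact hl.ne' hsq
    have hSS := right_mem_Icc.2 hS0.le
    have h2 := hS.2
    have h4 : (γ S).1 ^ 2 + (γ S).2 ^ 2 = (|x| * c S) ^ 2 := by
      rw [hγ S hSS, mul_pow |x|, sq_abs]
      linear_combination (x * c S) ^ 2 * Real.sin_sq_add_cos_sq (θ S)
    rw [h4] at h2
    have h5 : |x| * c S < δ :=
      (mul_le_mul_of_nonneg_left (hce S hSS) (abs_nonneg x)).trans_lt hxδ
    have h6 : 0 ≤ |x| * c S := mul_nonneg (abs_nonneg _) (hp.c_pos S hSS).le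
    nlinarith
  obtain ⟨θ, c, hp, hγ, hce, hθm, hπ⟩ := main T hT le_rfl hball
  have hTT := right_mem_Icc.2 hT.le
  have hcT := hp.c_pos T hTT
  have hend := hγ T hTT
  rw [h1] at hend
  have hsin : Real.sin (θ T) = 0 := by
    have := congrArg Prod.snd hend
    simpa [hx, hcT.ne'] using this.symm
  have hθT : θ T = Real.pi := by
    refine le_antisymm (hπ T hTT) (le_of_not_gt fun hlt => ?_)
    exact (Real.sin_pos_of_pos_of_lt_pi ((mul_pos hm hT).trans_le (hθm T hTT)) hlt).ne' hsin
  refine ⟨T, θ, c, hT, hp, fun t ht => ⟨⟨?_, hπ t ht⟩, hce t ht⟩, hθT, ?_⟩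
  · exact (mul_nonneg hm.le ht.1).trans (hθm t ht)
  · have := congrArg Prod.fst hend
    simp only [hθT, Real.cos_pi] at this
    linarith

theorem norm_cos_sin_le (r θ : ℝ) : ‖((r * Real.cos θ, r * Real.sin θ) : ℝ × ℝ)‖ ≤ |r| := by
  rw [Prod.norm_def]
  refine max_le ?_ ?_ <;> rw [norm_mul, Real.norm_eq_abs, Real.norm_eq_abs]
  · exact mul_le_of_le_one_right (abs_nonneg _) (Real.abs_cos_le_one θ)
  · exact mul_le_of_le_one_right (abs_nonneg _) (Real.abs_sin_le_one θ)

/-! ### Expansion of the end point of a half turn. -/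

/-- Taylor expansion of an analytic vector field in polar coordinates. -/
theorem AnalyticAt.exists_polar_expansion {V : ℝ × ℝ → ℝ × ℝ} (hV : AnalyticAt ℝ V 0)
    (h0 : V 0 = 0) (N : ℕ) : ∃ q : ℕ → ℝ → ℝ × ℝ, (∀ i, Continuous (q i)) ∧ ∃ δ > 0, ∃ C, 0 ≤ C ∧
      ∀ r θ : ℝ, |r| ≤ δ → ‖V (r * Real.cos θ, r * Real.sin θ) -
        r • fderiv ℝ V 0 (Real.cos θ, Real.sin θ) -
        ∑ i ∈ Finset.range N, r ^ (i + 2) • q i θ‖ ≤ C * |r| ^ (N + 2) := by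
  obtain ⟨p, hp⟩ := hV
  obtain ⟨C, hC⟩ := (hp.isBigO_sub_partialSum_pow (N + 2)).bound
  obtain ⟨δ, hδ, hball⟩ := Metric.eventually_nhds_iff_ball.1 hC
  refine ⟨fun i θ => p (i + 2) fun _ => (Real.cos θ, Real.sin θ), fun i => ?_, δ / 2,
    by positivity, |C|, abs_nonneg C, fun r θ hr => ?_⟩
  · exact (p (i + 2)).cont.comp (by fun_prop)
  · have h1 := norm_cos_sin_le r θ
    have h2 := hball (r * Real.cos θ, r * Real.sin θ)
      (by rw [mem_ball_zero_iff]; linarith)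
    have h3 : ∀ i, (p i fun _ => ((r * Real.cos θ, r * Real.sin θ) : ℝ × ℝ)) =
        r ^ i • p i fun _ => (Real.cos θ, Real.sin θ) := fun i => by
      have := (p i).map_smul_univ (fun _ => r) (fun _ => ((Real.cos θ, Real.sin θ) : ℝ × ℝ))
      simpa using this
    have h4 : p.partialSum (N + 2) (r * Real.cos θ, r * Real.sin θ) =
        r • fderiv ℝ V 0 (Real.cos θ, Real.sin θ) + ∑ i ∈ Finset.range N, r ^ (i + 2) •
          p (i + 2) fun _ => (Real.cos θ, Real.sin θ) := by
      rw [FormalMultilinearSeries.partialSum, Finset.sum_range_succ', Finset.sum_range_succ',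
        hp.coeff_zero, h0, add_zero, add_comm, h3, hp.fderiv_eq]
      simp only [h3]
      congr 1
      simp only [zero_add, pow_one]
      congr 1
    rw [zero_add, h4] at h2
    rw [sub_sub]
    refine h2.trans ?_
    rw [Real.norm_of_nonneg (by positivity)]
    exact mul_le_mul (le_abs_self C) (pow_le_pow_left₀ (norm_nonneg _) h1 _) (by positivity)
      (abs_nonneg _)

theorem exists_cos_sin (p : ℝ × ℝ) : ∃ θ : ℝ, p =
    (√(p.1 ^ 2 + p.2 ^ 2) * Real.cos θ, √(p.1 ^ 2 + p.2 ^ 2) * Real.sin θ) := by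
  have h : ‖(⟨p.1, p.2⟩ : ℂ)‖ = √(p.1 ^ 2 + p.2 ^ 2) := by
    rw [Complex.norm_def, Complex.normSq_mk]; ring_nf
  refine ⟨Complex.arg ⟨p.1, p.2⟩, ?_⟩
  rw [← h, Complex.norm_mul_cos_arg, Complex.norm_mul_sin_arg]

theorem sq_cos_add_sq_sin (r θ : ℝ) : (r * Real.cos θ) ^ 2 + (r * Real.sin θ) ^ 2 = r ^ 2 := by
  linear_combination r ^ 2 * Real.sin_sq_add_cos_sq θ

/-- Trajectories, in polar coordinates, that start in the punctured disc of radius `η` and make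
half a turn while growing by a factor of at most `M`. -/
structure PolarArc (V : ℝ × ℝ → ℝ × ℝ) (η M : ℝ) where
  (x T : ℝ)
  (θ c : ℝ → ℝ)
  x_ne : x ≠ 0
  x_lt : |x| < η
  T_pos : 0 < T
  curve : IsPolarCurve V x T θ c
  θ_mem : ∀ t ∈ Icc 0 T, θ t ∈ Icc 0 Real.pi
  c_le : ∀ t ∈ Icc 0 T, c t ≤ M

theorem angVel_polar (V : ℝ × ℝ → ℝ × ℝ) (L : ℝ × ℝ →L[ℝ] ℝ × ℝ) {r θ : ℝ} (hr : r ≠ 0)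
    {R : ℝ × ℝ} (hR : V (r * Real.cos θ, r * Real.sin θ) =
      r • L (Real.cos θ, Real.sin θ) + r ^ 2 • R) :
    angVel V (r * Real.cos θ, r * Real.sin θ) =
      (Real.cos θ * (L (Real.cos θ, Real.sin θ)).2 - Real.sin θ * (L (Real.cos θ, Real.sin θ)).1) +
      r * (Real.cos θ * R.2 - Real.sin θ * R.1) := by
  simp only [angVel, sq_cos_add_sq_sin, hR, Prod.fst_add, Prod.snd_add, Prod.smul_fst,
    Prod.smul_snd, smul_eq_mul]
  field_simp
  ring

theorem radVel_polar (V : ℝ × ℝ → ℝ × ℝ) (L : ℝ × ℝ →L[ℝ] ℝ × ℝ) {r θ : ℝ} (hr : r ≠ 0)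
    {R : ℝ × ℝ} (hR : V (r * Real.cos θ, r * Real.sin θ) =
      r • L (Real.cos θ, Real.sin θ) + r ^ 2 • R) :
    radVel V (r * Real.cos θ, r * Real.sin θ) =
      (Real.cos θ * (L (Real.cos θ, Real.sin θ)).1 + Real.sin θ * (L (Real.cos θ, Real.sin θ)).2) +
      r * (Real.cos θ * R.1 + Real.sin θ * R.2) := by
  simp only [radVel, sq_cos_add_sq_sin, hR, Prod.fst_add, Prod.snd_add, Prod.smul_fst,
    Prod.smul_snd, smul_eq_mul]
  field_simp
  ring

theorem abs_trig_comb_le (θ a b : ℝ) {C : ℝ} (ha : |a| ≤ C) (hb : |b| ≤ C) :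
    |Real.cos θ * a + Real.sin θ * b| ≤ 2 * C := by
  refine (abs_add_le _ _).trans ?_
  rw [abs_mul, abs_mul]
  have h1 := mul_le_mul (Real.abs_cos_le_one θ) ha (abs_nonneg _) zero_le_one
  have h2 := mul_le_mul (Real.abs_sin_le_one θ) hb (abs_nonneg _) zero_le_one
  linarith

/-- Near a counter-clockwise monodromic singularity, the field turns uniformly and its radial
velocity is bounded. -/
theorem IsNondegenerateMonodromic.exists_vel_bounds {V : ℝ × ℝ → ℝ × ℝ}
    (hV : IsNondegenerateMonodromic V) {m : ℝ} (hm : 0 < m)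
    (hmd : ∀ θ : ℝ, m ≤ Real.cos θ * (fderiv ℝ V 0 (Real.cos θ, Real.sin θ)).2 -
      Real.sin θ * (fderiv ℝ V 0 (Real.cos θ, Real.sin θ)).1) :
    ∃ δ₀ > 0, ∃ K, 0 ≤ K ∧ ∀ δ, 0 < δ → δ ≤ δ₀ → ContinuousOn V {p | p.1 ^ 2 + p.2 ^ 2 ≤ δ ^ 2} ∧
      ∀ p : ℝ × ℝ, 0 < p.1 ^ 2 + p.2 ^ 2 → p.1 ^ 2 + p.2 ^ 2 ≤ δ ^ 2 →
        m / 2 ≤ angVel V p ∧ |radVel V p| ≤ K := by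
  obtain ⟨_, _, δ₁, hδ₁, C, hC0, hC⟩ := hV.analytic.exists_polar_expansion hV.singular 0
  obtain ⟨δ₂, hδ₂, hcont⟩ := Metric.eventually_nhds_iff_ball.1 hV.analytic.eventually_continuousAt
  set L := fderiv ℝ V 0 with hL
  -- The quadratic remainder changes the angular velocity by at most 2Cr; the last bound keeps this
  -- below m / 2.
  refine ⟨min δ₁ (min (δ₂ / 2) (min 1 (m / (4 * C + 1)))), by positivity, 2 * ‖L‖ + 2 * C,
    by positivity, fun δ hδ hδle => ⟨fun p hp => ?_, fun p hp0 hp => ?_⟩⟩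
  · refine (hcont p ?_).continuousWithinAt
    have hδ2 : δ < δ₂ := by
      have := hδle.trans ((min_le_right _ _).trans (min_le_left _ _))
      linarith
    rw [mem_ball_zero_iff, Prod.norm_def, max_lt_iff, Real.norm_eq_abs, Real.norm_eq_abs]
    have hp' : p.1 ^ 2 + p.2 ^ 2 ≤ δ ^ 2 := hp
    exact ⟨(abs_le_of_sq_le_sq (by nlinarith [sq_nonneg p.2]) hδ.le).trans_lt hδ2,
      (abs_le_of_sq_le_sq (by nlinarith [sq_nonneg p.1]) hδ.le).trans_lt hδ2⟩
  · obtain ⟨θ, hθ⟩ := exists_cos_sin p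
    set r := √(p.1 ^ 2 + p.2 ^ 2) with hr
    have hr0 : 0 < r := Real.sqrt_pos.2 hp0
    have hrδ : r ≤ δ := Real.sqrt_le_iff.2 ⟨hδ.le, hp⟩
    have hrδ' := hrδ.trans hδle
    rw [hθ]
    set R := (r ^ 2)⁻¹ • (V (r * Real.cos θ, r * Real.sin θ) -
      r • L (Real.cos θ, Real.sin θ)) with hR
    have hVR : V (r * Real.cos θ, r * Real.sin θ) =
        r • L (Real.cos θ, Real.sin θ) + r ^ 2 • R := by
      rw [hR, smul_smul, mul_inv_cancel₀ (by positivity), one_smul, add_sub_cancel]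
    have hRC : ‖R‖ ≤ C := by
      have h1 := hC r θ (by rw [abs_of_pos hr0]; exact hrδ'.trans (min_le_left _ _))
      rw [Finset.sum_range_zero, sub_zero, abs_of_pos hr0, zero_add] at h1
      rw [hR, norm_smul, norm_inv, Real.norm_of_nonneg (by positivity), inv_mul_le_iff₀
        (by positivity)]
      exact h1.trans_eq (mul_comm _ _)
    have hR1 : |R.1| ≤ C := (norm_fst_le R).trans hRC
    have hR2 : |R.2| ≤ C := (norm_snd_le R).trans hRC
    rw [angVel_polar V L hr0.ne' hVR, radVel_polar V L hr0.ne' hVR]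
    constructor
    · have h1 := abs_trig_comb_le θ R.2 (-R.1) hR2 (by rwa [abs_neg])
      have h2 : r * (4 * C + 1) ≤ m := by
        rw [← le_div_iff₀ (by positivity)]
        exact hrδ'.trans ((min_le_right _ _).trans ((min_le_right _ _).trans (min_le_right _ _)))
      have h3 := hmd θ
      have h4 := mul_le_mul_of_nonneg_left (abs_le.1 h1).1 hr0.le
      nlinarith
    · have h1 := abs_trig_comb_le θ R.1 R.2 hR1 hR2
      have hLn : ‖L (Real.cos θ, Real.sin θ)‖ ≤ ‖L‖ :=
        (L.le_opNorm _).trans (mul_le_of_le_one_right (norm_nonneg _)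
          (by simpa using norm_cos_sin_le 1 θ))
      have h2 := abs_trig_comb_le θ _ _ ((norm_fst_le (L (Real.cos θ, Real.sin θ))).trans hLn)
        ((norm_snd_le (L (Real.cos θ, Real.sin θ))).trans hLn)
      have hr1 : r ≤ 1 :=
        hrδ'.trans ((min_le_right _ _).trans ((min_le_right _ _).trans (min_le_left _ _)))
      refine (abs_add_le _ _).trans (add_le_add h2 ?_)
      rw [abs_mul, abs_of_pos hr0]
      exact (mul_le_of_le_one_left (abs_nonneg _) hr1).trans h1

/-- Near a counter-clockwise monodromic singularity the end point of an arc has an expansion to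
any order in its starting point. -/
theorem IsNondegenerateMonodromic.exists_jet {V : ℝ × ℝ → ℝ × ℝ}
    (hV : IsNondegenerateMonodromic V)
    (hcc : ∀ᶠ x in 𝓝[≠] (0 : ℝ), SignType.sign (V (x, 0)).2 = SignType.sign x) (N : ℕ) :
    ∃ p : Polynomial ℝ, p.coeff 0 = 0 ∧ ∃ C, ∀ᶠ x in 𝓝[≠] (0 : ℝ), ∀ x', IsArc V x x' →
      |x' - p.eval x| ≤ C * |x| ^ (N + 1) ∧ x * x' < 0 := by
  obtain ⟨m, hm, hmd⟩ := hV.exists_pos_le_angular hcc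
  obtain ⟨q, hq, δ₁, hδ₁, C₁, -, hC₁⟩ := hV.analytic.exists_polar_expansion hV.singular N
  obtain ⟨δ₀, hδ₀, K, hK, hvel⟩ := hV.exists_vel_bounds hm hmd
  set L := fderiv ℝ V 0 with hL
  set δ := min 1 (min δ₀ δ₁) with hδ
  have hδpos : 0 < δ := by positivity
  have hδ1 : δ ≤ 1 := min_le_left _ _
  obtain ⟨hVc, hVb⟩ := hvel δ hδpos ((min_le_right _ _).trans (min_le_left _ _))
  set M := Real.exp (K * (Real.pi / (m / 2))) with hM
  have hM0 : 0 < M := Real.exp_pos _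
  have hM1 : 1 ≤ M := Real.one_le_exp (by have := Real.pi_pos; positivity)
  -- The radius carries the sign of the starting point, so every arc runs from angle 0 to π and one
  -- expansion serves both sides. Starting within δ / M keeps it at most δ.
  set r : PolarArc V (δ / M) M → ℝ → ℝ := fun a t => a.x * a.c t with hr
  have hr0 : ∀ a : PolarArc V (δ / M) M, ∀ t ∈ Icc 0 a.T, r a t ≠ 0 := fun a t ht =>
    mul_ne_zero a.x_ne (a.curve.c_pos t ht).ne'
  have hrδ : ∀ a : PolarArc V (δ / M) M, ∀ t ∈ Icc 0 a.T, |r a t| ≤ δ := fun a t ht => by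
    rw [hr, abs_mul, abs_of_pos (a.curve.c_pos t ht)]
    have h1 := a.x_lt.le
    rw [le_div_iff₀ hM0] at h1
    exact (mul_le_mul_of_nonneg_left (a.c_le t ht) (abs_nonneg _)).trans h1
  set R : PolarArc V (δ / M) M → ℝ → ℝ × ℝ := fun a t => (r a t ^ 2)⁻¹ •
    (V (r a t * Real.cos (a.θ t), r a t * Real.sin (a.θ t)) -
      r a t • L (Real.cos (a.θ t), Real.sin (a.θ t))) with hR
  have hVR : ∀ a : PolarArc V (δ / M) M, ∀ t ∈ Icc 0 a.T,
      V (r a t * Real.cos (a.θ t), r a t * Real.sin (a.θ t)) =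
        r a t • L (Real.cos (a.θ t), Real.sin (a.θ t)) + r a t ^ 2 • R a t := fun a t ht => by
    rw [hR, smul_smul, mul_inv_cancel₀ (pow_ne_zero 2 (hr0 a t ht)), one_smul, add_sub_cancel]
  have hθ : ∀ a : PolarArc V (δ / M) M, ∀ t ∈ Icc 0 a.T, a.θ t ∈ Icc 0 Real.pi :=
    fun a => a.θ_mem
  have hr1 : ∀ a : PolarArc V (δ / M) M, ∀ t ∈ Icc 0 a.T, |r a t| ≤ 1 :=
    fun a t ht => (hrδ a t ht).trans hδ1
  have hRexp : ∀ f : ℝ × ℝ →L[ℝ] ℝ,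
      HasUExp PolarArc.T PolarArc.θ r N (fun a t => f (R a t)) := by
    intro f
    have h1 : HasUExp PolarArc.T PolarArc.θ r N (fun a t => f (R a t) -
        ∑ i ∈ Finset.range N, r a t ^ i * f (q i (a.θ t))) := by
      refine HasUExp.of_abs_le_pow hr0 (C := ‖f‖ * C₁) fun a t ht => ?_
      have h2 := hC₁ (r a t) (a.θ t) ((hrδ a t ht).trans
        ((min_le_right _ _).trans (min_le_right _ _)))
      rw [hVR a t ht, add_sub_cancel_left] at h2
      have h3 : r a t ^ 2 • R a t - ∑ i ∈ Finset.range N, r a t ^ (i + 2) • q i (a.θ t) =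
          r a t ^ 2 • (R a t - ∑ i ∈ Finset.range N, r a t ^ i • q i (a.θ t)) := by
        rw [smul_sub, Finset.smul_sum]
        simp only [smul_smul, ← pow_add, add_comm 2]
      have h4 : f (R a t) - ∑ i ∈ Finset.range N, r a t ^ i * f (q i (a.θ t)) =
          f (R a t - ∑ i ∈ Finset.range N, r a t ^ i • q i (a.θ t)) := by
        simp
      rw [h3, norm_smul, norm_pow, Real.norm_eq_abs, pow_add, ← mul_assoc, mul_comm,
        mul_le_mul_iff_left₀ (pow_pos (abs_pos.2 (hr0 a t ht)) 2)] at h2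
      rw [h4, mul_assoc]
      exact (f.le_opNorm _).trans (mul_le_mul_of_nonneg_left h2 (norm_nonneg _))
    refine (h1.add (HasUExp.sum (Finset.range N) (F := fun i a t => r a t ^ i * f (q i (a.θ t)))
      fun i => HasUExp.pow_mul hθ hr1 (HasUExp.of_continuous hθ
        (f.continuous.comp (hq i))) i)).congr fun a t ht => by ring
  have hR1 := hRexp (ContinuousLinearMap.fst ℝ ℝ ℝ)
  have hR2 := hRexp (ContinuousLinearMap.snd ℝ ℝ ℝ)
  have hcos : HasUExp PolarArc.T PolarArc.θ r N (fun a t => Real.cos (a.θ t)) :=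
    HasUExp.of_continuous hθ Real.continuous_cos
  have hsin : HasUExp PolarArc.T PolarArc.θ r N (fun a t => Real.sin (a.θ t)) :=
    HasUExp.of_continuous hθ Real.continuous_sin
  have hcos_sin : Continuous fun θ => L (Real.cos θ, Real.sin θ) := by fun_prop
  -- The family consists of all arcs at once, so the estimate needs no uniqueness of trajectories.
  have hexp := hasUExp_radius (κ := PolarArc V (δ / M) M) (T := PolarArc.T) (ε := PolarArc.x)
    (θ := PolarArc.θ) (c := PolarArc.c)
    (D := fun a t => angVel V (r a t * Real.cos (a.θ t), r a t * Real.sin (a.θ t)))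
    (lam := fun a t => radVel V (r a t * Real.cos (a.θ t), r a t * Real.sin (a.θ t)))
    (d := fun θ => Real.cos θ * (L (Real.cos θ, Real.sin θ)).2 -
      Real.sin θ * (L (Real.cos θ, Real.sin θ)).1)
    (l := fun θ => Real.cos θ * (L (Real.cos θ, Real.sin θ)).1 +
      Real.sin θ * (L (Real.cos θ, Real.sin θ)).2) (m := m / 2)
    hθ (fun a => a.curve.θ_zero) (fun a => a.x_ne)
    (fun a => a.x_lt.le.trans ((div_le_one hM0).2 (hδ1.trans hM1))) (fun a => a.T_pos.le)
    (fun a => a.curve.θ_cont) (fun a => a.curve.θ_deriv) (fun a => a.curve.c_cont)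
    (fun a => a.curve.c_zero) (fun a => a.curve.c_deriv)
    ⟨M, fun a t ht => (abs_of_pos (a.curve.c_pos t ht)).trans_le (a.c_le t ht)⟩
    (by fun_prop) (fun θ => (hm.trans_le (hmd θ)).ne') (by fun_prop) (by positivity)
    (fun a t ht => (hVb _ (by
      dsimp only
      rw [sq_cos_add_sq_sin]
      exact sq_pos_of_ne_zero (hr0 a t ht)) (by
      dsimp only
      rw [sq_cos_add_sq_sin]
      exact sq_le_sq' (abs_le.1 (hrδ a t ht)).1 (abs_le.1 (hrδ a t ht)).2)).1)
    ((HasUExp.mul hθ hr1 hcos hR2).sub (HasUExp.mul hθ hr1 hsin hR1))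
    ((HasUExp.mul hθ hr1 hcos hR1).add (HasUExp.mul hθ hr1 hsin hR2))
    hr1 (fun a t ht => angVel_polar V L (hr0 a t ht) (hVR a t ht))
    (fun a t ht => radVel_polar V L (hr0 a t ht) (hVR a t ht))
  obtain ⟨p, C, hp⟩ := hexp.exists_polynomial Real.pi
  -- At angle π the end point is -(x c(T)), and p is the jet of c(T).
  refine ⟨-(Polynomial.X * p), by simp, C, ?_⟩
  have hη : 0 < δ / M := by positivity
  filter_upwards [self_mem_nhdsWithin, nhdsWithin_le_nhds (Metric.ball_mem_nhds (0 : ℝ) hη)]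
    with x hx0 hx x' hxx'
  rw [mem_ball_zero_iff, Real.norm_eq_abs] at hx
  obtain ⟨T, θ, c, hT, hcurve, hb, hθT, rfl⟩ := hxx'.exists_polar (half_pos hm) hδpos hK hVc hVb
    hx0 (by rwa [← lt_div_iff₀ hM0])
  have hTT := right_mem_Icc.2 hT.le
  have h1 := hp ⟨x, T, θ, c, hx0, hx, hT, hcurve, fun t ht => (hb t ht).1,
    fun t ht => (hb t ht).2⟩ T hTT hθT
  refine ⟨?_, ?_⟩
  · have h2 : -(x * c T) - (-(Polynomial.X * p)).eval x = -(x * (c T - p.eval x)) := by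
      simp; ring
    rw [h2, abs_neg, abs_mul, pow_succ, ← mul_assoc, mul_comm]
    exact mul_le_mul_of_nonneg_right h1 (abs_nonneg _)
  · have := hcurve.c_pos T hTT
    have hx2 : 0 < x ^ 2 := by have : x ≠ 0 := hx0; positivity
    nlinarith [mul_pos hx2 this]

theorem IsFirstReturn.exists_isArc {V₁ V₂ : ℝ × ℝ → ℝ × ℝ} {x x' : ℝ}
    (h : IsFirstReturn V₁ V₂ x x') : ∃ x₁, IsArc V₁ x x₁ ∧ IsArc V₂ x₁ x' := by
  obtain ⟨-, -, S, T, γ, hS, hST, hc, h0, -, hS2, hT, hup, hlow, hd⟩ := h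
  refine ⟨(γ S).1, ⟨S, γ, hS, h0, Prod.ext rfl hS2, hc.mono (Icc_subset_Icc_right hST.le),
    fun t ht => ?_, fun t ht => (hup t ht).ne'⟩, ⟨T - S, fun t => γ (S + t), sub_pos.2 hST,
    ?_, ?_, ?_, fun t ht => ?_, fun t ht => (hlow _ ⟨by linarith [ht.1], by linarith [ht.2]⟩).ne⟩⟩
  · have := hd t ⟨ht.1, ht.2.trans hST⟩ ht.2.ne
    simpa [gluing, hup t ht, (hup t ht).not_gt] using this
  · dsimp only
    rw [add_zero]
    exact Prod.ext rfl hS2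
  · dsimp only
    rw [add_sub_cancel]
    exact hT
  · exact hc.comp (by fun_prop) fun t ht => ⟨by linarith [ht.1], by linarith [ht.2]⟩
  · have hlt := hlow (S + t) ⟨by linarith [ht.1], by linarith [ht.2]⟩
    have := hd (S + t) ⟨by linarith [ht.1], by linarith [ht.2]⟩ (by linarith [ht.1])
    simp only [gluing, indicator, mem_ofPred_eq, hlt, hlt.not_gt, if_true, if_false, zero_add]
      at this
    simpa using this.comp_const_add S t

/-! ### Algebra of truncated jets. -/

section Polynomial

open Polynomial

/-- One-sided asymptotics suffice to determine a polynomial jet, which is why the return map on the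
positive axis can be compared with two-sided maps. -/
theorem X_pow_dvd_of_isLittleO (q : ℝ[X]) (n : ℕ)
    (h : (fun x : ℝ => q.eval x) =o[𝓝[>] 0] fun x => x ^ n) : X ^ (n + 1) ∣ q := by
  have key : ∀ q : ℝ[X], ((fun x : ℝ => q.eval x) =o[𝓝[>] 0] fun _ => (1 : ℝ)) → X ∣ q := by
    intro q h
    rw [isLittleO_one_iff] at h
    have h2 : Tendsto (fun x : ℝ => q.eval x) (𝓝[>] 0) (𝓝 (q.eval 0)) :=
      q.continuous.continuousAt.tendsto.mono_left nhdsWithin_le_nhds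
    rw [X_dvd_iff, coeff_zero_eq_eval_zero]
    exact tendsto_nhds_unique h2 h
  induction n generalizing q with
  | zero => simpa using key q (by simpa using h)
  | succ n ih =>
    obtain ⟨r, rfl⟩ := key q (h.trans_isBigO (IsBigO.of_bound 1 (by
      filter_upwards [Ioo_mem_nhdsGT one_pos] with x hx
      simp only [norm_pow, Real.norm_eq_abs, abs_of_pos hx.1, norm_one, mul_one]
      exact pow_le_one₀ hx.1.le hx.2.le)))
    rw [pow_succ']
    refine mul_dvd_mul_left _ (ih r ?_)
    have h2 := (isBigO_refl (fun x : ℝ => x⁻¹) (𝓝[>] 0)).mul_isLittleO h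
    refine h2.congr' ?_ ?_ <;> filter_upwards [self_mem_nhdsWithin] with x hx <;>
      have hx' : x ≠ 0 := (show 0 < x from hx).ne'
    · simp [hx']
    · rw [pow_succ']; field_simp

theorem dvd_comp_sub_comp {R : Type*} [CommRing R] (q A B : R[X]) :
    A - B ∣ q.comp A - q.comp B := by
  have := sub_dvd_eval_sub A B (q.map C)
  simpa only [eval_map, ← comp.eq_1] using this

theorem X_pow_dvd_comp {R : Type*} [CommRing R] {q p : R[X]} {n : ℕ} (hp : X ∣ p)
    (h : X ^ n ∣ q) : X ^ n ∣ q.comp p := by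
  obtain ⟨s, rfl⟩ := h
  rw [mul_comp, pow_comp, X_comp]
  exact (pow_dvd_pow_of_dvd hp n).mul_right _

/-- If two jets invert each other and one of them is an involution, up to a given order, then so is
the other. -/
theorem involution_of_comp {p₁ p₂ : ℝ[X]} {n : ℕ} (h1 : X ∣ p₁) (h2 : X ∣ p₂)
    (h11 : X ^ n ∣ p₁.comp p₁ - X) (h21 : X ^ n ∣ p₂.comp p₁ - X) : X ^ n ∣ p₂.comp p₂ - X := by
  have e1 : X ^ n ∣ (p₂.comp p₁).comp p₁ - p₁ := by
    simpa using X_pow_dvd_comp h1 h21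
  have e2 : X ^ n ∣ p₂.comp (p₁.comp p₁) - p₂ := by
    simpa using h11.trans (dvd_comp_sub_comp p₂ (p₁.comp p₁) X)
  -- The composition p₂ ∘ p₁ ∘ p₁, bracketed in two ways, is p₁ and p₂ modulo X^n.
  have e3 : X ^ n ∣ p₂ - p₁ := by
    rw [comp_assoc] at e1
    have := dvd_sub e1 e2
    ring_nf at this ⊢
    exact this
  have e4 : X ^ n ∣ (p₂ - p₁).comp p₂ := X_pow_dvd_comp h2 e3
  have e5 : X ^ n ∣ p₁.comp p₂ - p₁.comp p₁ := e3.trans (dvd_comp_sub_comp p₁ p₂ p₁)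
  have := dvd_add (dvd_add e4 e5) h11
  rw [sub_comp] at this
  simpa using this

theorem eval_zero_sq_of_involution {u : ℝ[X]} (h : X ^ 2 ∣ (X * u).comp (X * u) - X) :
    u.eval 0 ^ 2 = 1 := by
  rw [mul_comp, X_comp, mul_assoc, show X * (u * u.comp (X * u)) - X =
    X * (u * u.comp (X * u) - 1) by ring, pow_two] at h
  have h2 := (mul_dvd_mul_iff_left (X_ne_zero (R := ℝ))).1 h
  rw [X_dvd_iff, coeff_zero_eq_eval_zero] at h2
  simp [eval_comp] at h2
  linarith

theorem X_dvd_add_one {u : ℝ[X]} (h : u.eval 0 = -1) : X ∣ u + 1 := by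
  rw [X_dvd_iff, coeff_zero_eq_eval_zero]; simp [h]

theorem X_pow_dvd_pow_add {u : ℝ[X]} (h : u.eval 0 = -1) {k : ℕ} (hk : Odd k) :
    X ^ (k + 1) ∣ (X * u) ^ k + X ^ k := by
  have h1 : u + 1 ∣ u ^ k + 1 := by
    have := sub_dvd_pow_sub_pow u (-1) k
    rwa [hk.neg_one_pow, sub_neg_eq_add, sub_neg_eq_add] at this
  rw [mul_pow, ← mul_add_one, pow_succ]
  exact mul_dvd_mul_left _ ((X_dvd_add_one h).trans h1)

/-- A map of slope -1 reverses a difference of order k, up to order k + 1. -/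
theorem X_pow_dvd_comp_sub_add {u A B : ℝ[X]} (h : u.eval 0 = -1) (hA : X ∣ A) (hB : X ∣ B)
    {k : ℕ} (hAB : X ^ k ∣ A - B) :
    X ^ (k + 1) ∣ (X * u).comp A - (X * u).comp B + (A - B) := by
  have h2 : (X * u).comp A - (X * u).comp B + (A - B) =
      A * ((u + 1).comp A - (u + 1).comp B) + (A - B) * (u + 1).comp B := by
    simp; ring
  rw [h2]
  refine dvd_add ?_ ?_
  · rw [pow_succ']
    exact mul_dvd_mul hA (hAB.trans (dvd_comp_sub_comp _ _ _))
  · rw [pow_succ]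
    refine mul_dvd_mul hAB ?_
    have := X_pow_dvd_comp (n := 1) (q := u + 1) hB (by simpa using X_dvd_add_one h)
    rwa [pow_one] at this

/-- Two orientation-reversing involutive jets cannot differ from inverses of each other at odd
order. -/
theorem eq_zero_of_involutions {u₁ u₂ : ℝ[X]} (h1 : u₁.eval 0 = -1) (h2 : u₂.eval 0 = -1)
    {k : ℕ} (hk : Odd k) {α : ℝ} (h11 : X ^ (k + 1) ∣ (X * u₁).comp (X * u₁) - X)
    (h22 : X ^ (k + 1) ∣ (X * u₂).comp (X * u₂) - X)
    (h21 : X ^ (k + 1) ∣ (X * u₂).comp (X * u₁) - X - C α * X ^ k) : α = 0 := by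
  have d1 : X ∣ X * u₁ := dvd_mul_right _ _
  have d2 : X ∣ X * u₂ := dvd_mul_right _ _
  have q1 := X_pow_dvd_pow_add h1 hk
  have q2 := X_pow_dvd_pow_add h2 hk
  set p₁ := X * u₁ with hp1
  set p₂ := X * u₂ with hp2
  have e1 : X ^ (k + 1) ∣ p₂.comp (p₁.comp p₁) - p₁ - C α * p₁ ^ k := by
    simpa [comp_assoc] using X_pow_dvd_comp d1 h21
  have e2 : X ^ (k + 1) ∣ p₂.comp (p₁.comp p₁) - p₂ := by
    simpa using h11.trans (dvd_comp_sub_comp p₂ (p₁.comp p₁) X)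
  -- Composing the expansion of p₂ ∘ p₁ with p₁ gives p₂ ≡ p₁ + α p₁^k, and p₁^k ≡ -X^k because k is
  -- odd.
  have e3 : X ^ (k + 1) ∣ p₂ - p₁ + C α * X ^ k := by
    have := dvd_add (dvd_sub e1 e2) (q1.mul_left (C α))
    ring_nf at this ⊢
    exact this
  have e4 : X ^ k ∣ p₂ - p₁ := by
    have := dvd_sub ((pow_dvd_pow X (Nat.le_succ k)).trans e3) (dvd_mul_left (X ^ k) (C α))
    simpa using this
  have e5 : X ^ (k + 1) ∣ p₂.comp p₂ - p₁.comp p₂ + C α * p₂ ^ k := by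
    simpa using X_pow_dvd_comp d2 e3
  have e6 := X_pow_dvd_comp_sub_add h1 d2 d1 e4
  rw [← hp1] at e6
  -- In p₂ ∘ p₂ ≡ p₁ ∘ p₂ - α p₂^k each of the two terms exceeds its unperturbed value by αX^k; the
  -- involutions on both sides cancel.
  have e7 : X ^ (k + 1) ∣ C (2 * α) * X ^ k := by
    have := dvd_sub (dvd_sub (dvd_add (dvd_add (dvd_add e5 e6) h11)
      (dvd_neg.2 h22)) (dvd_neg.2 (dvd_neg.2 e3))) ((q2.mul_left (C α)))
    rw [map_mul, show (C (2 : ℝ)) = 2 from rfl]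
    rw [← dvd_neg]
    ring_nf at this ⊢
    exact this
  have e8 := X_pow_dvd_iff.1 e7 k (Nat.lt_succ_self k)
  rw [coeff_C_mul_X_pow] at e8
  simpa using e8

end Polynomial

/-! ### Jets of semi-monodromy and return maps; necessity. -/

open Polynomial in
/-- Composition of jets. -/
theorem isBigO_comp_jet {l : Filter ℝ} (hl : l ≤ 𝓝 0) {f G : ℝ → ℝ} {p q : ℝ[X]} {N : ℕ}
    (hp : X ∣ p) (hf : (fun x => f x - p.eval x) =O[l] fun x => x ^ (N + 1))
    (hG : (fun x => G x - q.eval (f x)) =O[l] fun x => f x ^ (N + 1)) :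
    (fun x => G x - (q.comp p).eval x) =O[l] fun x => x ^ (N + 1) := by
  have hx1 : Tendsto (fun x : ℝ => x) l (𝓝 0) := hl
  have hpx : (fun x => p.eval x) =O[l] fun x => x := by
    obtain ⟨u, rfl⟩ := hp
    have h1 : (fun x => u.eval x) =O[l] fun _ => (1 : ℝ) :=
      (u.continuous.continuousAt.tendsto.mono_left hl).isBigO_one ℝ
    simpa using (isBigO_refl (fun x : ℝ => x) l).mul h1
  have hpow : (fun x : ℝ => x ^ (N + 1)) =O[l] fun x => x := by
    have h1 : (fun x : ℝ => x ^ N) =O[l] fun _ => (1 : ℝ) :=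
      (hx1.pow N).isBigO_one ℝ
    simpa [pow_succ'] using (isBigO_refl (fun x : ℝ => x) l).mul h1
  have hfx : f =O[l] fun x => x := by simpa using (hf.trans hpow).add hpx
  have hf0 : Tendsto f l (𝓝 0) := hfx.trans_tendsto hx1
  have hp0 : Tendsto (fun x => p.eval x) l (𝓝 0) := hpx.trans_tendsto hx1
  have h1 : (fun x => q.eval (f x) - q.eval (p.eval x)) =O[l] fun x => f x - p.eval x :=
    (q.hasStrictDerivAt 0).isBigO_sub.comp_tendsto (hf0.prodMk_nhds hp0)
  have h2 := (hG.trans (hfx.pow (N + 1))).add (h1.trans hf)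
  simpa [eval_comp] using h2

open Polynomial in
/-- The jet of the semi-monodromy map of a focus of order `k`. -/
theorem HasFocusOfOrder.exists_jet {V : ℝ × ℝ → ℝ × ℝ} {k : ℕ} (hV : HasFocusOfOrder V k)
    (hcc : ∀ᶠ x in 𝓝[≠] (0 : ℝ), SignType.sign (V (x, 0)).2 = SignType.sign x) (N : ℕ) :
    ∃ u : ℝ[X], (∃ C, ∀ᶠ x in 𝓝[≠] (0 : ℝ), ∀ x', IsArc V x x' →
      |x' - (X * u).eval x| ≤ C * |x| ^ (N + 1) ∧ x * x' < 0) ∧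
      (1 ≤ N → u.eval 0 ≤ 0) ∧ (N < 2 * k + 1 → X ^ (N + 1) ∣ (X * u).comp (X * u) - X) ∧
      (N = 2 * k + 1 → ¬ X ^ (N + 1) ∣ (X * u).comp (X * u) - X) := by
  obtain ⟨hmon, h, hh, α, hα, ho⟩ := hV
  obtain ⟨p, hp0, C, hp⟩ := hmon.exists_jet hcc N
  obtain ⟨u, rfl⟩ := X_dvd_iff.2 hp0
  refine ⟨u, ⟨C, hp⟩, ?_⟩
  have hd : X ∣ X * u := dvd_mul_right _ _
  have hjet : ∀ᶠ x in 𝓝[≠] (0 : ℝ), |h x - (X * u).eval x| ≤ C * |x| ^ (N + 1) ∧ x * h x < 0 := by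
    filter_upwards [hh, hp] with x h1 h2 using h2 _ h1.isArc
  have hO : (fun x => h x - (X * u).eval x) =O[𝓝[≠] 0] fun x => x ^ (N + 1) :=
    IsBigO.of_bound C (hjet.mono fun x hx => by simpa using hx.1)
  have hle : 𝓝[≠] (0 : ℝ) ≤ 𝓝 0 := nhdsWithin_le_nhds
  have hh0 : Tendsto h (𝓝[≠] 0) (𝓝[≠] 0) := by
    refine tendsto_nhdsWithin_iff.2 ⟨?_, hjet.mono fun x hx h0 => ?_⟩
    · have h1 : Tendsto (fun x : ℝ => x ^ (N + 1)) (𝓝[≠] 0) (𝓝 0) := by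
        simpa using ((continuous_pow (M := ℝ) (N + 1)).tendsto 0).mono_left hle
      have h2 : Tendsto (fun x : ℝ => (X * u).eval x) (𝓝[≠] 0) (𝓝 0) := by
        have := ((X * u).continuous.tendsto 0).mono_left hle
        rwa [eval_mul, eval_X, zero_mul] at this
      simpa using (hO.trans_tendsto h1).add h2
    · have := hx.2
      rw [show h x = 0 from h0] at this
      simp at this
  have hcomp := isBigO_comp_jet hle hd hO (G := fun x => h (h x)) (q := X * u)
    (hO.comp_tendsto hh0)
  have hgt : 𝓝[>] (0 : ℝ) ≤ 𝓝[≠] 0 := nhdsWithin_mono _ fun x hx => (show 0 < x from hx).ne'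
  have hsucc : ∀ a b : ℕ, a < b → (fun x : ℝ => x ^ b) =o[𝓝[≠] 0] fun x => x ^ a :=
    fun a b hab => (isLittleO_pow_pow hab).mono hle
  refine ⟨fun hN => ?_, fun hN => ?_, fun hN hdvd => ?_⟩
  -- The slope is the limit of h(x) / x, negative because a half turn lands on the opposite side.
  · have h1 : Tendsto (fun x => (h x - (X * u).eval x) / x) (𝓝[≠] 0) (𝓝 0) := by
      have := hO.trans_isLittleO (hsucc 1 (N + 1) (by omega))
      simpa using this.tendsto_div_nhds_zero
    have h2 := h1.add ((u.continuous.tendsto 0).mono_left hle)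
    rw [zero_add] at h2
    refine le_of_tendsto h2 ?_
    filter_upwards [hjet, self_mem_nhdsWithin] with x hx hx0
    have hx0' : x ≠ 0 := hx0
    have h3 : (h x - (X * u).eval x) / x + u.eval x = x * h x / x ^ 2 := by
      simp only [eval_mul, eval_X]
      field_simp
      ring
    rw [h3]
    exact div_nonpos_of_nonpos_of_nonneg hx.2.le (sq_nonneg x)
  · refine X_pow_dvd_of_isLittleO _ N ?_
    have h1 : (fun x => h (h x) - x) =o[𝓝[≠] 0] fun x => x ^ N := by
      have h2 := (ho.trans (hsucc N _ hN)).add ((hsucc N _ hN).const_mul_left α)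
      simpa using h2
    have h2 := h1.sub (hcomp.trans_isLittleO (hsucc N (N + 1) (by omega)))
    refine (h2.congr_left fun x => ?_).mono hgt
    simp
  · refine hα ?_
    obtain ⟨s, hs⟩ := hdvd
    have h1 : (fun x => ((X * u).comp (X * u) - X : ℝ[X]).eval x) =o[𝓝[≠] 0]
        fun x : ℝ => x ^ N := by
      rw [hs]
      have h2 : (fun x => s.eval x) =O[𝓝[≠] 0] fun _ => (1 : ℝ) :=
        ((s.continuous.tendsto 0).mono_left hle).isBigO_one ℝ
      simpa using (hsucc N (N + 1) (by omega)).mul_isBigO h2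
    have h2 := h1.add (hcomp.trans_isLittleO (hsucc N (N + 1) (by omega)))
    rw [← hN] at ho
    have h3 : (fun x : ℝ => α * x ^ N) =o[𝓝[≠] 0] fun x => x ^ N :=
      (h2.sub ho).congr_left fun x => by simp
    have h4 := h3.tendsto_div_nhds_zero
    refine tendsto_nhds_unique (tendsto_const_nhds.congr' ?_) h4
    filter_upwards [self_mem_nhdsWithin] with x hx
    have hx0' : x ≠ 0 := hx
    field_simp

open Polynomial in
/-- The possible orders of a pseudo focus: it is even, or at least `2 k₂ + 1`, and in the latter
case it is `2 k₂ + 1` if `k₂ < k₁`. -/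
theorem HasFFPseudoFocusOfOrder.order {V₁ V₂ : ℝ × ℝ → ℝ × ℝ} {k₁ k₂ k : ℕ} (hk : k₂ ≤ k₁)
    (hk1 : 1 ≤ k) (h1 : HasFocusOfOrder V₁ k₁) (h2 : HasFocusOfOrder V₂ k₂)
    (h : HasFFPseudoFocusOfOrder V₁ V₂ k) :
    (k < 2 * k₂ + 1 → Even k) ∧ (k₂ < k₁ → k ≤ 2 * k₂ + 1) := by
  obtain ⟨⟨-, -, hcc⟩, P, hP, α, hα, ho⟩ := h
  have hgt : 𝓝[>] (0 : ℝ) ≤ 𝓝[≠] 0 := nhdsWithin_mono _ fun x hx => (show 0 < x from hx).ne'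
  have hle : 𝓝[>] (0 : ℝ) ≤ 𝓝 0 := nhdsWithin_le_nhds
  have main : ∀ N, ∃ u₁ u₂ : ℝ[X], (1 ≤ N → u₁.eval 0 ≤ 0 ∧ u₂.eval 0 ≤ 0) ∧
      (N < 2 * k₁ + 1 → X ^ (N + 1) ∣ (X * u₁).comp (X * u₁) - X) ∧
      (N < 2 * k₂ + 1 → X ^ (N + 1) ∣ (X * u₂).comp (X * u₂) - X) ∧
      (N = 2 * k₂ + 1 → ¬ X ^ (N + 1) ∣ (X * u₂).comp (X * u₂) - X) ∧
      (fun x => P x - ((X * u₂).comp (X * u₁)).eval x) =O[𝓝[>] 0] fun x => x ^ (N + 1) := by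
    intro N
    obtain ⟨u₁, ⟨C₁, hC₁⟩, a1, a2, -⟩ := h1.exists_jet (hcc.mono fun _ h => h.1) N
    obtain ⟨u₂, ⟨C₂, hC₂⟩, b1, b2, b3⟩ := h2.exists_jet (hcc.mono fun _ h => h.2) N
    refine ⟨u₁, u₂, fun hN => ⟨a1 hN, b1 hN⟩, a2, b2, b3, ?_⟩
    -- f picks the crossing of the negative semiaxis; it has the jet of the first semi-monodromy
    -- map.
    obtain ⟨f, hf⟩ := (hP.mono fun x hx => hx.exists_isArc).choice
    have hf1 : ∀ᶠ x in 𝓝[>] (0 : ℝ),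
        |f x - (X * u₁).eval x| ≤ C₁ * |x| ^ (N + 1) ∧ x * f x < 0 := by
      filter_upwards [hf, hC₁.filter_mono hgt] with x hx hx' using hx' _ hx.1
    have hO : (fun x => f x - (X * u₁).eval x) =O[𝓝[>] 0] fun x => x ^ (N + 1) :=
      IsBigO.of_bound C₁ (hf1.mono fun x hx => by simpa using hx.1)
    have hf0 : Tendsto f (𝓝[>] 0) (𝓝[≠] 0) := by
      refine tendsto_nhdsWithin_iff.2 ⟨?_, hf1.mono fun x hx h0 => ?_⟩
      · have h1 : Tendsto (fun x : ℝ => x ^ (N + 1)) (𝓝[>] 0) (𝓝 0) := by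
          simpa using ((continuous_pow (M := ℝ) (N + 1)).tendsto 0).mono_left hle
        have h2 : Tendsto (fun x : ℝ => (X * u₁).eval x) (𝓝[>] 0) (𝓝 0) := by
          have := ((X * u₁).continuous.tendsto 0).mono_left hle
          rwa [eval_mul, eval_X, zero_mul] at this
        simpa using (hO.trans_tendsto h1).add h2
      · have := hx.2
        rw [show f x = 0 from h0] at this
        simp at this
    refine isBigO_comp_jet hle (dvd_mul_right _ _) hO (IsBigO.of_bound C₂ ?_)
    filter_upwards [hf, hf0.eventually hC₂] with x hx hx'
    simpa using (hx' _ hx.2).1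
  have hsucc : ∀ a b : ℕ, a < b → (fun x : ℝ => x ^ b) =o[𝓝[>] 0] fun x => x ^ a :=
    fun a b hab => (isLittleO_pow_pow hab).mono hle
  refine ⟨fun hlt => ?_, fun hlt => ?_⟩
  · by_contra hodd
    rw [Nat.not_even_iff_odd] at hodd
    obtain ⟨u₁, u₂, hs, h11, h22, -, hO⟩ := main k
    obtain ⟨s1, s2⟩ := hs hk1
    have d1 := h11 (by omega)
    have d2 := h22 hlt
    have key : ∀ u : ℝ[X], X ^ (k + 1) ∣ (X * u).comp (X * u) - X → u.eval 0 ≤ 0 →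
        u.eval 0 = -1 := fun u hu h0 => by
      have := eval_zero_sq_of_involution ((pow_dvd_pow X (by omega : 2 ≤ k + 1)).trans hu)
      nlinarith
    refine hα (eq_zero_of_involutions (key _ d1 s1) (key _ d2 s2) hodd d1 d2
      (X_pow_dvd_of_isLittleO _ k ?_))
    exact (ho.sub (hO.trans_isLittleO (hsucc k (k + 1) (by omega)))).congr_left fun x => by simp; ring
  · by_contra! hgt'
    -- At this order the first jet is still an involution, the second no longer is, and the return
    -- map is the identity.
    obtain ⟨u₁, u₂, -, h11, -, h22, hO⟩ := main (2 * k₂ + 1)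
    refine h22 rfl (involution_of_comp (dvd_mul_right _ _) (dvd_mul_right _ _) (h11 (by omega)) ?_)
    refine X_pow_dvd_of_isLittleO _ _ ?_
    have h3 := (ho.trans (hsucc _ _ hgt')).add ((hsucc _ _ hgt').const_mul_left α)
    exact (h3.sub (hO.trans_isLittleO (hsucc _ _ (Nat.lt_succ_self _)))).congr_left fun x => by simp

/-! ### The rotationally symmetric equation over half a turn. -/

open scoped NNReal in
/-- Picard-Lindelöf on a given time interval for an autonomous scalar equation with bounded right
hand side. -/
theorem exists_bounded_solution {f : ℝ → ℝ} {L R : ℝ≥0} {τ : ℝ} (hτ : 0 ≤ τ)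
    (hf : ContDiffOn ℝ 1 f (Metric.closedBall 0 R)) (hb : ∀ y : ℝ, |y| ≤ R → |f y| ≤ L)
    (hLR : L * τ ≤ R) : ∃ y : ℝ → ℝ, y 0 = 0 ∧ ∀ t ∈ Icc 0 τ, |y t| ≤ R ∧
      HasDerivWithinAt y (f (y t)) (Icc 0 τ) t := by
  obtain ⟨K, hK⟩ := hf.exists_lipschitzOnWith one_ne_zero (convex_closedBall _ _)
    (isCompact_closedBall _ _)
  have hp : IsPicardLindelof (fun _ => f) (tmin := 0) (tmax := τ) ⟨0, left_mem_Icc.2 hτ⟩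
      (0 : ℝ) R 0 L K := by
    refine IsPicardLindelof.of_time_independent (fun y hy => hb y (by simpa using hy)) hK ?_
    simpa [hτ] using hLR
  -- Working with the fixed point itself keeps the bound |y| ≤ R beside the equation.
  obtain ⟨α, hα⟩ := ODE.FunSpace.exists_isFixedPt_next hp (Metric.mem_closedBall_self le_rfl)
  refine ⟨α.compProj, ?_, fun t ht => ⟨?_, ?_⟩⟩
  · have : α.compProj ((⟨0, left_mem_Icc.2 hτ⟩ : Icc 0 τ) : ℝ) = 0 := by
      rw [ODE.FunSpace.compProj_val, ← hα, ODE.FunSpace.next_apply₀]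
    exact this
  · simpa using α.compProj_mem_closedBall hp.mul_max_le (t := t)
  · refine ODE.hasDerivWithinAt_picard_Icc (left_mem_Icc.2 hτ) hp.continuousOn_uncurry
      α.continuous_compProj.continuousOn
      (fun _ _ => α.compProj_mem_closedBall hp.mul_max_le) 0 ht |>.congr_of_mem (fun t ht => ?_) ht
    nth_rw 1 [← hα]
    rw [ODE.FunSpace.compProj_of_mem ht, ODE.FunSpace.next_apply]

section LogRadius

open Polynomial

/-- `Y w` is, for small `w`, the logarithm of `r / w` along the solution of the rotationally symmetric
equation `dr/dt = r F(r²)` over half a turn with initial value `w`. -/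
def IsLogRadius (F : ℝ[X]) (R δ : ℝ) (Y : ℝ → ℝ → ℝ) : Prop :=
  ∀ w, |w| ≤ δ → Y w 0 = 0 ∧ Y (-w) = Y w ∧ ∀ t ∈ Icc 0 Real.pi, |Y w t| ≤ R ∧
    HasDerivWithinAt (Y w) (F.eval (w ^ 2 * Real.exp (2 * Y w t))) (Icc 0 Real.pi) t

/-- Solutions of the rotationally symmetric equation `dr/dt = r F(r²)` over half a turn, for small
initial radius `w` and in terms of `Y = log (r / w)`. -/
theorem exists_logRadius (F : ℝ[X]) : ∃ R, ∃ δ > 0, ∃ Y : ℝ → ℝ → ℝ, IsLogRadius F R δ Y := by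
  have hπ := Real.pi_pos
  set L : ℝ := |F.eval 0| + 1 with hL
  -- A speed of at most L moves the solution by at most R in time π.
  set R : ℝ := L * Real.pi with hR
  have hL0 : 0 < L := by positivity
  have hR0 : 0 < R := by positivity
  obtain ⟨η, hη, hF⟩ : ∃ η > 0, ∀ s : ℝ, |s| < η → |F.eval s| ≤ L := by
    have h1 : Tendsto (fun s => |F.eval s|) (𝓝 0) (𝓝 |F.eval 0|) := F.continuous.abs.tendsto 0
    obtain ⟨η, hη, h⟩ := Metric.eventually_nhds_iff_ball.1
      (h1.eventually (eventually_lt_nhds (lt_add_one _)))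
    exact ⟨η, hη, fun s hs => (h s (by simpa using hs)).le⟩
  obtain ⟨δ, hδ, hδη⟩ : ∃ δ > 0, ∀ w : ℝ, |w| ≤ δ → w ^ 2 * Real.exp (2 * R) < η := by
    have h1 : Tendsto (fun w : ℝ => w ^ 2 * Real.exp (2 * R)) (𝓝 0) (𝓝 0) := by
      have : Continuous fun w : ℝ => w ^ 2 * Real.exp (2 * R) := by fun_prop
      simpa using this.tendsto 0
    obtain ⟨δ, hδ, h⟩ := Metric.eventually_nhds_iff_ball.1 (h1.eventually (eventually_lt_nhds hη))
    exact ⟨δ / 2, by positivity, fun w hw => h w (by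
      rw [mem_ball_zero_iff, Real.norm_eq_abs]; linarith)⟩
  have key : ∀ w : ℝ, ∃ y : ℝ → ℝ, |w| ≤ δ → y 0 = 0 ∧ ∀ t ∈ Icc 0 Real.pi, |y t| ≤ R ∧
      HasDerivWithinAt y (F.eval (w ^ 2 * Real.exp (2 * y t))) (Icc 0 Real.pi) t := by
    intro w
    by_cases hw : |w| ≤ δ
    swap
    · exact ⟨0, fun h => absurd h hw⟩
    have hcd : ContDiffOn ℝ 1 (fun y : ℝ => F.eval (w ^ 2 * Real.exp (2 * y)))
        (Metric.closedBall 0 (R.toNNReal : ℝ)) := by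
      have : ContDiff ℝ 1 fun s => F.eval s := by simpa using F.contDiff_aeval (𝕜 := ℝ) 1
      exact (this.comp (by fun_prop)).contDiffOn
    have hR' : (R.toNNReal : ℝ) = R := Real.coe_toNNReal _ hR0.le
    have hL' : (L.toNNReal : ℝ) = L := Real.coe_toNNReal _ hL0.le
    obtain ⟨y, h0, hy⟩ := exists_bounded_solution (L := L.toNNReal) (R := R.toNNReal) hπ.le hcd
      (fun y hy => by
        rw [hR'] at hy
        rw [hL']
        refine hF _ ?_
        rw [abs_of_nonneg (by positivity)]
        refine lt_of_le_of_lt (mul_le_mul_of_nonneg_left (Real.exp_le_exp.2 ?_) (sq_nonneg w))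
          (hδη w hw)
        linarith [(abs_le.1 hy).2]) (by rw [hR', hL'])
    rw [hR'] at hy
    exact ⟨y, fun _ => ⟨h0, hy⟩⟩
  choose y hy using key
  -- The equation involves only w²; choosing solutions by |w| makes the family even without a
  -- uniqueness argument.
  refine ⟨R, δ, hδ, fun w => y |w|, fun w hw => ⟨(hy _ (by rwa [abs_abs])).1, by simp,
    fun t ht => ?_⟩⟩
  have := (hy _ (by rwa [abs_abs] : |(|w|)| ≤ δ)).2 t ht
  rwa [sq_abs] at this

end LogRadius

/-! ### Spiral fields and their half turns. -/

/-- The change of coordinate `x ↦ x + b x ^ k` of the `x`-axis. -/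
def axisChange (b : ℝ) (k : ℕ) (x : ℝ) : ℝ := x + b * x ^ k

theorem hasStrictDerivAt_axisChange (b : ℝ) (k : ℕ) (x : ℝ) :
    HasStrictDerivAt (axisChange b k) (1 + b * (k * x ^ (k - 1))) x :=
  (hasStrictDerivAt_id x).add ((hasStrictDerivAt_pow k x).const_mul b)

theorem axisChange_zero (b : ℝ) {k : ℕ} (hk : 2 ≤ k) : axisChange b k 0 = 0 := by
  simp [axisChange, show k ≠ 0 by omega]

/-- The strict derivative at 0 compares return maps; the derivatives at nearby points carry
trajectories back through g. -/
theorem exists_axisChange_inverse (b : ℝ) {k : ℕ} (hk : 2 ≤ k) : ∃ g : ℝ → ℝ,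
    HasStrictDerivAt g 1 0 ∧ g 0 = 0 ∧ (∀ᶠ x in 𝓝 0, g (axisChange b k x) = x) ∧
    ∀ᶠ s in 𝓝 0, axisChange b k (g s) = s ∧ 1 + b * (k * g s ^ (k - 1)) ≠ 0 ∧
      HasDerivAt g (1 + b * (k * g s ^ (k - 1)))⁻¹ s := by
  have hk1 : k - 1 ≠ 0 := by omega
  have h1 : HasStrictDerivAt (axisChange b k) 1 0 := by
    simpa [hk1] using hasStrictDerivAt_axisChange b k 0
  have h0 := axisChange_zero b hk
  set e := (h1.hasStrictFDerivAt_equiv one_ne_zero).toOpenPartialHomeomorph with he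
  have hmem : (0 : ℝ) ∈ e.target := by
    have := (h1.hasStrictFDerivAt_equiv one_ne_zero).image_mem_toOpenPartialHomeomorph_target
    rwa [h0] at this
  have hleft := h1.eventually_left_inverse one_ne_zero
  have hright := h1.eventually_right_inverse one_ne_zero
  have hstrict := h1.to_localInverse one_ne_zero
  set g := h1.localInverse (axisChange b k) 1 0 one_ne_zero with hg
  rw [h0] at hright hstrict
  rw [inv_one] at hstrict
  have hg0 : g 0 = 0 := by
    have := hleft.self_of_nhds
    rwa [h0] at this
  have hcont : ∀ᶠ s in 𝓝 0, ContinuousAt g s := by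
    filter_upwards [e.open_target.mem_nhds hmem] with s hs using e.symm.continuousAt hs
  have hne : ∀ᶠ s in 𝓝 0, 1 + b * (k * g s ^ (k - 1)) ≠ 0 := by
    have h2 : ContinuousAt (fun s => 1 + b * (k * g s ^ (k - 1))) 0 := by
      have := hcont.self_of_nhds
      fun_prop
    exact h2.eventually_ne (by simp [hg0, hk1])
  refine ⟨g, hstrict, hg0, hleft, ?_⟩
  filter_upwards [hright.eventually_nhds, hcont, hne] with s hs hc hn
  exact ⟨hs.self_of_nhds, hn, HasDerivAt.of_local_left_inverse hc
    (hasStrictDerivAt_axisChange b k (g s)).hasDerivAt hn hs⟩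

open Polynomial in
/-- The pull-back of the rotationally symmetric field `θ' = 1`, `r' = r F(r²)` by the change of
coordinates `(x, y) ↦ (x + b x ^ k, y)`. -/
noncomputable def spiralField (F : ℝ[X]) (b : ℝ) (k : ℕ) (p : ℝ × ℝ) : ℝ × ℝ :=
  ((axisChange b k p.1 * F.eval (axisChange b k p.1 ^ 2 + p.2 ^ 2) - p.2) /
      (1 + b * (k * p.1 ^ (k - 1))),
    axisChange b k p.1 + p.2 * F.eval (axisChange b k p.1 ^ 2 + p.2 ^ 2))

section SpiralField

open Polynomial

variable (F : ℝ[X]) (b : ℝ) {k : ℕ}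

/-- For k ≥ 2 the coordinate change is tangent to the identity, so the linear part is F(0) plus a
quarter turn, with eigenvalues F(0) ± i. -/
theorem isNondegenerateMonodromic_spiralField (hk : 2 ≤ k) :
    IsNondegenerateMonodromic (spiralField F b k) := by
  have hk1 : k - 1 ≠ 0 := by omega
  have h0 := axisChange_zero b hk
  have han : AnalyticAt ℝ (spiralField F b k) 0 := by
    have h1 : AnalyticAt ℝ (fun p : ℝ × ℝ => axisChange b k p.1) 0 := by
      exact analyticAt_fst.add (analyticAt_const.mul (analyticAt_fst.pow k))
    have h2 : AnalyticAt ℝ (fun p : ℝ × ℝ => axisChange b k p.1 ^ 2 + p.2 ^ 2) 0 :=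
      (h1.pow 2).add (analyticAt_snd.pow 2)
    have h3 : AnalyticAt ℝ (fun p : ℝ × ℝ => F.eval (axisChange b k p.1 ^ 2 + p.2 ^ 2)) 0 := by
      simpa [Polynomial.aeval_def] using h2.aeval_polynomial F
    have h4 : AnalyticAt ℝ (fun p : ℝ × ℝ => 1 + b * (k * p.1 ^ (k - 1))) 0 :=
      analyticAt_const.add (analyticAt_const.mul (analyticAt_const.mul (analyticAt_fst.pow _)))
    exact (((h1.mul h3).sub analyticAt_snd).div h4 (by simp [hk1])).prod
      (h1.add (analyticAt_snd.mul h3))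
  refine ⟨han, by simp [spiralField, h0], ?_⟩
  have hfd : HasFDerivAt (spiralField F b k) (fderiv ℝ (spiralField F b k) 0) 0 :=
    han.differentiableAt.hasFDerivAt
  set L := fderiv ℝ (spiralField F b k) 0
  have hψ : HasDerivAt (axisChange b k) 1 0 := by
    simpa [hk1] using (hasStrictDerivAt_axisChange b k 0).hasDerivAt
  have hF : ∀ {f : ℝ → ℝ} {f' : ℝ}, HasDerivAt f f' 0 → f 0 = 0 →
      HasDerivAt (fun x => F.eval (f x ^ 2)) 0 0 := fun {f f'} hf hf0 => by
    refine ((F.hasDerivAt (f 0 ^ 2)).comp 0 (hf.pow 2)).congr_deriv ?_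
    simp [hf0]
  have hL1 : L (1, 0) = (F.eval 0, 1) := by
    have h2 : HasDerivAt (fun x : ℝ => ((x, 0) : ℝ × ℝ)) (1, 0) 0 :=
      (hasDerivAt_id 0).prodMk (hasDerivAt_const 0 0)
    have h3 : HasDerivAt (fun x : ℝ => spiralField F b k (x, 0)) (L (1, 0)) 0 :=
      HasFDerivAt.comp_hasDerivAt (x := (0 : ℝ)) (f := fun x : ℝ => ((x, 0) : ℝ × ℝ)) hfd h2
    have h4 : HasDerivAt (fun x : ℝ => 1 + b * (k * x ^ (k - 1)))
        (b * (k * ((k - 1 : ℕ) * 0 ^ (k - 1 - 1)))) 0 :=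
      (((hasDerivAt_pow (k - 1) (0 : ℝ)).const_mul _).const_mul _).const_add 1
    have h5 := (((hψ.mul (hF hψ h0)).div h4 (by simp [hk1])).prodMk hψ)
    refine h3.unique (h5.congr_deriv ?_ |>.congr_of_eventuallyEq (.of_forall fun x => ?_))
    · simp [h0, hk1]
    · simp [spiralField]
  have hL2 : L (0, 1) = (-1, F.eval 0) := by
    have h2 : HasDerivAt (fun y : ℝ => ((0, y) : ℝ × ℝ)) (0, 1) 0 :=
      (hasDerivAt_const 0 0).prodMk (hasDerivAt_id 0)
    have h3 : HasDerivAt (fun y : ℝ => spiralField F b k (0, y)) (L (0, 1)) 0 :=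
      HasFDerivAt.comp_hasDerivAt (x := (0 : ℝ)) (f := fun y : ℝ => ((0, y) : ℝ × ℝ)) hfd h2
    have h5 := (hasDerivAt_id (0 : ℝ)).neg.prodMk ((hasDerivAt_id (0 : ℝ)).mul
      (hF (hasDerivAt_id (0 : ℝ)) rfl))
    refine h3.unique (h5.congr_deriv ?_ |>.congr_of_eventuallyEq (.of_forall fun x => ?_))
    · simp
    · simp [spiralField, h0, hk1]
  intro z hz him
  rw [aeval_charpoly_prod, hL1, hL2] at hz
  have hre := congrArg Complex.re hz
  simp [pow_two, him] at hre
  nlinarith [sq_nonneg (z.re - F.eval 0)]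

theorem eventually_axisChange_pos (hk : 2 ≤ k) : ∀ᶠ x in 𝓝[≠] (0 : ℝ), 0 < x * axisChange b k x := by
  have hk1 : k - 1 ≠ 0 := by omega
  have h1 : Tendsto (fun x : ℝ => 1 + b * x ^ (k - 1)) (𝓝[≠] 0) (𝓝 1) := by
    have : Continuous fun x : ℝ => 1 + b * x ^ (k - 1) := by fun_prop
    simpa [hk1] using (this.tendsto 0).mono_left nhdsWithin_le_nhds
  filter_upwards [h1.eventually (eventually_gt_nhds one_pos), self_mem_nhdsWithin] with x hx hx0
  have hx0' : x ≠ 0 := hx0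
  have : x * axisChange b k x = x ^ 2 * (1 + b * x ^ (k - 1)) := by
    obtain ⟨j, rfl⟩ : ∃ j, k = j + 1 := ⟨k - 1, by omega⟩
    simp [axisChange]; ring
  rw [this]
  positivity

theorem sign_spiralField (hk : 2 ≤ k) : ∀ᶠ x in 𝓝[≠] (0 : ℝ),
    SignType.sign (spiralField F b k (x, 0)).2 = SignType.sign x := by
  filter_upwards [eventually_axisChange_pos b hk] with x hx
  have h1 : (spiralField F b k (x, 0)).2 = axisChange b k x := by simp [spiralField]
  rw [h1]
  rcases pos_and_pos_or_neg_and_neg_of_mul_pos hx with ⟨h, h'⟩ | ⟨h, h'⟩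
  · rw [sign_pos h, sign_pos h']
  · rw [sign_neg h, sign_neg h']

end SpiralField

/-- A trajectory of `V` runs in time `π` from `(x, 0)` to `(x', 0)` through the open upper (if
`0 < x`) or lower (if `x < 0`) half plane. -/
def HalfTurn (V : ℝ × ℝ → ℝ × ℝ) (x x' : ℝ) : Prop :=
  ∃ γ : ℝ → ℝ × ℝ, γ 0 = (x, 0) ∧ γ Real.pi = (x', 0) ∧
    IsIntegralCurveOn γ (fun _ => V) (Icc 0 Real.pi) ∧ ∀ t ∈ Ioo 0 Real.pi, 0 < x * (γ t).2

theorem HalfTurn.firstHit {V : ℝ × ℝ → ℝ × ℝ} {x x' : ℝ} (h : HalfTurn V x x') :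
    FirstHit V x x' := by
  obtain ⟨γ, h0, h1, hγ, hp⟩ := h
  exact ⟨Real.pi, γ, Real.pi_pos, h0, h1, hγ, fun t ht h => by simpa [h] using hp t ht⟩

theorem HalfTurn.isFirstReturn {V₁ V₂ : ℝ × ℝ → ℝ × ℝ} {x x₁ x' : ℝ} (hx : 0 < x) (hx₁ : x₁ < 0)
    (hx' : 0 < x') (h1 : HalfTurn V₁ x x₁) (h2 : HalfTurn V₂ x₁ x') :
    IsFirstReturn V₁ V₂ x x' := by
  obtain ⟨γ₁, a0, a1, ha, hp⟩ := h1
  obtain ⟨γ₂, b0, b1, hb, hn⟩ := h2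
  have hπ := Real.pi_pos
  set γ : ℝ → ℝ × ℝ := fun t => if t ≤ Real.pi then γ₁ t else γ₂ (t - Real.pi) with hγ
  have e1 : ∀ t ≤ Real.pi, γ t = γ₁ t := fun t ht => if_pos ht
  have e2 : ∀ t ≥ Real.pi, γ t = γ₂ (t - Real.pi) := fun t ht => by
    rcases ht.eq_or_lt with h | h
    · rw [← h, e1 _ le_rfl, sub_self, a1, b0]
    · exact if_neg h.not_ge
  have hup : ∀ t ∈ Ioo 0 Real.pi, 0 < (γ t).2 := fun t ht => by
    rw [e1 t ht.2.le]
    exact pos_of_mul_pos_right (hp t ht) hx.le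
  have hlow : ∀ t ∈ Ioo Real.pi (2 * Real.pi), (γ t).2 < 0 := fun t ht => by
    rw [e2 t ht.1.le]
    have := hn (t - Real.pi) ⟨by linarith [ht.1], by linarith [ht.2]⟩
    exact (neg_iff_neg_of_mul_pos this).1 hx₁
  refine ⟨hx, hx', Real.pi, 2 * Real.pi, γ, hπ, by linarith, ?_, ?_, ?_, ?_, ?_, hup, hlow, ?_⟩
  · have hc1 : ContinuousOn γ (Icc 0 Real.pi) :=
      ContinuousOn.congr (fun t ht => (ha t ht).continuousWithinAt) fun t ht => e1 t ht.2
    have hc2 : ContinuousOn γ (Icc Real.pi (2 * Real.pi)) := by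
      refine ContinuousOn.congr (f := fun t => γ₂ (t - Real.pi)) ?_ fun t ht => e2 t ht.1
      exact ContinuousOn.comp (t := Icc 0 Real.pi) (fun t ht => (hb t ht).continuousWithinAt)
        (by fun_prop) fun t ht => ⟨by linarith [ht.1], by linarith [ht.2]⟩
    have := hc1.union_of_isClosed hc2 isClosed_Icc isClosed_Icc
    rwa [Icc_union_Icc_eq_Icc hπ.le (by linarith)] at this
  · rw [e1 0 hπ.le, a0]
  · rw [e1 _ le_rfl, a1]; exact hx₁
  · rw [e1 _ le_rfl, a1]
  · rw [e2 _ (by linarith), show 2 * Real.pi - Real.pi = Real.pi by ring, b1]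
  · intro t ht hne
    rcases lt_or_gt_of_ne hne with h | h
    · have hpos := hup t ⟨ht.1, h⟩
      have h3 : gluing V₁ V₂ (γ t) = V₁ (γ₁ t) := by
        rw [← e1 t h.le]
        simp [gluing, indicator, hpos, hpos.not_gt]
      rw [h3]
      refine ((ha t ⟨ht.1.le, h.le⟩).hasDerivAt (Icc_mem_nhds ht.1 h)).congr_of_eventuallyEq ?_
      filter_upwards [eventually_lt_nhds h] with s hs using e1 s hs.le
    · have hneg := hlow t ⟨h, ht.2⟩
      have h3 : gluing V₁ V₂ (γ t) = V₂ (γ₂ (t - Real.pi)) := by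
        rw [← e2 t h.le]
        simp [gluing, indicator, hneg, hneg.not_gt]
      rw [h3]
      have h4 : 0 < t - Real.pi := by linarith [h]
      have h5 : t - Real.pi < Real.pi := by linarith [ht.2]
      refine (((hb _ ⟨h4.le, h5.le⟩).hasDerivAt (Icc_mem_nhds h4 h5)).comp_sub_const t
        Real.pi).congr_of_eventuallyEq ?_
      filter_upwards [eventually_gt_nhds h] with s hs using e2 s hs.le

open Polynomial in
/-- The half turns of a spiral field. -/
theorem halfTurn_spiralField {F : ℝ[X]} {b : ℝ} {k : ℕ} (hk : 2 ≤ k) {g : ℝ → ℝ}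
    (hgl : ∀ᶠ x in 𝓝 0, g (axisChange b k x) = x)
    (hgr : ∀ᶠ s in 𝓝 0, axisChange b k (g s) = s ∧ 1 + b * (k * g s ^ (k - 1)) ≠ 0 ∧
      HasDerivAt g (1 + b * (k * g s ^ (k - 1)))⁻¹ s) {R δ : ℝ} (hδ : 0 < δ) {Y : ℝ → ℝ → ℝ}
    (hY : IsLogRadius F R δ Y) :
    ∀ᶠ x in 𝓝[≠] (0 : ℝ), HalfTurn (spiralField F b k) x
      (g (-(axisChange b k x * Real.exp (Y (axisChange b k x) Real.pi)))) := by
  obtain ⟨η, hη, hball⟩ := Metric.eventually_nhds_iff_ball.1 hgr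
  have hψ : Tendsto (axisChange b k) (𝓝 0) (𝓝 0) := by
    have := (hasStrictDerivAt_axisChange b k 0).hasDerivAt.continuousAt.tendsto
    rwa [axisChange_zero b hk] at this
  have hπ := Real.pi_pos
  have hle : 𝓝[≠] (0 : ℝ) ≤ 𝓝 0 := nhdsWithin_le_nhds
  filter_upwards [eventually_axisChange_pos b hk, hle hgl, (hψ.mono_left hle).eventually
    (Metric.closedBall_mem_nhds 0 hδ), (hψ.mono_left hle).eventually
    (Metric.ball_mem_nhds 0 (show 0 < η * Real.exp (-R) by positivity))] with x hx hgx hxδ hxη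
  set w := axisChange b k x with hw
  have hwδ : |w| ≤ δ := by simpa using hxδ
  have hwη : |w| * Real.exp R < η := by
    have : |w| < η * Real.exp (-R) := by simpa using hxη
    rwa [Real.exp_neg, ← div_eq_mul_inv, lt_div_iff₀ (Real.exp_pos _)] at this
  obtain ⟨h0, -, hYt⟩ := hY w hwδ
  -- In the straightened coordinates the angle is t and the signed radius is w exp (Y w t).
  refine ⟨fun t => (g (w * Real.exp (Y w t) * Real.cos t), w * Real.exp (Y w t) * Real.sin t),
    by simp [h0, hgx], by simp, fun t ht => ?_, fun t ht => ?_⟩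
  · obtain ⟨hYR, hYd⟩ := hYt t ht
    set ξ := w * Real.exp (Y w t) * Real.cos t with hξ
    have hξη : ξ ∈ Metric.ball (0 : ℝ) η := by
      rw [mem_ball_zero_iff, Real.norm_eq_abs, hξ, abs_mul, abs_mul, Real.abs_exp]
      refine lt_of_le_of_lt ?_ hwη
      refine (mul_le_of_le_one_right (by positivity) (Real.abs_cos_le_one t)).trans ?_
      exact mul_le_mul_of_nonneg_left (Real.exp_le_exp.2 (abs_le.1 hYR).2) (abs_nonneg _)
    obtain ⟨h1, h2, h3⟩ := hball ξ hξη
    have hr := (hYd.exp.const_mul w)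
    have hξd := hr.mul (Real.hasDerivAt_cos t).hasDerivWithinAt
    have hηd := hr.mul (Real.hasDerivAt_sin t).hasDerivWithinAt
    have hgd := h3.comp_hasDerivWithinAt t hξd
    refine (hgd.prodMk hηd).congr_deriv ?_
    have h4 : ξ ^ 2 + (w * Real.exp (Y w t) * Real.sin t) ^ 2 =
        w ^ 2 * Real.exp (2 * Y w t) := by
      rw [show 2 * Y w t = Y w t + Y w t by ring, Real.exp_add, hξ]
      linear_combination (w ^ 2 * Real.exp (Y w t) ^ 2) * Real.sin_sq_add_cos_sq t
    simp only [spiralField, ← hξ, h1, h4]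
    ext
    · dsimp only
      rw [div_eq_inv_mul, hξ]
      ring
    · dsimp only
      rw [hξ]
      ring
  · have h1 := Real.sin_pos_of_pos_of_lt_pi ht.1 ht.2
    have : x * (w * Real.exp (Y w t) * Real.sin t) = x * w * Real.exp (Y w t) * Real.sin t := by
      ring
    dsimp only
    rw [this]
    positivity

/-! ### Asymptotics of the radial growth. -/

section Slope

variable {α : Type*} {l : Filter α} {f : ℝ → ℝ} {f' a L : ℝ} {y y' z : α → ℝ}

/-- Both points move, hence the strict derivative. It removes the outer inverse g from a difference
of return points. -/
theorem HasStrictDerivAt.tendsto_sub_div (hf : HasStrictDerivAt f f' a)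
    (hy : Tendsto y l (𝓝 a)) (hy' : Tendsto y' l (𝓝 a)) (hz : ∀ᶠ x in l, z x ≠ 0)
    (h : Tendsto (fun x => (y x - y' x) / z x) l (𝓝 L)) :
    Tendsto (fun x => (f (y x) - f (y' x)) / z x) l (𝓝 (f' * L)) := by
  have h1 : (fun x => f (y x) - f (y' x) - (y x - y' x) * f') =o[l] fun x => y x - y' x :=
    hf.isLittleO.comp_tendsto (hy.prodMk_nhds hy')
  have h2 : (fun x => y x - y' x) =O[l] z :=
    isBigO_of_div_tendsto_nhds (hz.mono fun x hx h => absurd h hx) L h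
  have h3 := (h1.trans_isBigO h2).tendsto_div_nhds_zero.add (h.const_mul f')
  rw [zero_add] at h3
  refine h3.congr' (hz.mono fun x hx => ?_)
  field_simp
  ring

theorem HasStrictDerivAt.tendsto_sub_const_div (hf : HasStrictDerivAt f f' a)
    (hy : Tendsto y l (𝓝 a)) (hz : ∀ᶠ x in l, z x ≠ 0)
    (h : Tendsto (fun x => (y x - a) / z x) l (𝓝 L)) :
    Tendsto (fun x => (f (y x) - f a) / z x) l (𝓝 (f' * L)) :=
  hf.tendsto_sub_div hy tendsto_const_nhds hz h

end Slope

open Polynomial in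
/-- `lam w` is, for small `w`, the logarithm of the factor by which the radius `w` grows during half
a turn along `dr/dt = r F(r²)`. -/
def IsLogGrowth (F : ℝ[X]) (lam : ℝ → ℝ) : Prop :=
  ∃ R, ∃ δ > 0, ∃ Y, IsLogRadius F R δ Y ∧ lam = fun w => Y w Real.pi

open Polynomial in
theorem exists_isLogGrowth (F : ℝ[X]) : ∃ lam, IsLogGrowth F lam := by
  obtain ⟨R, δ, hδ, Y, hY⟩ := exists_logRadius F
  exact ⟨_, R, δ, hδ, Y, hY, rfl⟩

namespace IsLogGrowth

open Polynomial

variable {F : ℝ[X]} {lam : ℝ → ℝ}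

theorem eventually_even (h : IsLogGrowth F lam) : ∀ᶠ w in 𝓝 0, lam (-w) = lam w := by
  obtain ⟨R, δ, hδ, Y, hY, rfl⟩ := h
  filter_upwards [Metric.closedBall_mem_nhds 0 hδ] with w hw
  rw [(hY w (by simpa using hw)).2.1]

theorem eventually_bounded (h : IsLogGrowth F lam) : ∃ R, ∀ᶠ w in 𝓝 0, |lam w| ≤ R := by
  obtain ⟨R, δ, hδ, Y, hY, rfl⟩ := h
  refine ⟨R, ?_⟩
  filter_upwards [Metric.closedBall_mem_nhds 0 hδ] with w hw
  exact ((hY w (by simpa using hw)).2.2 _ (right_mem_Icc.2 Real.pi_pos.le)).1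

theorem tendsto_radius (h : IsLogGrowth F lam) :
    Tendsto (fun w => w * Real.exp (lam w)) (𝓝 0) (𝓝 0) := by
  obtain ⟨R, hR⟩ := h.eventually_bounded
  have h1 : Tendsto (fun w : ℝ => |w| * Real.exp R) (𝓝 0) (𝓝 0) := by
    have : Continuous fun w : ℝ => |w| * Real.exp R := by fun_prop
    simpa using this.tendsto 0
  refine squeeze_zero_norm' ?_ h1
  filter_upwards [hR] with w hw
  rw [norm_mul, Real.norm_eq_abs, Real.norm_eq_abs, Real.abs_exp]
  exact mul_le_mul_of_nonneg_left (Real.exp_le_exp.2 (abs_le.1 hw).2) (abs_nonneg _)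

theorem tendsto_radius_ne (h : IsLogGrowth F lam) :
    Tendsto (fun w => w * Real.exp (lam w)) (𝓝[≠] 0) (𝓝[≠] 0) :=
  tendsto_nhdsWithin_iff.2 ⟨h.tendsto_radius.mono_left nhdsWithin_le_nhds, by
    filter_upwards [self_mem_nhdsWithin] with w hw
    exact mul_ne_zero hw (Real.exp_pos _).ne'⟩

theorem tendsto_radius_gt (h : IsLogGrowth F lam) :
    Tendsto (fun w => w * Real.exp (lam w)) (𝓝[>] 0) (𝓝[>] 0) :=
  tendsto_nhdsWithin_iff.2 ⟨h.tendsto_radius.mono_left nhdsWithin_le_nhds, by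
    filter_upwards [self_mem_nhdsWithin] with w hw
    exact mul_pos hw (Real.exp_pos _)⟩

theorem eventually_eq_const {a : ℝ} (h : IsLogGrowth (C a) lam) :
    ∀ᶠ w in 𝓝 0, lam w = a * Real.pi := by
  obtain ⟨R, δ, hδ, Y, hY, rfl⟩ := h
  filter_upwards [Metric.closedBall_mem_nhds 0 hδ] with w hw
  obtain ⟨h0, -, hd⟩ := hY w (by simpa using hw)
  have hc : ContinuousOn (Y w) (Icc 0 Real.pi) := fun t ht => (hd t ht).2.continuousWithinAt
  have := eq_of_hasDerivAt_zero (f := fun t => Y w t - a * t) (a := 0) (b := Real.pi)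
    (by fun_prop) (fun t ht => ?_) (right_mem_Icc.2 Real.pi_pos.le)
  · simp only [h0, mul_zero, sub_zero] at this
    linarith
  · have h1 := (hd t (Ioo_subset_Icc_self ht)).2.hasDerivAt (Icc_mem_nhds ht.1 ht.2)
    refine (h1.sub ((hasDerivAt_id t).const_mul a)).congr_deriv ?_
    simp

end IsLogGrowth

open Polynomial in
theorem IsLogRadius.abs_le {F : ℝ[X]} {R δ : ℝ} {Y : ℝ → ℝ → ℝ} (hY : IsLogRadius F R δ Y)
    (hF : X ∣ F) : ∃ K, 0 ≤ K ∧ ∀ w, |w| ≤ δ → |w| ≤ 1 → ∀ t ∈ Icc 0 Real.pi,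
      |Y w t| ≤ K * w ^ 2 := by
  obtain ⟨G, rfl⟩ := hF
  obtain ⟨K, hK⟩ := (isCompact_Icc (a := (0 : ℝ)) (b := Real.exp (2 * R))).exists_bound_of_continuousOn
    G.continuous.continuousOn
  have hK0 : 0 ≤ K := (norm_nonneg _).trans (hK 0 ⟨le_rfl, (Real.exp_pos _).le⟩)
  refine ⟨Real.exp (2 * R) * K * Real.pi, by have := Real.pi_pos; positivity,
    fun w hw hw1 t ht => ?_⟩
  obtain ⟨h0, -, hd⟩ := hY w hw
  have h1 := (convex_Icc 0 Real.pi).norm_image_sub_le_of_norm_hasDerivWithin_le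
    (C := w ^ 2 * (Real.exp (2 * R) * K)) (fun s hs => (hd s hs).2) (fun s hs => ?_)
    (left_mem_Icc.2 Real.pi_pos.le) ht
  · rw [h0, sub_zero, sub_zero, Real.norm_eq_abs, Real.norm_of_nonneg ht.1] at h1
    refine h1.trans ?_
    have := mul_le_mul_of_nonneg_left ht.2
      (show 0 ≤ w ^ 2 * (Real.exp (2 * R) * K) by positivity)
    linarith
  · have he : Real.exp (2 * Y w s) ≤ Real.exp (2 * R) := Real.exp_le_exp.2 (by
      linarith [(_root_.abs_le.1 (hd s hs).1).2])
    have hw2 : w ^ 2 ≤ 1 := by rw [← sq_abs]; exact pow_le_one₀ (abs_nonneg _) hw1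
    have h2 := hK (w ^ 2 * Real.exp (2 * Y w s)) ⟨by positivity, by
      have := mul_le_mul hw2 he (Real.exp_pos _).le zero_le_one
      linarith⟩
    rw [eval_mul, eval_X, norm_mul, Real.norm_of_nonneg (by positivity), mul_assoc]
    exact mul_le_mul_of_nonneg_left (mul_le_mul he h2 (norm_nonneg _) (Real.exp_pos _).le)
      (sq_nonneg w)

namespace IsLogGrowth

open Polynomial

theorem tendsto_zero {F : ℝ[X]} {lam : ℝ → ℝ} (h : IsLogGrowth F lam) (hF : X ∣ F) :
    Tendsto lam (𝓝 0) (𝓝 0) := by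
  obtain ⟨R, δ, hδ, Y, hY, rfl⟩ := h
  obtain ⟨K, -, hK⟩ := hY.abs_le hF
  have h1 : Tendsto (fun w : ℝ => K * w ^ 2) (𝓝 0) (𝓝 0) := by
    have : Continuous fun w : ℝ => K * w ^ 2 := by fun_prop
    simpa using this.tendsto 0
  refine squeeze_zero_norm' ?_ h1
  filter_upwards [Metric.closedBall_mem_nhds 0 hδ, Metric.closedBall_mem_nhds 0 one_pos] with w h2 h3
  exact hK w (by simpa using h2) (by simpa using h3) _ (right_mem_Icc.2 Real.pi_pos.le)

/-- Expansion of the growth factor for `F(s) = a s ^ m + c s ^ n`. -/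
theorem tendsto_exp {a c : ℝ} {m n : ℕ} (hm : 1 ≤ m) (hmn : m < n) {lam : ℝ → ℝ}
    (h : IsLogGrowth (C a * X ^ m + C c * X ^ n) lam) :
    Tendsto (fun w => (Real.exp (-(2 * m * lam w)) - 1 + 2 * m * a * Real.pi * w ^ (2 * m)) /
      w ^ (2 * n)) (𝓝[≠] 0) (𝓝 (-(2 * m * c * Real.pi))) := by
  obtain ⟨R, δ, hδ, Y, hY, rfl⟩ := h
  have hX : X ∣ C a * X ^ m + C c * X ^ n :=
    dvd_add ((dvd_pow_self X (by omega)).mul_left _) ((dvd_pow_self X (by omega)).mul_left _)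
  obtain ⟨K, hK0, hK⟩ := hY.abs_le hX
  obtain ⟨d, rfl⟩ : ∃ d, n = m + d := ⟨n - m, by omega⟩
  have hπ := Real.pi_pos
  set B : ℝ := 2 * m * |c| * (4 * d * K) * Real.pi with hB
  have hsmall : ∀ᶠ w : ℝ in 𝓝[≠] 0, 2 * d * (K * w ^ 2) ≤ 1 := by
    have h1 : Tendsto (fun w : ℝ => 2 * d * (K * w ^ 2)) (𝓝[≠] 0) (𝓝 0) := by
      have : Continuous fun w : ℝ => 2 * d * (K * w ^ 2) := by fun_prop
      simpa using (this.tendsto 0).mono_left nhdsWithin_le_nhds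
    exact (h1.eventually (eventually_lt_nhds one_pos)).mono fun _ h => h.le
  have hB0 : Tendsto (fun w : ℝ => B * w ^ 2) (𝓝[≠] 0) (𝓝 0) := by
    have : Continuous fun w : ℝ => B * w ^ 2 := by fun_prop
    simpa using (this.tendsto 0).mono_left nhdsWithin_le_nhds
  rw [tendsto_iff_norm_sub_tendsto_zero]
  refine squeeze_zero' (.of_forall fun _ => norm_nonneg _) ?_ hB0
  filter_upwards [hsmall, nhdsWithin_le_nhds (Metric.closedBall_mem_nhds 0 hδ),
    nhdsWithin_le_nhds (Metric.closedBall_mem_nhds 0 one_pos), self_mem_nhdsWithin]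
    with w hs h1 h2 hw0
  have hw0' : w ≠ 0 := hw0
  have h1' : |w| ≤ δ := by simpa using h1
  have h2' : |w| ≤ 1 := by simpa using h2
  obtain ⟨h0, -, hd⟩ := hY w h1'
  have hYK := hK w h1' h2'
  -- The variable r^(-2m) linearizes the leading term: its derivative is -2m(a + c r^(2(n-m))).
  -- Replacing r by w in the second term costs a factor O(w²).
  have key := (convex_Icc 0 Real.pi).norm_image_sub_le_of_norm_hasDerivWithin_le
    (f := fun t => Real.exp (-(2 * m * Y w t)) + 2 * m * a * w ^ (2 * m) * t +
      2 * m * c * w ^ (2 * (m + d)) * t)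
    (f' := fun t => 2 * m * c * w ^ (2 * (m + d)) * (1 - Real.exp (2 * d * Y w t)))
    (C := 2 * m * |c| * w ^ (2 * (m + d)) * (4 * d * K * w ^ 2))
    (fun t ht => ?_) (fun t ht => ?_) (left_mem_Icc.2 hπ.le) (right_mem_Icc.2 hπ.le)
  · have hpow : 0 < w ^ (2 * (m + d)) := by rw [pow_mul]; positivity
    simp only [h0, mul_zero, neg_zero, Real.exp_zero, add_zero, sub_zero] at key
    rw [Real.norm_of_nonneg hπ.le] at key
    have e1 : (Real.exp (-(2 * m * Y w Real.pi)) - 1 + 2 * m * a * Real.pi * w ^ (2 * m)) /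
        w ^ (2 * (m + d)) - -(2 * m * c * Real.pi) = (Real.exp (-(2 * m * Y w Real.pi)) +
        2 * m * a * w ^ (2 * m) * Real.pi + 2 * m * c * w ^ (2 * (m + d)) * Real.pi - 1) /
        w ^ (2 * (m + d)) := by
      field_simp
      ring
    rw [e1, norm_div, Real.norm_of_nonneg hpow.le, div_le_iff₀ hpow]
    refine key.trans_eq ?_
    rw [hB]
    ring
  · have h3 := (((hd t ht).2.const_mul (2 * (m : ℝ))).neg.exp.add
      ((hasDerivWithinAt_id t _).const_mul (2 * m * a * w ^ (2 * m)))).add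
      ((hasDerivWithinAt_id t _).const_mul (2 * m * c * w ^ (2 * (m + d))))
    refine h3.congr_deriv ?_
    have e2 : Real.exp (2 * d * Y w t) =
        Real.exp (-(2 * m * Y w t)) * Real.exp (2 * Y w t) ^ (m + d) := by
      rw [← Real.exp_nat_mul, ← Real.exp_add]
      push_cast
      ring_nf
    have e3 : Real.exp (-(2 * m * Y w t)) * Real.exp (2 * Y w t) ^ m = 1 := by
      rw [← Real.exp_nat_mul, ← Real.exp_add]
      ring_nf
      exact Real.exp_zero
    rw [e2]
    simp only [eval_add, eval_mul, eval_C, eval_pow, eval_X, mul_pow, ← pow_mul, Pi.neg_apply]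
    linear_combination (-(2 * m * a * w ^ (2 * m))) * e3
  · have h4 : |2 * d * Y w t| ≤ 2 * d * (K * w ^ 2) := by
      rw [abs_mul, abs_of_nonneg (by positivity)]
      exact mul_le_mul_of_nonneg_left (hYK t ht) (by positivity)
    have h5 := Real.abs_exp_sub_one_le (h4.trans hs)
    rw [norm_mul, Real.norm_eq_abs, Real.norm_eq_abs, abs_sub_comm (1 : ℝ), abs_mul, abs_mul,
      abs_of_nonneg (show (0 : ℝ) ≤ 2 * m by positivity),
      abs_of_nonneg (show 0 ≤ w ^ (2 * (m + d)) by rw [pow_mul]; positivity)]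
    refine mul_le_mul_of_nonneg_left (h5.trans ?_) ?_
    · linarith
    · have : 0 ≤ w ^ (2 * (m + d)) := by rw [pow_mul]; positivity
      positivity

/-- Leading term of the logarithmic growth for `F(s) = a s ^ m + c s ^ n`. -/
theorem tendsto_div_pow {a c : ℝ} {m n : ℕ} (hm : 1 ≤ m) (hmn : m < n) {lam : ℝ → ℝ}
    (h : IsLogGrowth (C a * X ^ m + C c * X ^ n) lam) :
    Tendsto (fun w => lam w / w ^ (2 * m)) (𝓝[≠] 0) (𝓝 (a * Real.pi)) := by
  have hm0 : (m : ℝ) ≠ 0 := by positivity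
  have hpow : Tendsto (fun w : ℝ => w ^ (2 * (n - m))) (𝓝[≠] 0) (𝓝 0) := by
    have : Continuous fun w : ℝ => w ^ (2 * (n - m)) := by fun_prop
    have h0 : 2 * (n - m) ≠ 0 := by omega
    simpa [h0] using (this.tendsto 0).mono_left nhdsWithin_le_nhds
  have h1 := ((h.tendsto_exp hm hmn).mul hpow).sub
    (tendsto_const_nhds (x := 2 * m * a * Real.pi))
  rw [mul_zero, zero_sub] at h1
  have h2 : Tendsto (fun w => (Real.exp (-(2 * m * lam w)) - 1) / w ^ (2 * m)) (𝓝[≠] 0)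
      (𝓝 (-(2 * m * a * Real.pi))) := by
    refine h1.congr' ?_
    filter_upwards [self_mem_nhdsWithin] with w hw
    have hw' : w ≠ 0 := hw
    have e : w ^ (2 * n) = w ^ (2 * (n - m)) * w ^ (2 * m) := by rw [← pow_add]; congr 1; omega
    rw [e]
    field_simp
    ring
  have h3 : Tendsto (fun w => Real.exp (-(2 * m * lam w))) (𝓝[≠] 0) (𝓝 1) := by
    have hX : X ∣ C a * X ^ m + C c * X ^ n :=
      dvd_add ((dvd_pow_self X (by omega)).mul_left _) ((dvd_pow_self X (by omega)).mul_left _)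
    have h0 := (((h.tendsto_zero hX).mono_left (nhdsWithin_le_nhds (s := {0}ᶜ))).const_mul
      (2 * (m : ℝ))).neg
    rw [mul_zero, neg_zero] at h0
    simpa using h0.rexp
  -- Taking the logarithm recovers the growth itself from its exponential.
  have h4 := (Real.hasStrictDerivAt_log one_ne_zero).tendsto_sub_const_div h3
    (by filter_upwards [self_mem_nhdsWithin] with w hw using pow_ne_zero (2 * m) hw) h2
  have h5 := h4.const_mul (-(1 / (2 * m : ℝ)))
  convert h5 using 2
  · rw [Real.log_exp, Real.log_one]
    field_simp
    ring
  · field_simp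

end IsLogGrowth

theorem isLittleO_pow_of_tendsto {l : Filter ℝ} (hl : ∀ᶠ x in l, x ≠ 0) {f : ℝ → ℝ} {n : ℕ} {α : ℝ}
    (h : Tendsto (fun x => f x / x ^ n) l (𝓝 α)) :
    (fun x => f x - α * x ^ n) =o[l] fun x => x ^ n := by
  refine isLittleO_of_tendsto' (hl.mono fun x hx h => absurd h (pow_ne_zero n hx)) ?_
  have h1 := h.sub_const α
  rw [sub_self] at h1
  refine h1.congr' (hl.mono fun x hx => ?_)
  field_simp

theorem tendsto_comp_div_pow {l : Filter ℝ} {G v : ℝ → ℝ} {p : ℕ} {L r : ℝ}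
    (hG : Tendsto (fun w => G w / w ^ p) (𝓝[≠] 0) (𝓝 L)) (hv : Tendsto v l (𝓝[≠] 0))
    (hr : Tendsto (fun x => v x / x) l (𝓝 r)) :
    Tendsto (fun x => G (v x) / x ^ p) l (𝓝 (L * r ^ p)) := by
  refine ((hG.comp hv).mul (hr.pow p)).congr' ?_
  filter_upwards [hv.eventually self_mem_nhdsWithin] with x hx
  have hx' : v x ≠ 0 := hx
  simp only [Function.comp_apply]
  rw [div_pow]
  field_simp

theorem tendsto_pow_nhds_zero {l : Filter ℝ} (hl : l ≤ 𝓝 0) {p : ℕ} (hp : p ≠ 0) :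
    Tendsto (fun x : ℝ => x ^ p) l (𝓝 0) := by
  simpa [hp] using ((continuous_pow (M := ℝ) p).tendsto 0).mono_left hl

theorem tendsto_axisChange (b : ℝ) {k : ℕ} (hk : 2 ≤ k) :
    Tendsto (axisChange b k) (𝓝[≠] 0) (𝓝[≠] 0) := by
  refine tendsto_nhdsWithin_iff.2 ⟨?_, (eventually_axisChange_pos b hk).mono fun x hx h => ?_⟩
  · have := (hasStrictDerivAt_axisChange b k 0).hasDerivAt.continuousAt.tendsto
    rw [axisChange_zero b hk] at this
    exact this.mono_left nhdsWithin_le_nhds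
  · rw [show axisChange b k x = 0 from h, mul_zero] at hx
    exact hx.false

theorem tendsto_axisChange_div (b : ℝ) {k : ℕ} (hk : 2 ≤ k) :
    Tendsto (fun x => axisChange b k x / x) (𝓝[≠] 0) (𝓝 1) := by
  have h1 := ((tendsto_pow_nhds_zero (l := 𝓝[≠] 0) nhdsWithin_le_nhds
    (show k - 1 ≠ 0 by omega)).const_mul b).const_add 1
  rw [mul_zero, add_zero] at h1
  refine h1.congr' ?_
  filter_upwards [self_mem_nhdsWithin] with x hx
  have hx' : x ≠ 0 := hx
  obtain ⟨j, rfl⟩ : ∃ j, k = j + 1 := ⟨k - 1, by omega⟩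
  simp only [axisChange, add_tsub_cancel_right]
  field_simp
  ring

/-! ### Orders of the spiral fields; pseudo foci with a focus of order zero. -/

section Spiral

open Polynomial

theorem IsLogGrowth.halfTurn {F : ℝ[X]} {lam : ℝ → ℝ} (h : IsLogGrowth F lam) {b : ℝ} {k : ℕ}
    (hk : 2 ≤ k) {g : ℝ → ℝ} (hgl : ∀ᶠ x in 𝓝 0, g (axisChange b k x) = x)
    (hgr : ∀ᶠ s in 𝓝 0, axisChange b k (g s) = s ∧ 1 + b * (k * g s ^ (k - 1)) ≠ 0 ∧
      HasDerivAt g (1 + b * (k * g s ^ (k - 1)))⁻¹ s) :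
    ∀ᶠ x in 𝓝[≠] (0 : ℝ), HalfTurn (spiralField F b k) x
      (g (-(axisChange b k x * Real.exp (lam (axisChange b k x))))) := by
  obtain ⟨R, δ, hδ, Y, hY, rfl⟩ := h
  exact halfTurn_spiralField hk hgl hgr hδ hY

/-- A full turn is conjugated by the coordinate change, which has slope 1, so the order and its
coefficient do not depend on b. -/
theorem hasFocusOfOrder_spiralField {F : ℝ[X]} {lam : ℝ → ℝ} (h : IsLogGrowth F lam) (b : ℝ)
    {k : ℕ} (hk : 2 ≤ k) {m : ℕ} {β : ℝ} (hβ : β ≠ 0)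
    (hlim : Tendsto (fun w => (Real.exp (lam w + lam (w * Real.exp (lam w))) - 1) / w ^ (2 * m))
      (𝓝[≠] 0) (𝓝 β)) : HasFocusOfOrder (spiralField F b k) m := by
  obtain ⟨g, hgd, hg0, hgl, hgr⟩ := exists_axisChange_inverse b hk
  refine ⟨isNondegenerateMonodromic_spiralField F b hk, _,
    (h.halfTurn hk hgl hgr).mono fun x hx => hx.firstHit, β, hβ, ?_⟩
  have hψ := tendsto_axisChange b hk
  have hψr := tendsto_axisChange_div b hk
  have hle : 𝓝[≠] (0 : ℝ) ≤ 𝓝 0 := nhdsWithin_le_nhds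
  have hne : ∀ᶠ x in 𝓝[≠] (0 : ℝ), x ≠ 0 := self_mem_nhdsWithin
  refine isLittleO_pow_of_tendsto hne ?_
  have h1 : Tendsto (fun x => (axisChange b k x * Real.exp (lam (axisChange b k x) +
      lam (axisChange b k x * Real.exp (lam (axisChange b k x)))) - axisChange b k x) /
      x ^ (2 * m + 1)) (𝓝[≠] 0) (𝓝 β) := by
    have := (tendsto_comp_div_pow hlim hψ hψr).mul hψr
    rw [one_pow, mul_one, mul_one] at this
    refine this.congr' (hne.mono fun x hx => ?_)
    field_simp
    ring
  have h2 : Tendsto (fun x => axisChange b k x * Real.exp (lam (axisChange b k x) +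
      lam (axisChange b k x * Real.exp (lam (axisChange b k x))))) (𝓝[≠] 0) (𝓝 0) := by
    refine ((h.tendsto_radius.comp h.tendsto_radius).comp (hψ.mono_right hle)).congr fun x => ?_
    simp only [Function.comp_apply]
    rw [Real.exp_add, mul_assoc]
  have h3 := hgd.tendsto_sub_div h2 (hψ.mono_right hle)
    (hne.mono fun x hx => pow_ne_zero (2 * m + 1) hx) h1
  rw [one_mul] at h3
  refine h3.congr' ?_
  have hρ := (h.tendsto_radius.comp (hψ.mono_right hle))
  have hρ' := hρ.neg
  rw [neg_zero] at hρ'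
  -- After half a turn the signed radius is negative; evenness of the growth brings back a positive
  -- argument.
  filter_upwards [hle hgl, hρ'.eventually hgr, hρ.eventually h.eventually_even] with x e1 e2 e3
  simp only [Function.comp_apply] at e2 e3
  rw [e1, e2.1, e3, neg_mul, neg_neg, Real.exp_add, mul_assoc]

/-- The composition of half turns of two spiral fields. -/
theorem hasFFPseudoFocusOfOrder_spiralField {F₁ F₂ : ℝ[X]} {lam₁ lam₂ : ℝ → ℝ}
    (h₁ : IsLogGrowth F₁ lam₁) (h₂ : IsLogGrowth F₂ lam₂) {b : ℝ} {k k₁ k₂ j : ℕ} (hk : 2 ≤ k)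
    (hf₁ : HasFocusOfOrder (spiralField F₁ 0 2) k₁)
    (hf₂ : HasFocusOfOrder (spiralField F₂ b k) k₂) {u v : ℝ → ℝ}
    (hu : ∀ x, u x = x * Real.exp (lam₁ x)) (hv : ∀ x, v x = -axisChange b k (-u x)) {α : ℝ}
    (hα : α ≠ 0)
    (hlim : Tendsto (fun x => (v x * Real.exp (lam₂ (v x)) - axisChange b k x) / x ^ j) (𝓝[>] 0)
      (𝓝 α)) :
    HasFFPseudoFocusOfOrder (spiralField F₁ 0 2) (spiralField F₂ b k) j := by
  -- The upper field has coefficient 0, so its coordinate change is the identity and the exponent 2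
  -- is immaterial.
  obtain ⟨g₁, hgd₁, hg0₁, hgl₁, hgr₁⟩ := exists_axisChange_inverse 0 le_rfl
  obtain ⟨g, hgd, hg0, hgl, hgr⟩ := exists_axisChange_inverse b hk
  have hid : ∀ x, axisChange 0 2 x = x := fun x => by simp [axisChange]
  have hle : 𝓝[>] (0 : ℝ) ≤ 𝓝 0 := nhdsWithin_le_nhds
  have hgt : 𝓝[>] (0 : ℝ) ≤ 𝓝[≠] 0 := nhdsWithin_mono _ fun x hx => (show 0 < x from hx).ne'
  have hpos : ∀ᶠ x in 𝓝[>] (0 : ℝ), 0 < x := self_mem_nhdsWithin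
  have hu0 : Tendsto u (𝓝[>] 0) (𝓝[>] 0) := h₁.tendsto_radius_gt.congr fun x => (hu x).symm
  have hnu : Tendsto (fun x => -u x) (𝓝[>] 0) (𝓝[≠] 0) := by
    refine tendsto_nhdsWithin_iff.2 ⟨by simpa using (hu0.mono_right hle).neg, ?_⟩
    filter_upwards [hu0.eventually hpos] with x hx using (neg_lt_zero.2 hx).ne
  have hψnu := (tendsto_axisChange b hk).comp hnu
  have hvpos : ∀ᶠ x in 𝓝[>] (0 : ℝ), 0 < v x := by
    filter_upwards [hnu.eventually (eventually_axisChange_pos b hk), hu0.eventually hpos]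
      with x hx hx'
    rw [hv]
    nlinarith
  have hv0 : Tendsto v (𝓝[>] 0) (𝓝[>] 0) := by
    refine tendsto_nhdsWithin_iff.2 ⟨?_, hvpos⟩
    have := (hψnu.mono_right nhdsWithin_le_nhds).neg
    rw [neg_zero] at this
    exact this.congr fun x => (hv x).symm
  have hQ0 := h₂.tendsto_radius_gt.comp hv0
  have hg0' : Tendsto g (𝓝 0) (𝓝 0) := by
    have := hgd.hasDerivAt.continuousAt.tendsto
    rwa [hg0] at this
  have hgpos : ∀ᶠ s in 𝓝[>] (0 : ℝ), 0 < g s := by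
    have hgne : Tendsto g (𝓝[>] 0) (𝓝[≠] 0) := by
      refine tendsto_nhdsWithin_iff.2 ⟨hg0'.mono_left hle, ?_⟩
      filter_upwards [hle hgr, hpos] with s hs hs0 h0
      have := hs.1
      rw [show g s = 0 from h0, axisChange_zero b hk] at this
      exact hs0.ne this
    filter_upwards [hgne.eventually (eventually_axisChange_pos b hk), hle hgr, hpos]
      with s h1 h2 h3
    rw [h2.1] at h1
    exact pos_of_mul_pos_left h1 h3.le
  refine ⟨⟨⟨_, hf₁⟩, ⟨_, hf₂⟩, ?_⟩, fun x => g (v x * Real.exp (lam₂ (v x))), ?_, α, hα, ?_⟩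
  · filter_upwards [sign_spiralField F₁ 0 le_rfl, sign_spiralField F₂ b hk] with x h1 h2
      using ⟨h1, h2⟩
  · have hnu0 : Tendsto (fun x => -u x) (𝓝[>] 0) (𝓝 0) := hnu.mono_right nhdsWithin_le_nhds
    filter_upwards [hpos, hu0.eventually hpos, hQ0.eventually hgpos,
      hgt (h₁.halfTurn le_rfl hgl₁ hgr₁), hnu.eventually (h₂.halfTurn hk hgl hgr),
      hnu0.eventually hgl₁, (hv0.mono_right hle).eventually h₂.eventually_even]
      with x hx hux hQx t1 t2 e1 e2
    rw [hid] at e1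
    rw [hid, ← hu, e1] at t1
    have e3 : axisChange b k (-u x) = -v x := by rw [hv, neg_neg]
    rw [e3, e2, neg_mul, neg_neg] at t2
    exact HalfTurn.isFirstReturn hx (neg_lt_zero.2 hux) hQx t1 t2
  · refine isLittleO_pow_of_tendsto (hpos.mono fun x hx => hx.ne') ?_
    have h3 := hgd.tendsto_sub_div (hQ0.mono_right hle)
      (((tendsto_axisChange b hk).mono_left hgt).mono_right nhdsWithin_le_nhds)
      (hpos.mono fun x hx => pow_ne_zero j hx.ne') hlim
    rw [one_mul] at h3
    refine h3.congr' ?_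
    filter_upwards [hle hgl] with x e1
    simp only [Function.comp_apply]
    rw [e1]

theorem hasFocusOfOrder_spiralField_const {a : ℝ} (ha : a ≠ 0) (b : ℝ) {k : ℕ} (hk : 2 ≤ k) :
    HasFocusOfOrder (spiralField (C a) b k) 0 := by
  obtain ⟨lam, h⟩ := exists_isLogGrowth (C a)
  have hle : 𝓝[≠] (0 : ℝ) ≤ 𝓝 0 := nhdsWithin_le_nhds
  refine hasFocusOfOrder_spiralField h b hk (β := Real.exp (2 * (a * Real.pi)) - 1) ?_
    (tendsto_const_nhds.congr' ?_)
  · rw [sub_ne_zero, Ne, Real.exp_eq_one_iff]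
    have := Real.pi_ne_zero
    positivity
  · filter_upwards [hle h.eventually_eq_const, hle (h.tendsto_radius.eventually
      h.eventually_eq_const)] with w h1 h2
    rw [h2, h1]
    simp only [mul_zero, pow_zero, div_one]
    ring_nf

theorem IsLogGrowth.tendsto_exp_one {F : ℝ[X]} {lam : ℝ → ℝ} (h : IsLogGrowth F lam) (hF : X ∣ F) :
    Tendsto (fun x => Real.exp (lam x)) (𝓝 0) (𝓝 1) := by
  simpa using (h.tendsto_zero hF).rexp

theorem X_dvd_pow_add {a c : ℝ} {m n : ℕ} (hm : 1 ≤ m) (hmn : m < n) :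
    X ∣ C a * X ^ m + C c * X ^ n :=
  dvd_add ((dvd_pow_self X (by omega)).mul_left _) ((dvd_pow_self X (by omega)).mul_left _)

/-- The two half turns contribute aπ w^(2m) each to the logarithm of the radius, hence a coefficient
2aπ. -/
theorem hasFocusOfOrder_spiralField_pow {a c : ℝ} (ha : a ≠ 0) {m n : ℕ} (hm : 1 ≤ m)
    (hmn : m < n) (b : ℝ) {k : ℕ} (hk : 2 ≤ k) :
    HasFocusOfOrder (spiralField (C a * X ^ m + C c * X ^ n) b k) m := by
  obtain ⟨lam, h⟩ := exists_isLogGrowth (C a * X ^ m + C c * X ^ n)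
  have hle : 𝓝[≠] (0 : ℝ) ≤ 𝓝 0 := nhdsWithin_le_nhds
  have hX := X_dvd_pow_add (a := a) (c := c) hm hmn
  have hne : ∀ᶠ x in 𝓝[≠] (0 : ℝ), x ≠ 0 := self_mem_nhdsWithin
  have h1 := h.tendsto_div_pow hm hmn
  have h2 : Tendsto (fun w => w * Real.exp (lam w) / w) (𝓝[≠] 0) (𝓝 1) :=
    ((h.tendsto_exp_one hX).mono_left hle).congr' (hne.mono fun x hx => by field_simp)
  have h3 := h1.add (tendsto_comp_div_pow h1 h.tendsto_radius_ne h2)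
  have h4 := ((h.tendsto_zero hX).mono_left hle).add
    (((h.tendsto_zero hX).comp h.tendsto_radius).mono_left hle)
  rw [add_zero] at h4
  have h5 := (Real.hasStrictDerivAt_exp 0).tendsto_sub_const_div h4
    (hne.mono fun x hx => pow_ne_zero (2 * m) hx) (L := a * Real.pi + a * Real.pi * 1 ^ (2 * m))
    (h3.congr fun x => by simp only [Function.comp_apply]; ring)
  refine hasFocusOfOrder_spiralField h b hk ?_ (h5.congr fun x => by simp)
  rw [Real.exp_zero, one_pow, one_mul, mul_one]
  have := Real.pi_ne_zero
  rw [← two_mul]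
  positivity

theorem pseudoFocus_const_one : HasFFPseudoFocusOfOrder (spiralField (C 1) 0 2)
    (spiralField (C 1) 0 2) 1 := by
  obtain ⟨lam, h⟩ := exists_isLogGrowth (C (1 : ℝ))
  have hf := hasFocusOfOrder_spiralField_const one_ne_zero 0 le_rfl
  have hπ := Real.pi_pos
  refine hasFFPseudoFocusOfOrder_spiralField h h le_rfl hf hf (fun _ => rfl) (fun _ => rfl)
    (α := Real.exp (2 * Real.pi) - 1) ?_ (tendsto_const_nhds.congr' ?_)
  · have : 1 < Real.exp (2 * Real.pi) := Real.one_lt_exp_iff.2 (by positivity)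
    linarith
  · have hle : 𝓝[>] (0 : ℝ) ≤ 𝓝 0 := nhdsWithin_le_nhds
    filter_upwards [hle h.eventually_eq_const, hle (h.tendsto_radius.eventually
      h.eventually_eq_const), self_mem_nhdsWithin] with x h1 h2 h3
    have h3' : x ≠ 0 := (show 0 < x from h3).ne'
    simp only [axisChange, zero_mul, add_zero, neg_neg]
    rw [h2, h1, two_mul, Real.exp_add]
    field_simp

/-- The growths e^π and e^(-π) cancel, but the term x^k is scaled by e^(π(k-1)) ≠ 1 in between. Its
two contributions therefore do not cancel, whatever the parity of k. -/
theorem pseudoFocus_const_of_two_le {k : ℕ} (hk : 2 ≤ k) :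
    HasFFPseudoFocusOfOrder (spiralField (C 1) 0 2) (spiralField (C (-1)) 1 k) k := by
  obtain ⟨lam₁, h₁⟩ := exists_isLogGrowth (C (1 : ℝ))
  obtain ⟨lam₂, h₂⟩ := exists_isLogGrowth (C (-1 : ℝ))
  have hπ := Real.pi_pos
  have hlt : 1 < Real.exp Real.pi ^ (k - 1) :=
    one_lt_pow₀ (Real.one_lt_exp_iff.2 hπ) (by omega)
  refine hasFFPseudoFocusOfOrder_spiralField h₁ h₂ hk
    (hasFocusOfOrder_spiralField_const one_ne_zero 0 le_rfl)
    (hasFocusOfOrder_spiralField_const (by norm_num) 1 hk) (fun _ => rfl) (fun _ => rfl)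
    (α := -(-1) ^ k * Real.exp Real.pi ^ (k - 1) - 1) ?_ (tendsto_const_nhds.congr' ?_)
  · rcases Nat.even_or_odd k with h | h
    · rw [h.neg_one_pow]; linarith
    · rw [h.neg_one_pow]; linarith
  · have hle : 𝓝[>] (0 : ℝ) ≤ 𝓝 0 := nhdsWithin_le_nhds
    have hv0 : Tendsto (fun x => -axisChange 1 k (-(x * Real.exp (lam₁ x)))) (𝓝[>] 0) (𝓝 0) := by
      have h0 := (hasStrictDerivAt_axisChange 1 k 0).hasDerivAt.continuousAt.tendsto
      rw [axisChange_zero 1 hk] at h0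
      have hu := h₁.tendsto_radius.neg
      rw [neg_zero] at hu
      simpa using (h0.comp hu).neg.mono_left hle
    filter_upwards [hle h₁.eventually_eq_const, hv0.eventually
      h₂.eventually_eq_const, self_mem_nhdsWithin] with x h1 h2 h3
    have h3' : x ≠ 0 := (show 0 < x from h3).ne'
    rw [h2, h1]
    obtain ⟨j, rfl⟩ : ∃ j, k = j + 1 := ⟨k - 1, by omega⟩
    simp only [axisChange, one_mul, neg_mul, Real.exp_neg, add_tsub_cancel_right]
    rw [neg_pow (x * Real.exp Real.pi)]
    have := Real.exp_pos Real.pi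
    field_simp
    ring

theorem pseudoFocus_pow_const {m : ℕ} (hm : 1 ≤ m) :
    HasFFPseudoFocusOfOrder (spiralField (C 1 * X ^ m + C 0 * X ^ (m + 1)) 0 2)
      (spiralField (C 1) 0 2) 1 := by
  obtain ⟨lam₁, h₁⟩ := exists_isLogGrowth (C 1 * X ^ m + C 0 * X ^ (m + 1) : ℝ[X])
  obtain ⟨lam₂, h₂⟩ := exists_isLogGrowth (C (1 : ℝ))
  have hle : 𝓝[>] (0 : ℝ) ≤ 𝓝 0 := nhdsWithin_le_nhds
  have h1 := (((h₁.tendsto_exp_one (X_dvd_pow_add hm (Nat.lt_succ_self m))).mono_left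
    hle).mul_const (Real.exp Real.pi)).sub_const 1
  refine hasFFPseudoFocusOfOrder_spiralField h₁ h₂ le_rfl
    (hasFocusOfOrder_spiralField_pow one_ne_zero hm (Nat.lt_succ_self m) 0 le_rfl)
    (hasFocusOfOrder_spiralField_const one_ne_zero 0 le_rfl) (fun _ => rfl) (fun _ => rfl)
    ?_ (h1.congr' ?_)
  · have : 1 < Real.exp Real.pi := Real.one_lt_exp_iff.2 Real.pi_pos
    linarith
  · filter_upwards [hle (h₁.tendsto_radius.eventually h₂.eventually_eq_const),
      self_mem_nhdsWithin] with x h2 h3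
    have h3' : x ≠ 0 := (show 0 < x from h3).ne'
    simp only [axisChange, zero_mul, add_zero, neg_neg]
    rw [h2, one_mul]
    field_simp

end Spiral

/-! ### Pseudo foci with both foci of positive order. -/

section SpiralPow

open Polynomial

/-- Half turns `x ↦ u x` of a spiral field in the upper half plane, followed by a change of
coordinates. -/
theorem IsLogGrowth.tendsto_half_turn {F : ℝ[X]} {lam : ℝ → ℝ} (h : IsLogGrowth F lam) (hF : X ∣ F)
    (b : ℝ) {k : ℕ} (hk : 2 ≤ k) {u v : ℝ → ℝ} (hu : ∀ x, u x = x * Real.exp (lam x))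
    (hv : ∀ x, v x = -axisChange b k (-u x)) :
    Tendsto u (𝓝[>] 0) (𝓝[>] 0) ∧ Tendsto (fun x => u x / x) (𝓝[>] 0) (𝓝 1) ∧
      Tendsto v (𝓝[>] 0) (𝓝[>] 0) ∧ Tendsto (fun x => v x / x) (𝓝[>] 0) (𝓝 1) := by
  have hle : 𝓝[>] (0 : ℝ) ≤ 𝓝 0 := nhdsWithin_le_nhds
  have hpos : ∀ᶠ x in 𝓝[>] (0 : ℝ), 0 < x := self_mem_nhdsWithin
  have hu0 : Tendsto u (𝓝[>] 0) (𝓝[>] 0) := h.tendsto_radius_gt.congr fun x => (hu x).symm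
  have hux : Tendsto (fun x => u x / x) (𝓝[>] 0) (𝓝 1) :=
    ((h.tendsto_exp_one hF).mono_left hle).congr' (hpos.mono fun x hx => by
      simp only [hu]; field_simp)
  have hnu : Tendsto (fun x => -u x) (𝓝[>] 0) (𝓝[≠] 0) := by
    refine tendsto_nhdsWithin_iff.2 ⟨by simpa using (hu0.mono_right hle).neg, ?_⟩
    filter_upwards [hu0.eventually hpos] with x hx using (neg_lt_zero.2 hx).ne
  refine ⟨hu0, hux, tendsto_nhdsWithin_iff.2 ⟨?_, ?_⟩, ?_⟩
  · have := (((tendsto_axisChange b hk).comp hnu).mono_right nhdsWithin_le_nhds).neg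
    rw [neg_zero] at this
    exact this.congr fun x => (hv x).symm
  · filter_upwards [hnu.eventually (eventually_axisChange_pos b hk), hu0.eventually hpos]
      with x hx hx'
    show 0 < v x
    rw [hv]
    nlinarith
  · have := ((tendsto_axisChange_div b hk).comp hnu).mul hux
    rw [one_mul] at this
    refine this.congr' ?_
    filter_upwards [hu0.eventually hpos] with x hx
    simp only [Function.comp_apply]
    rw [hv]
    field_simp

/-- Both fields expand, so their growths add without cancellation and the lower order decides. The
zero terms only fit the two-term form of F. -/
theorem pseudoFocus_pow_pow {m₁ m₂ : ℕ} (hm₂ : 1 ≤ m₂) (hm : m₂ ≤ m₁) :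
    HasFFPseudoFocusOfOrder (spiralField (C 1 * X ^ m₁ + C 0 * X ^ (m₁ + 1)) 0 2)
      (spiralField (C 1 * X ^ m₂ + C 0 * X ^ (m₂ + 1)) 0 2) (2 * m₂ + 1) := by
  obtain ⟨lam₁, h₁⟩ := exists_isLogGrowth (C 1 * X ^ m₁ + C 0 * X ^ (m₁ + 1) : ℝ[X])
  obtain ⟨lam₂, h₂⟩ := exists_isLogGrowth (C 1 * X ^ m₂ + C 0 * X ^ (m₂ + 1) : ℝ[X])
  have hle : 𝓝[>] (0 : ℝ) ≤ 𝓝 0 := nhdsWithin_le_nhds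
  have hgt : 𝓝[>] (0 : ℝ) ≤ 𝓝[≠] 0 := nhdsWithin_mono _ fun x hx => (show 0 < x from hx).ne'
  have hne : ∀ᶠ x in 𝓝[>] (0 : ℝ), x ≠ 0 := hgt self_mem_nhdsWithin
  have hX₁ := X_dvd_pow_add (a := 1) (c := 0) (hm₂.trans hm) (Nat.lt_succ_self m₁)
  have hX₂ := X_dvd_pow_add (a := 1) (c := 0) hm₂ (Nat.lt_succ_self m₂)
  -- The limit is π for equal exponents and 0 otherwise; only its sign matters.
  obtain ⟨L, hL0, hL⟩ : ∃ L, 0 ≤ L ∧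
      Tendsto (fun x => lam₁ x / x ^ (2 * m₂)) (𝓝[>] 0) (𝓝 L) := by
    have h1 := (h₁.tendsto_div_pow (hm₂.trans hm) (Nat.lt_succ_self m₁)).mono_left hgt
    rcases hm.eq_or_lt with rfl | hlt
    · exact ⟨_, by have := Real.pi_pos; positivity, h1⟩
    · have h2 := h1.mul (tendsto_pow_nhds_zero hle (show 2 * (m₁ - m₂) ≠ 0 by omega))
      rw [mul_zero] at h2
      refine ⟨0, le_rfl, h2.congr' (hne.mono fun x hx => ?_)⟩
      have : x ^ (2 * m₁) = x ^ (2 * (m₁ - m₂)) * x ^ (2 * m₂) := by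
        rw [← pow_add]; congr 1; omega
      rw [this]
      field_simp
  obtain ⟨hu0, hux, -, -⟩ := h₁.tendsto_half_turn hX₁ 0 le_rfl (fun _ => rfl) (fun _ => rfl)
  have h3 := tendsto_comp_div_pow (h₂.tendsto_div_pow hm₂ (Nat.lt_succ_self m₂))
    (hu0.mono_right hgt) hux
  have h4 := ((h₁.tendsto_zero hX₁).mono_left hle).add
    ((h₂.tendsto_zero hX₂).comp (hu0.mono_right hle))
  rw [add_zero] at h4
  have h5 := (Real.hasStrictDerivAt_exp 0).tendsto_sub_const_div h4
    (hne.mono fun x hx => pow_ne_zero (2 * m₂) hx)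
    ((hL.add h3).congr fun x => by simp only [Function.comp_apply]; ring)
  refine hasFFPseudoFocusOfOrder_spiralField h₁ h₂ le_rfl
    (hasFocusOfOrder_spiralField_pow one_ne_zero (hm₂.trans hm) (Nat.lt_succ_self m₁) 0 le_rfl)
    (hasFocusOfOrder_spiralField_pow one_ne_zero hm₂ (Nat.lt_succ_self m₂) 0 le_rfl)
    (fun _ => rfl) (fun _ => rfl) ?_ (h5.congr' (hne.mono fun x hx => ?_))
  · rw [Real.exp_zero]
    have := Real.pi_pos
    positivity
  · simp only [axisChange, zero_mul, add_zero, neg_neg, Function.comp_apply]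
    rw [Real.exp_zero, Real.exp_add, pow_succ]
    field_simp

/-- Radial growth enters only at order 2m₂ + 1 > k. Below it the reflected coordinate change, u -
u^k for even k, differs from x + x^k by -2x^k. -/
theorem pseudoFocus_pow_pow_even {m₁ m₂ k : ℕ} (hm₂ : 1 ≤ m₂) (hm : m₂ < m₁) (hk : 2 ≤ k)
    (hke : Even k) (hkm : k < 2 * m₂ + 1) :
    HasFFPseudoFocusOfOrder (spiralField (C 1 * X ^ m₁ + C 0 * X ^ (m₁ + 1)) 0 2)
      (spiralField (C 1 * X ^ m₂ + C 0 * X ^ (m₂ + 1)) 1 k) k := by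
  obtain ⟨lam₁, h₁⟩ := exists_isLogGrowth (C 1 * X ^ m₁ + C 0 * X ^ (m₁ + 1) : ℝ[X])
  obtain ⟨lam₂, h₂⟩ := exists_isLogGrowth (C 1 * X ^ m₂ + C 0 * X ^ (m₂ + 1) : ℝ[X])
  have hle : 𝓝[>] (0 : ℝ) ≤ 𝓝 0 := nhdsWithin_le_nhds
  have hgt : 𝓝[>] (0 : ℝ) ≤ 𝓝[≠] 0 := nhdsWithin_mono _ fun x hx => (show 0 < x from hx).ne'
  have hne : ∀ᶠ x in 𝓝[>] (0 : ℝ), x ≠ 0 := hgt self_mem_nhdsWithin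
  have hm₁ : 1 ≤ m₁ := by omega
  have hX₁ := X_dvd_pow_add (a := 1) (c := 0) hm₁ (Nat.lt_succ_self m₁)
  have hX₂ := X_dvd_pow_add (a := 1) (c := 0) hm₂ (Nat.lt_succ_self m₂)
  obtain ⟨hu0, hux, hv0, hvx⟩ := h₁.tendsto_half_turn hX₁ 1 hk (fun _ => rfl) (fun _ => rfl)
  have key : ∀ {f : ℝ → ℝ} {m : ℕ} {L : ℝ}, k ≤ 2 * m → Tendsto f (𝓝[>] 0) (𝓝 0) →
      Tendsto (fun x => f x / x ^ (2 * m)) (𝓝[>] 0) (𝓝 L) →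
      Tendsto (fun x => (Real.exp (f x) - 1) / x ^ (k - 1)) (𝓝[>] 0) (𝓝 0) := by
    intro f m L hkm h0 h
    have h1 := h.mul (tendsto_pow_nhds_zero hle (show 2 * m - (k - 1) ≠ 0 by omega))
    rw [mul_zero] at h1
    have h2 := (Real.hasStrictDerivAt_exp 0).tendsto_sub_const_div h0
      (hne.mono fun x hx => pow_ne_zero (k - 1) hx) (L := 0)
      (h1.congr' (hne.mono fun x hx => by
        have : x ^ (2 * m) = x ^ (2 * m - (k - 1)) * x ^ (k - 1) := by
          rw [← pow_add]; congr 1; omega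
        simp only [this, sub_zero]
        field_simp))
    rw [mul_zero, Real.exp_zero] at h2
    exact h2
  have e1 := key (m := m₁) (by omega) ((h₁.tendsto_zero hX₁).mono_left hle)
    ((h₁.tendsto_div_pow hm₁ (Nat.lt_succ_self m₁)).mono_left hgt)
  have e2 := key (m := m₂) (f := fun x => lam₂ (-axisChange 1 k (-(x * Real.exp (lam₁ x)))))
    (by omega) ((h₂.tendsto_zero hX₂).comp (hv0.mono_right hle))
    (tendsto_comp_div_pow (h₂.tendsto_div_pow hm₂ (Nat.lt_succ_self m₂)) (hv0.mono_right hgt) hvx)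
  have h3 := (((hvx.mul e2).add e1).sub (hux.pow k)).sub_const 1
  refine hasFFPseudoFocusOfOrder_spiralField h₁ h₂ hk
    (hasFocusOfOrder_spiralField_pow one_ne_zero hm₁ (Nat.lt_succ_self m₁) 0 le_rfl)
    (hasFocusOfOrder_spiralField_pow one_ne_zero hm₂ (Nat.lt_succ_self m₂) 1 hk)
    (fun _ => rfl) (fun _ => rfl) ?_ (h3.congr' (hne.mono fun x hx => ?_))
  · norm_num
  · beta_reduce
    set l₂ := lam₂ (-axisChange 1 k (-(x * Real.exp (lam₁ x))))
    obtain ⟨j, rfl⟩ : ∃ j, k = j + 1 := ⟨k - 1, by omega⟩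
    simp only [axisChange, one_mul, hke.neg_pow, add_tsub_cancel_right, div_pow, pow_succ x j]
    field_simp
    ring

/-- Composition of half turns of fields whose leading terms cancel. -/
theorem pseudoFocus_of_cancel {m n k : ℕ} {b c κ ν : ℝ} (hm : 1 ≤ m) (hmn : m < n) (hk : 2 ≤ k)
    (hkn : k - 1 ≤ 2 * n) (hκ : κ = 2 * m * (b * (-1) ^ k))
    (hν : Tendsto (fun x : ℝ => x ^ (2 * n - (k - 1))) (𝓝[>] 0) (𝓝 ν))
    (hα : -((κ - 2 * m * c * Real.pi * ν) / (2 * m)) - b ≠ 0) :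
    HasFFPseudoFocusOfOrder (spiralField (C 1 * X ^ m + C 0 * X ^ n) 0 2)
      (spiralField (C (-1) * X ^ m + C c * X ^ n) b k) k := by
  obtain ⟨lam₁, h₁⟩ := exists_isLogGrowth (C 1 * X ^ m + C 0 * X ^ n : ℝ[X])
  obtain ⟨lam₂, h₂⟩ := exists_isLogGrowth (C (-1) * X ^ m + C c * X ^ n : ℝ[X])
  have hle : 𝓝[>] (0 : ℝ) ≤ 𝓝 0 := nhdsWithin_le_nhds
  have hgt : 𝓝[>] (0 : ℝ) ≤ 𝓝[≠] 0 := nhdsWithin_mono _ fun x hx => (show 0 < x from hx).ne'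
  have hpos : ∀ᶠ x in 𝓝[>] (0 : ℝ), 0 < x := self_mem_nhdsWithin
  have hm0 : (m : ℝ) ≠ 0 := by positivity
  have hX₁ := X_dvd_pow_add (a := 1) (c := 0) hm hmn
  obtain ⟨u, hu⟩ : ∃ u : ℝ → ℝ, ∀ x, u x = x * Real.exp (lam₁ x) := ⟨_, fun _ => rfl⟩
  obtain ⟨v, hv⟩ : ∃ v : ℝ → ℝ, ∀ x, v x = -axisChange b k (-u x) := ⟨_, fun _ => rfl⟩
  obtain ⟨hu0, hux, hv0, hvx⟩ := h₁.tendsto_half_turn hX₁ b hk hu hv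
  have hvpos := hv0.eventually hpos
  have hupos := hu0.eventually hpos
  -- The product A B q is the power -2m of v e^λ₂(v) / x. In this power the leading growth of either
  -- field is an explicit monomial.
  set A : ℝ → ℝ := fun x => Real.exp (-(2 * m * lam₁ x)) with hA
  set B : ℝ → ℝ := fun x => Real.exp (-(2 * m * lam₂ (v x))) with hB
  set q : ℝ → ℝ := fun x => ((v x / u x) ^ (2 * m))⁻¹ with hq
  have hA1 : Tendsto A (𝓝[>] 0) (𝓝 1) := by
    have h0 := (((h₁.tendsto_zero hX₁).mono_left hle).const_mul (2 * (m : ℝ))).neg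
    rw [mul_zero, neg_zero] at h0
    simpa using h0.rexp
  have hy1 : Tendsto (fun x => v x / u x) (𝓝[>] 0) (𝓝 1) := by
    have := hvx.div hux one_ne_zero
    rw [div_one] at this
    refine this.congr' (hpos.mono fun x hx => ?_)
    simp only [Pi.div_apply]
    field_simp
  have hq1 : Tendsto q (𝓝[>] 0) (𝓝 1) := by
    have := (hy1.pow (2 * m)).inv₀ (by simp)
    simpa using this
  have hqκ : Tendsto (fun x => (q x - 1) / x ^ (k - 1)) (𝓝[>] 0) (𝓝 κ) := by
    have hd : HasStrictDerivAt (fun y : ℝ => (y ^ (2 * m))⁻¹) (-(2 * m)) 1 := by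
      have := (hasStrictDerivAt_inv (one_ne_zero (α := ℝ))).comp_of_eq 1
        (hasStrictDerivAt_pow (2 * m) (1 : ℝ)) (by simp)
      refine this.congr_deriv ?_
      simp
    have h1 : Tendsto (fun x => (v x / u x - 1) / x ^ (k - 1)) (𝓝[>] 0)
        (𝓝 (-(b * (-1) ^ k) * 1 ^ (k - 1))) := by
      refine ((hux.pow (k - 1)).const_mul (-(b * (-1) ^ k))).congr' ?_
      filter_upwards [hpos, hupos] with x hx hux
      rw [hv, axisChange, neg_pow (u x)]
      obtain ⟨j, rfl⟩ : ∃ j, k = j + 1 := ⟨k - 1, by omega⟩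
      simp only [add_tsub_cancel_right, pow_succ (u x) j, div_pow]
      field_simp
      ring
    have h2 := hd.tendsto_sub_const_div hy1
      (hpos.mono fun x hx => pow_ne_zero (k - 1) hx.ne') h1
    convert h2 using 2
    · simp [hq]
    · rw [hκ]; simp
  have hr1 : Tendsto (fun x => (A x - 1 + 2 * m * 1 * Real.pi * x ^ (2 * m)) / x ^ (2 * n))
      (𝓝[>] 0) (𝓝 (-(2 * m * 0 * Real.pi))) := (h₁.tendsto_exp hm hmn).mono_left hgt
  have hr2 : Tendsto (fun x => (B x - 1 + 2 * m * (-1) * Real.pi * v x ^ (2 * m)) / x ^ (2 * n))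
      (𝓝[>] 0) (𝓝 (-(2 * m * c * Real.pi) * 1 ^ (2 * n))) :=
    tendsto_comp_div_pow (h₂.tendsto_exp hm hmn) (hv0.mono_right hgt) hvx
  have hpow : Tendsto (fun x : ℝ => 1 - 2 * m * Real.pi * x ^ (2 * m)) (𝓝[>] 0) (𝓝 1) := by
    have := ((tendsto_pow_nhds_zero hle (show 2 * m ≠ 0 by omega)).const_mul
      (2 * m * Real.pi)).const_sub 1
    rwa [mul_zero, sub_zero] at this
  -- With r₁, r₂ the remainders of A, B, this is ABq - 1 = (q - 1)(1 - 2mπx^(2m)) + q r₁ + A q r₂.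
  -- The leading terms cancel exactly because A q v^(2m) = x^(2m).
  have hS := ((hqκ.mul hpow).add ((hq1.mul hr1).mul hν)).add (((hA1.mul hq1).mul hr2).mul hν)
  have hS' : Tendsto (fun x => (A x * B x * q x - 1) / x ^ (k - 1)) (𝓝[>] 0)
      (𝓝 (κ - 2 * m * c * Real.pi * ν)) := by
    have e : κ * 1 + 1 * -(2 * m * 0 * Real.pi) * ν +
        1 * 1 * (-(2 * m * c * Real.pi) * 1 ^ (2 * n)) * ν = κ - 2 * m * c * Real.pi * ν := by
      rw [one_pow]; ring
    rw [e] at hS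
    refine hS.congr' ?_
    filter_upwards [hpos, hupos, hvpos] with x hx hux hvx
    have e1 : A x * u x ^ (2 * m) = x ^ (2 * m) := by
      rw [hu, mul_pow, ← Real.exp_nat_mul, mul_left_comm, ← Real.exp_add]
      push_cast
      simp
    have e2 : q x * v x ^ (2 * m) = u x ^ (2 * m) := by
      simp only [hq, div_pow, inv_div]
      field_simp
    have e3 : x ^ (2 * n) = x ^ (2 * n - (k - 1)) * x ^ (k - 1) := by
      rw [← pow_add]; congr 1; omega
    have e4 : A x * q x * v x ^ (2 * m) = x ^ (2 * m) := by rw [mul_assoc, e2, e1]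
    rw [e3]
    field_simp
    linear_combination (2 * m * Real.pi) * (-1 : ℝ) * e4
  have hS1 : Tendsto (fun x => A x * B x * q x) (𝓝[>] 0) (𝓝 1) := by
    have h1 := (hS'.mul (tendsto_pow_nhds_zero hle (show k - 1 ≠ 0 by omega))).add_const 1
    rw [mul_zero, zero_add] at h1
    refine h1.congr' (hpos.mono fun x hx => ?_)
    field_simp
    ring
  -- The power -1 / (2m) undoes the power -2m.
  have hΦ : HasStrictDerivAt (fun y : ℝ => Real.exp (-(Real.log y / (2 * m)))) (-(1 / (2 * m))) 1 := by
    have := (((Real.hasStrictDerivAt_log one_ne_zero).div_const (2 * (m : ℝ))).neg).exp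
    refine this.congr_deriv ?_
    simp
  have hfin := (hΦ.tendsto_sub_const_div hS1
    (hpos.mono fun x hx => pow_ne_zero (k - 1) hx.ne') hS').sub_const b
  refine hasFFPseudoFocusOfOrder_spiralField h₁ h₂ hk
    (hasFocusOfOrder_spiralField_pow one_ne_zero hm hmn 0 le_rfl)
    (hasFocusOfOrder_spiralField_pow (by norm_num) hm hmn b hk)
    hu hv hα ?_
  rw [show -(1 / (2 * (m : ℝ))) * (κ - 2 * m * c * Real.pi * ν) - b =
    -((κ - 2 * m * c * Real.pi * ν) / (2 * m)) - b by ring] at hfin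
  refine hfin.congr' ?_
  filter_upwards [hpos, hupos, hvpos] with x hx hux hvx
  have e1 : Real.log (A x * B x * q x) =
      -(2 * m) * (Real.log (v x) + lam₂ (v x) - Real.log x) := by
    have e2 : Real.log (u x) = Real.log x + lam₁ x := by
      rw [hu, Real.log_mul hx.ne' (Real.exp_pos _).ne', Real.log_exp]
    simp only [hA, hB, hq]
    rw [Real.log_mul (by positivity) (by positivity), Real.log_mul (by positivity) (by positivity),
      Real.log_exp, Real.log_exp, Real.log_inv, Real.log_pow, Real.log_div hvx.ne' hux.ne', e2]
    push_cast
    ring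
  have e3 : Real.exp (-(Real.log (A x * B x * q x) / (2 * m))) =
      v x * Real.exp (lam₂ (v x)) / x := by
    rw [e1]
    have : -(-(2 * (m : ℝ)) * (Real.log (v x) + lam₂ (v x) - Real.log x) / (2 * m)) =
        Real.log (v x) + lam₂ (v x) - Real.log x := by field_simp
    rw [this, Real.exp_sub, Real.exp_add, Real.exp_log hvx, Real.exp_log hx]
  rw [e3, Real.log_one, zero_div, neg_zero, Real.exp_zero]
  obtain ⟨j, rfl⟩ : ∃ j, k = j + 1 := ⟨k - 1, by omega⟩
  simp only [axisChange, add_tsub_cancel_right, pow_succ x j]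
  field_simp
  ring

/-- Opposite radial velocities cancel and the coordinate change leaves -2x^k. The exponent m + k has
zero coefficient and only has to satisfy k - 1 < 2(m + k). -/
theorem pseudoFocus_even {m k : ℕ} (hm : 1 ≤ m) (hk : 2 ≤ k) (hke : Even k) :
    HasFFPseudoFocusOfOrder (spiralField (C 1 * X ^ m + C 0 * X ^ (m + k)) 0 2)
      (spiralField (C (-1) * X ^ m + C 0 * X ^ (m + k)) 1 k) k := by
  have hm0 : (m : ℝ) ≠ 0 := by positivity
  refine pseudoFocus_of_cancel hm (by omega) hk (by omega) rfl
    (tendsto_pow_nhds_zero nhdsWithin_le_nhds (by omega)) ?_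
  rw [hke.neg_one_pow]
  have : -((2 * m * (1 * 1) - 2 * m * 0 * Real.pi * 0) / (2 * m)) - 1 = (-2 : ℝ) := by
    field_simp
    norm_num
  rw [this]
  norm_num

/-- There is no coordinate change: the terms of order m cancel, and the extra s^n in the lower field
leaves πx^(2n+1). -/
theorem pseudoFocus_odd {m n : ℕ} (hm : 1 ≤ m) (hmn : m < n) :
    HasFFPseudoFocusOfOrder (spiralField (C 1 * X ^ m + C 0 * X ^ n) 0 2)
      (spiralField (C (-1) * X ^ m + C 1 * X ^ n) 0 (2 * n + 1)) (2 * n + 1) := by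
  have hm0 : (m : ℝ) ≠ 0 := by positivity
  refine pseudoFocus_of_cancel (ν := 1) hm hmn (by omega) (by omega) rfl
    (by simp) ?_
  have : -((2 * m * (0 * (-1) ^ (2 * n + 1)) - 2 * m * 1 * Real.pi * 1) / (2 * m)) - 0 =
      Real.pi := by
    field_simp
    ring
  rw [this]
  exact Real.pi_ne_zero

end SpiralPow

/-! ### Assembly of the cases. -/

open Polynomial in
theorem mainTheorem3 (k₁ k₂ : ℕ) (hk : k₂ ≤ k₁) :
    (k₁ = k₂ → ∀ k : ℕ, 1 ≤ k →
      ((∃ V₁ V₂ : ℝ × ℝ → ℝ × ℝ, HasFocusOfOrder V₁ k₁ ∧ HasFocusOfOrder V₂ k₂ ∧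
          HasFFPseudoFocusOfOrder V₁ V₂ k) ↔
        2 * k₁ + 1 ≤ k ∨ Even k)) ∧
    (k₂ < k₁ → ∀ k : ℕ, 1 ≤ k →
      ((∃ V₁ V₂ : ℝ × ℝ → ℝ × ℝ, HasFocusOfOrder V₁ k₁ ∧ HasFocusOfOrder V₂ k₂ ∧
          HasFFPseudoFocusOfOrder V₁ V₂ k) ↔
        k = 2 * k₂ + 1 ∨ (Even k ∧ k < 2 * k₂ + 1))) := by
  refine ⟨?_, fun hlt k hk1 => ⟨?_, ?_⟩⟩
  · rintro rfl k hk1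
    refine ⟨?_, fun h => ?_⟩
    · rintro ⟨V₁, V₂, h1, h2, h⟩
      rcases le_or_gt (2 * k₁ + 1) k with h' | h'
      · exact Or.inl h'
      · exact Or.inr ((h.order hk hk1 h1 h2).1 h')
    · rcases Nat.eq_zero_or_pos k₁ with rfl | hpos
      · rcases hk1.eq_or_lt with rfl | hk2
        · exact ⟨_, _, hasFocusOfOrder_spiralField_const one_ne_zero _ le_rfl,
            hasFocusOfOrder_spiralField_const one_ne_zero _ le_rfl, pseudoFocus_const_one⟩
        · exact ⟨_, _, hasFocusOfOrder_spiralField_const one_ne_zero _ le_rfl,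
            hasFocusOfOrder_spiralField_const (by norm_num) _ hk2,
            pseudoFocus_const_of_two_le hk2⟩
      · rcases Nat.even_or_odd k with he | ho
        · have hk2 : 2 ≤ k := by obtain ⟨r, rfl⟩ := he; omega
          exact ⟨_, _, hasFocusOfOrder_spiralField_pow one_ne_zero hpos (by omega) _ le_rfl,
            hasFocusOfOrder_spiralField_pow (by norm_num) hpos (by omega) _ hk2,
            pseudoFocus_even hpos hk2 he⟩
        · have hle : 2 * k₁ + 1 ≤ k := h.resolve_right (Nat.not_even_iff_odd.2 ho)
          obtain ⟨n, rfl⟩ := ho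
          rcases (show k₁ ≤ n by omega).eq_or_lt with rfl | hlt
          · exact ⟨_, _, hasFocusOfOrder_spiralField_pow one_ne_zero hpos (by omega) _ le_rfl,
              hasFocusOfOrder_spiralField_pow one_ne_zero hpos (by omega) _ le_rfl,
              pseudoFocus_pow_pow hpos le_rfl⟩
          · exact ⟨_, _, hasFocusOfOrder_spiralField_pow one_ne_zero hpos hlt _ le_rfl,
              hasFocusOfOrder_spiralField_pow (by norm_num) hpos hlt _ (by omega),
              pseudoFocus_odd hpos hlt⟩
  · rintro ⟨V₁, V₂, h1, h2, h⟩
    obtain ⟨a, b⟩ := h.order hk hk1 h1 h2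
    rcases (b hlt).eq_or_lt with h' | h'
    · exact Or.inl h'
    · exact Or.inr ⟨a h', h'⟩
  · rintro (rfl | ⟨he, hlt'⟩)
    · rcases Nat.eq_zero_or_pos k₂ with rfl | hpos
      · exact ⟨_, _, hasFocusOfOrder_spiralField_pow one_ne_zero hlt (Nat.lt_succ_self _) _ le_rfl,
          hasFocusOfOrder_spiralField_const one_ne_zero _ le_rfl, pseudoFocus_pow_const hlt⟩
      · exact ⟨_, _, hasFocusOfOrder_spiralField_pow one_ne_zero (by omega) (Nat.lt_succ_self _) _
            le_rfl,
          hasFocusOfOrder_spiralField_pow one_ne_zero hpos (Nat.lt_succ_self _) _ le_rfl,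
          pseudoFocus_pow_pow hpos hk⟩
    -- A positive even k is at least 2, as the coordinate change requires; k < 2k₂ + 1 then excludes
    -- k₂ = 0.
    · have hk2 : 2 ≤ k := by obtain ⟨r, rfl⟩ := he; omega
      have hpos : 1 ≤ k₂ := by omega
      exact ⟨_, _, hasFocusOfOrder_spiralField_pow one_ne_zero (by omega) (Nat.lt_succ_self _) _
          le_rfl,
        hasFocusOfOrder_spiralField_pow one_ne_zero hpos (Nat.lt_succ_self _) _ hk2,
        pseudoFocus_pow_pow_even hpos hlt hk2 he hlt'⟩
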